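/- **Setting.** Let $F$ be a finite unramified extension of $\mathbb Q_2$ with ring of integers $A$ (so $2$ is a uniformizer of $A$), and let $|\cdot|$ be the normalized absolute value of $F$. Let $E=F(\pi)$ be a quadratic extension with $\pi^2=2\delta$, $\delta\in A$, $\delta\equiv1 \bmod 2$; let $B$ be its ring of integers, $\sigma$ the nontrivial element of $\mathrm{Gal}(E/F)$ and $\xi=\pi\sigma(\pi)$. Let $V$ be a finite-dimensional $E$-vector space, $n=\dim_E V$, let $h$ be a nondegenerate hermitian form on $V$ (with $h(av,bw)=\sigma(a)b\,h(v,w)$), and let $L\subset V$ be a $B$-lattice with $h(L,L)\subset B$. For $i\in\mathbb Z$ put $m=\lceil i/2\rceil$ (so $i=2m$ or $i=2m-1$) and define: * $A_i=\{x\in L: h(x,L)\subset \pi^iB\}$; * $B_i=\{x\in A_i: 2^{-m}h(x,x)\equiv 0 \bmod 2\}$; * $X_i=\{x\in A_i: \pi^{-i}h(x,A_i)\subset \pi B\}$; * for $i$ even, $W_i=X_i+Be$, where $e\in A_i$ satisfies $(\xi^{-m}h(v,e))^2\equiv\xi^{-m}h(v,v)\bmod \pi$ for all $v\in A_i$; for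 $i$ odd, $W_i=X_i$; * for $i$ even, $Z_i$ is the set of $x\in B_i$ such that, with $q(x)=2^{-(m+1)}h(x,x)$, one has $q(x)\equiv0$ and $q(x+y)-q(x)-q(y)\equiv 0 \bmod 2$ for all $y\in B_i$. For a lattice $S\subset V$ put $S^\perp=\{x\in V:h(x,S)\subset B\}$. Let $L=\bigoplus_i L_i$ be a Jordan splitting: an orthogonal direct sum in which $L_i$ is $\pi^i$-modular or zero, with $L_i=0$ for all but finitely many $i\ge 0$ (and for all $i<0$). Put $n_i=\mathrm{rank}_B L_i$. For $i$ even, $L_i$ is *of type I* if $L_i\ne0$ and its norm ideal (generated by all $h(x,x)$, $x\in L_i$) equals its scale (generated by all $h(x,y)$, $x,y\in L_i$). For $i$ odd, $L_i$ is *of type I* if $A_i\neq B_i$; in that case it is *free* if neither $L_{i-1}$ nor $L_{i+1}$ is of type I. Let $H$ be the $F$-vector space of hermitian forms on $V$, so that $\dim_F\mathrm{End}_E(V)=2n^2$ and $\dim_F H=n^2$. Consider the following subsets. * $M'=\mathrm{End}_B(L)\subset \mathrm{End}_E(V)$. * $H'\subset H$ is the set of forms that are $B$-valued on $L$. * $\underline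 M(A)$ is the set of $m\in \mathrm{End}_B(L)$ which stabilize $A_i,B_i,W_i,X_i$ for all $i$ and $Z_i$ for all even $i$, and which induce the identity on $A_i/B_i$ for all $i$, on $W_i/(X_i\cap Z_i)$ for all even $i$, and on $B_i^\perp/A_i^\perp$ for all odd $i$. * $\underline H(A)$ is the set of $f\in H'$ such that: (a) $f(L,A_i)\subset\pi^iB$ for all $i$; (b) $\xi^{-m}f(a,a)\equiv\xi^{-m}h(a,a)\bmod 2$ for all $a\in A_i$, where $i=2m$ or $i=2m-1$; (c) $\pi^{-i}f(a,w)\equiv\pi^{-i}h(a,w)\bmod\pi$ for all even $i$, $a\in A_i$, $w\in W_i$; (d) $\xi^{-m}f(w,w)-\xi^{-m}h(w,w)\in(4)$ for all $i=2m$, $w\in W_i$; (e) $f(B_i,B_i^\perp)\subset B$ and $f(a,b')-h(a,b')\in B$ for all odd $i$, $a\in A_i$, $b'\in B_i^\perp$. Let $\omega_M,\omega_M'$ be translation-invariant top degree forms on $\mathrm{End}_E(V)$ and $\omega_H,\omega_H'$ translation-invariant top degree forms on $H$, normalized by $$\int_{M'}|\omega_M|=\int_{H'}|\omega_H|=\int_{\underline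 M(A)}|\omega'_M|=\int_{\underline H(A)}|\omega'_H|=1,$$ where $|\omega|$ is the measure attached to $\omega$ and to the Haar measure on $F$ giving $A$ volume $1$. Let $\rho(m)(v,w)=h(mv,mw)$ and $G=\mathrm U(V,h)=\rho^{-1}(h)$, and let $\omega^{\mathrm{ld}}=\omega_M/\rho^*\omega_H$ and $\omega^{\mathrm{can}}=\omega'_M/\rho^*\omega'_H$, where $\omega_M/\rho^*\omega_H$ denotes the restriction to $G$ of any form $\tau$ with $\omega_M=\tau\wedge\rho^*\omega_H$. **Statement.** Then $$|\omega_M|=|2|^{N_M}|\omega_M'|,\qquad N_M=\sum_{L_i\text{ of type I}}2n_i+\sum_{i<j}(j-i)n_in_j-a,$$ $$|\omega_H|=|2|^{N_H}|\omega_H'|,\qquad N_H=\sum_{L_i\text{ of type I}}n_i+\sum_{i<j}j\,n_in_j+\sum_{i\text{ even}}\frac{i+2}2n_i+\sum_{i\text{ odd}}\frac{i+3}2n_i+\sum_i d_i-a,$$ $$|\omega^{\mathrm{ld}}|=|2|^{N_M-N_H}|\omega^{\mathrm{can}}|,$$ where $a$ is the number of odd $i$ such that $L_i$ is free of type I, and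 $d_i=i\,n_i(n_i-1)/2$. The last equality holds both for the densities on the tangent spaces of $G(F)$ and for the measures on $G(F)$. -/

import Mathlib

open MeasureTheory Module
open scoped NNReal ENNReal

noncomputable section

namespace HermLat

/-! ### Local fields, rings of integers, absolute value, Haar measure -/

/-- The ring of integers `A` of a finite extension `F` of `ℚ₂`. -/
abbrev intRing (F : Type*) [NontriviallyNormedField F] [NormedAlgebra ℚ_[2] F] :
    Subalgebra (PadicInt.subring 2) F :=
  integralClosure (PadicInt.subring 2) F

/-- The ring of integers `B` of an extension `E` of `F`: the integral closure of `A` in `E`. -/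
abbrev intRingExt (F E : Type*) [NontriviallyNormedField F] [NormedAlgebra ℚ_[2] F]
    [Field E] [Algebra F E] : Subalgebra (intRing F) E :=
  integralClosure (intRing F) E

/-- The normalized absolute value of `F`, `|x| = |N_{F/ℚ₂}(x)|₂`; a uniformizer is sent to the
inverse of the cardinality of the residue field. -/
def nabs {F : Type*} [NontriviallyNormedField F] [NormedAlgebra ℚ_[2] F] (x : F) : ℝ≥0 :=
  ‖Algebra.norm ℚ_[2] x‖₊

/-- The Haar measure `dx` on `F`, normalized so that `A` has volume `1`. -/
def stdHaar (F : Type*) [NontriviallyNormedField F] [NormedAlgebra ℚ_[2] F]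
    [FiniteDimensional ℚ_[2] F] [MeasurableSpace F] [BorelSpace F] : Measure F :=
  haveI : ProperSpace F := FiniteDimensional.proper ℚ_[2] F
  (Measure.addHaar (intRing F : Set F))⁻¹ • (Measure.addHaar : Measure F)

/-! ### Translation-invariant top forms on a vector space, and their measures -/

/-- The canonical σ-algebra of a finite dimensional `F`-vector space (generated by the linear
functionals; this is the Borel σ-algebra of the usual topology). -/
abbrev linMeasurableSpace (F W : Type*) [NontriviallyNormedField F] [MeasurableSpace F]
    [AddCommGroup W] [Module F W] : MeasurableSpace W :=
  ⨆ l : Module.Dual F W, MeasurableSpace.comap l inferInstance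

open Classical in
/-- The measure `|ω|` of a translation-invariant top degree form `ω` on `W`: if `b` is a basis of
`W` with coordinates `x`, so that `ω = ω(b) dx₁ ∧ ⋯ ∧ dx_r`, then `|ω| = |ω(b)| dx₁ ⋯ dx_r`.
(The result does not depend on `b`.) -/
def formMeasure {F W ι : Type*} [NontriviallyNormedField F] [NormedAlgebra ℚ_[2] F]
    [FiniteDimensional ℚ_[2] F] [MeasurableSpace F] [BorelSpace F]
    [AddCommGroup W] [Module F W] [Fintype ι] (ω : W [⋀^ι]→ₗ[F] F) :
    @Measure W (linMeasurableSpace F W) :=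
  letI : MeasurableSpace W := linMeasurableSpace F W
  if hb : Nonempty (Basis ι F W) then
    nabs (ω hb.some) • (Measure.pi fun _ : ι => stdHaar F).map hb.some.equivFun.symm
  else 0

/-! ### Hermitian forms and hermitian lattices -/

/-- The `F`-vector space `H` of hermitian forms on `V`: the `f : V × V → E` that are `E`-linear in
the second variable and satisfy `f(w, v) = σ(f(v, w))`; so `f(av, bw) = σ(a) b f(v, w)`. -/
def hermForms {F E : Type*} [Field F] [Field E] [Algebra F E] (σ : E ≃ₐ[F] E)
    (V : Type*) [AddCommGroup V] [Module E V] : Submodule F (V → V → E) where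
  carrier := {f | (∀ v w w', f v (w + w') = f v w + f v w') ∧
    (∀ (a : E) (v w), f v (a • w) = a * f v w) ∧ (∀ v w, f w v = σ (f v w))}
  add_mem' := by
    rintro f g ⟨hf1, hf2, hf3⟩ ⟨hg1, hg2, hg3⟩
    refine ⟨fun v w w' => ?_, fun a v w => ?_, fun v w => ?_⟩
    · simp only [Pi.add_apply, hf1, hg1]
      ring
    · simp only [Pi.add_apply, hf2, hg2]
      ring
    · simp only [Pi.add_apply, hf3 v w, hg3 v w, map_add]
  zero_mem' := by
    refine ⟨fun v w w' => ?_, fun a v w => ?_, fun v w => ?_⟩ <;> simp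
  smul_mem' := by
    rintro c f ⟨hf1, hf2, hf3⟩
    refine ⟨fun v w w' => ?_, fun a v w => ?_, fun v w => ?_⟩
    · simp only [Pi.smul_apply, hf1, smul_add]
    · simp only [Pi.smul_apply, hf2, mul_smul_comm]
    · simp only [Pi.smul_apply, hf3 v w, map_smul]

instance hermCoeFun {F E : Type*} [Field F] [Field E] [Algebra F E] (σ : E ≃ₐ[F] E)
    (V : Type*) [AddCommGroup V] [Module E V] :
    CoeFun (hermForms σ V) (fun _ => V → V → E) := ⟨fun f => f.1⟩

section HermForms

variable {F E V : Type*} [Field F] [Field E] [Algebra F E] [AddCommGroup V] [Module E V]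
  {σ : E ≃ₐ[F] E} (f : hermForms σ V)

theorem herm_add_right (v w w' : V) : f v (w + w') = f v w + f v w' := f.2.1 v w w'

theorem herm_smul_right (a : E) (v w : V) : f v (a • w) = a * f v w := f.2.2.1 a v w

theorem herm_symm (v w : V) : f w v = σ (f v w) := f.2.2.2 v w

theorem herm_add_left (v v' w : V) : f (v + v') w = f v w + f v' w := by
  rw [herm_symm f w (v + v'), herm_add_right, map_add, ← herm_symm, ← herm_symm]

theorem herm_smul_left (a : E) (v w : V) : f (a • v) w = σ a * f v w := by
  rw [herm_symm f w (a • v), herm_smul_right, map_mul, ← herm_symm]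

end HermForms

section Lattice

variable {F E V : Type*} [NontriviallyNormedField F] [NormedAlgebra ℚ_[2] F]
  [Field E] [Algebra F E] [AddCommGroup V] [Module E V] {σ : E ≃ₐ[F] E}

/-- `x ∈ cB`. -/
def InIdeal (F : Type*) {E : Type*} [NontriviallyNormedField F] [NormedAlgebra ℚ_[2] F]
    [Field E] [Algebra F E] (c x : E) : Prop :=
  ∃ b ∈ intRingExt F E, x = c * b

/-- `A_i = {x ∈ L | h(x, L) ⊆ π^i B}`. -/
def latA (π : E) (h : hermForms σ V) (L : Submodule (intRingExt F E) V) (i : ℤ) : Set V :=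
  {x | x ∈ L ∧ ∀ y ∈ L, InIdeal F (π ^ i) (h x y)}

/-- `B_i`: with `i = 2m` or `i = 2m - 1`, the `x ∈ A_i` for which `2^{-m} h(x,x)` vanishes
modulo `2`. -/
def latB (π : E) (h : hermForms σ V) (L : Submodule (intRingExt F E) V) (i : ℤ) : Set V :=
  {x | x ∈ latA π h L i ∧ InIdeal F 2 ((2 : E) ^ (-((i + 1) / 2)) * h x x)}

/-- `X_i`: `X_i / π A_i` is the radical of `π^{-i} h` modulo `π` on `A_i / π A_i`. -/
def latX (π : E) (h : hermForms σ V) (L : Submodule (intRingExt F E) V) (i : ℤ) : Set V :=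
  {x | x ∈ latA π h L i ∧ ∀ y ∈ latA π h L i, InIdeal F π (π ^ (-i) * h x y)}

/-- `e ∈ A_i` represents the characteristic vector of `A_i / X_i` (`i` even):
`(ξ^{-i/2} h(v,e))² = ξ^{-i/2} h(v,v)` modulo `π` for all `v`, where `ξ = π σ(π)`. -/
def IsCharVec (π : E) (h : hermForms σ V) (L : Submodule (intRingExt F E) V) (i : ℤ) (e : V) : Prop :=
  e ∈ latA π h L i ∧ ∀ v ∈ latA π h L i,
    InIdeal F π (((π * σ π) ^ (-(i / 2)) * h v e) ^ 2 - (π * σ π) ^ (-(i / 2)) * h v v)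

open Classical in
/-- `W_i`: for `i` even `W_i / X_i` is the line (or zero) spanned by the characteristic vector,
for `i` odd `W_i = X_i`. -/
def latW (π : E) (h : hermForms σ V) (L : Submodule (intRingExt F E) V) (i : ℤ) : Set V :=
  if Even i then
    {x | ∃ e, IsCharVec π h L i e ∧ ∃ c ∈ intRingExt F E, x - c • e ∈ latX π h L i}
  else latX π h L i

/-- `Z_i` (`i = 2m` even): `Z_i / π B_i` is the radical of the quadratic form
`q(x) = 2^{-(m+1)} h(x,x)` modulo `2` on `B_i / π B_i`, that is, the set of all `x` in the radical
of the polar form `q(x+y) - q(x) - q(y)` such that `q(x) = 0`. -/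
def latZ (π : E) (h : hermForms σ V) (L : Submodule (intRingExt F E) V) (i : ℤ) : Set V :=
  {x | x ∈ latB π h L i ∧ InIdeal F 2 ((2 : E) ^ (-(i / 2 + 1)) * h x x) ∧
    ∀ y ∈ latB π h L i, InIdeal F 2
      ((2 : E) ^ (-(i / 2 + 1)) * (h (x + y) (x + y) - h x x - h y y))}

/-- The dual lattice `S^⊥ = {x ∈ V | h(x, S) ⊆ B}`. -/
def latDual (F : Type*) {E V : Type*} [NontriviallyNormedField F] [NormedAlgebra ℚ_[2] F]
    [Field E] [Algebra F E] [AddCommGroup V] [Module E V] {σ : E ≃ₐ[F] E}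
    (h : hermForms σ V) (S : Set V) : Set V :=
  {x | ∀ y ∈ S, h x y ∈ intRingExt F E}

/-! ### Jordan splittings and types -/

/-- `M` is `π^i`-modular: `h(x, M)` generates `π^i B` for each `x ∈ M` outside `π M`. -/
def IsModular (π : E) (h : hermForms σ V) (M : Submodule (intRingExt F E) V) (i : ℤ) : Prop :=
  ∀ x ∈ M, (¬ ∃ y ∈ M, x = π • y) →
    Submodule.span (intRingExt F E) {a : E | ∃ y ∈ M, a = h x y} =
      Submodule.span (intRingExt F E) {π ^ i}

/-- The scale `s(M)`. -/
def scaleIdeal (h : hermForms σ V) (M : Submodule (intRingExt F E) V) :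
    Submodule (intRingExt F E) E :=
  Submodule.span (intRingExt F E) {a : E | ∃ x ∈ M, ∃ y ∈ M, a = h x y}

/-- The norm `n(M)`. -/
def normIdeal (h : hermForms σ V) (M : Submodule (intRingExt F E) V) :
    Submodule (intRingExt F E) E :=
  Submodule.span (intRingExt F E) {a : E | ∃ x ∈ M, a = h x x}

/-- `L = ⨁ L_i` is a Jordan splitting with `L_i` a `π^i`-modular lattice (possibly zero). -/
structure IsJordanSplitting (π : E) (h : hermForms σ V) (L : Submodule (intRingExt F E) V)
    (J : ℤ → Submodule (intRingExt F E) V) : Prop where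
  modular : ∀ i, IsModular π h (J i) i
  orthogonal : ∀ i j, i ≠ j → ∀ x ∈ J i, ∀ y ∈ J j, h x y = 0
  indep : iSupIndep J
  sup_eq : ⨆ i, J i = L

/-- `L_i` is of type I. For `i` even: the parity type of `L_i` is I, that is, `L_i ≠ 0` and
`n(L_i) = s(L_i)`. For `i` odd: `A_i ≠ B_i`. -/
def IsTypeI (π : E) (h : hermForms σ V) (L : Submodule (intRingExt F E) V)
    (J : ℤ → Submodule (intRingExt F E) V) (i : ℤ) : Prop :=
  (Even i → J i ≠ ⊥ ∧ normIdeal h (J i) = scaleIdeal h (J i)) ∧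
    (¬ Even i → latA π h L i ≠ latB π h L i)

/-- For `i` odd: `L_i` is free, i.e. neither `L_{i-1}` nor `L_{i+1}` is of type I. -/
def IsFreeOdd (π : E) (h : hermForms σ V) (L : Submodule (intRingExt F E) V)
    (J : ℤ → Submodule (intRingExt F E) V) (i : ℤ) : Prop :=
  ¬ (IsTypeI π h L J (i - 1) ∨ IsTypeI π h L J (i + 1))

/-- `n_i`, the rank of `L_i` over `B`. -/
def jrank (J : ℤ → Submodule (intRingExt F E) V) (i : ℤ) : ℤ :=
  (finrank (intRingExt F E) (J i) : ℤ)

open Classical in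
/-- `a`: the number of odd `i` for which `L_i` is free of type I. -/
def numFreeOdd (π : E) (h : hermForms σ V) (L : Submodule (intRingExt F E) V)
    (J : ℤ → Submodule (intRingExt F E) V) (N : ℕ) : ℤ :=
  (((Finset.Ico (0 : ℤ) N).filter
    fun i => Odd i ∧ IsTypeI π h L J i ∧ IsFreeOdd π h L J i).card : ℤ)

open Classical in
/-- `N_M` (where `n_i = 0` unless `0 ≤ i < N`). -/
def expM (π : E) (h : hermForms σ V) (L : Submodule (intRingExt F E) V)
    (J : ℤ → Submodule (intRingExt F E) V) (N : ℕ) : ℤ :=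
  (∑ i ∈ (Finset.Ico (0 : ℤ) N).filter (IsTypeI π h L J), 2 * jrank J i)
    + (∑ i ∈ Finset.Ico (0 : ℤ) N, ∑ j ∈ Finset.Ico (i + 1) (N : ℤ),
        (j - i) * jrank J i * jrank J j)
    - numFreeOdd π h L J N

open Classical in
/-- `N_H` (where `n_i = 0` unless `0 ≤ i < N`); all the divisions are exact. -/
def expH (π : E) (h : hermForms σ V) (L : Submodule (intRingExt F E) V)
    (J : ℤ → Submodule (intRingExt F E) V) (N : ℕ) : ℤ :=
  (∑ i ∈ (Finset.Ico (0 : ℤ) N).filter (IsTypeI π h L J), jrank J i)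
    + (∑ i ∈ Finset.Ico (0 : ℤ) N, ∑ j ∈ Finset.Ico (i + 1) (N : ℤ),
        j * jrank J i * jrank J j)
    + (∑ i ∈ (Finset.Ico (0 : ℤ) N).filter (fun i => Even i), (i + 2) / 2 * jrank J i)
    + (∑ i ∈ (Finset.Ico (0 : ℤ) N).filter (fun i => Odd i), (i + 3) / 2 * jrank J i)
    + (∑ i ∈ Finset.Ico (0 : ℤ) N, (i * jrank J i * (jrank J i - 1)) / 2)
    - numFreeOdd π h L J N

/-! ### The lattices `M'`, `M(A)` in `End_E V` and the sets `H'`, `H(A)` in `H` -/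

/-- `M' = End_B(L)`, inside `End_E V`. -/
def naiveM (L : Submodule (intRingExt F E) V) : Set (Module.End E V) :=
  {m | ∀ x ∈ L, m x ∈ L}

/-- `H'`: the (`B`-valued) hermitian forms on `L`, inside `H`. -/
def naiveH (σ : E ≃ₐ[F] E) (L : Submodule (intRingExt F E) V) : Set (hermForms σ V) :=
  {f | ∀ x ∈ L, ∀ y ∈ L, f x y ∈ intRingExt F E}

/-- The `A`-points of the smooth model `M` of `End_E V`. -/
structure IsModelM (π : E) (h : hermForms σ V) (L : Submodule (intRingExt F E) V)
    (m : Module.End E V) : Prop where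
  mem_L : ∀ x ∈ L, m x ∈ L
  stab_A : ∀ i, ∀ x ∈ latA π h L i, m x ∈ latA π h L i
  stab_B : ∀ i, ∀ x ∈ latB π h L i, m x ∈ latB π h L i
  stab_W : ∀ i, ∀ x ∈ latW π h L i, m x ∈ latW π h L i
  stab_X : ∀ i, ∀ x ∈ latX π h L i, m x ∈ latX π h L i
  stab_Z : ∀ i, Even i → ∀ x ∈ latZ π h L i, m x ∈ latZ π h L i
  id_AB : ∀ i, ∀ x ∈ latA π h L i, m x - x ∈ latB π h L i
  id_WXZ : ∀ i, Even i → ∀ x ∈ latW π h L i, m x - x ∈ latX π h L i ∩ latZ π h L i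
  id_dual : ∀ i, Odd i → ∀ x ∈ latDual F h (latB π h L i),
    m x - x ∈ latDual F h (latA π h L i)

/-- `M(A)`. -/
def modelM (π : E) (h : hermForms σ V) (L : Submodule (intRingExt F E) V) : Set (Module.End E V) :=
  {m | IsModelM π h L m}

/-- The `A`-points of the smooth model `H` of the space of hermitian forms. -/
structure IsModelH (π : E) (h : hermForms σ V) (L : Submodule (intRingExt F E) V)
    (f : hermForms σ V) : Prop where
  integral : ∀ x ∈ L, ∀ y ∈ L, f x y ∈ intRingExt F E
  cond_a : ∀ i, ∀ x ∈ L, ∀ a ∈ latA π h L i, InIdeal F (π ^ i) (f x a)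
  cond_b : ∀ i m : ℤ, (i = 2 * m ∨ i = 2 * m - 1) → ∀ a ∈ latA π h L i,
    InIdeal F 2 ((π * σ π) ^ (-m) * f a a - (π * σ π) ^ (-m) * h a a)
  cond_c : ∀ i, Even i → ∀ a ∈ latA π h L i, ∀ w ∈ latW π h L i,
    InIdeal F π (π ^ (-i) * f a w - π ^ (-i) * h a w)
  cond_d : ∀ i m : ℤ, i = 2 * m → ∀ w ∈ latW π h L i,
    InIdeal F 4 ((π * σ π) ^ (-m) * f w w - (π * σ π) ^ (-m) * h w w)
  cond_e₁ : ∀ i, Odd i → ∀ b ∈ latB π h L i, ∀ b' ∈ latDual F h (latB π h L i),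
    f b b' ∈ intRingExt F E
  cond_e₂ : ∀ i, Odd i → ∀ a ∈ latA π h L i, ∀ b' ∈ latDual F h (latB π h L i),
    f a b' - h a b' ∈ intRingExt F E

/-- `H(A)`. -/
def modelH (π : E) (h : hermForms σ V) (L : Submodule (intRingExt F E) V) : Set (hermForms σ V) :=
  {f | IsModelH π h L f}

end Lattice

/-! ### The orbit map `ρ`, the unitary group, and quotient forms on it -/

section Quotient

variable {F E V : Type*} [Field F] [Field E] [Algebra F E] [AddCommGroup V] [Module E V]
  [Module F V] [IsScalarTower F E V] {σ : E ≃ₐ[F] E}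

/-- `ρ(m) = h ∘ m`, the form `(v, w) ↦ h(m v, m w)`. -/
def rho (h : hermForms σ V) (m : Module.End E V) : hermForms σ V :=
  ⟨fun v w => h (m v) (m w), fun v w w' => by beta_reduce; rw [map_add, herm_add_right],
    fun a v w => by beta_reduce; rw [map_smul, herm_smul_right], fun v w => herm_symm h (m v) (m w)⟩

/-- The differential of `ρ` at `m`: `X ↦ h(m ·, X ·) + h(X ·, m ·)`. -/
def drho (h : hermForms σ V) (m : Module.End E V) : Module.End E V →ₗ[F] hermForms σ V where
  toFun X := ⟨fun v w => h (m v) (X w) + h (X v) (m w),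
    fun v w w' => by
      beta_reduce
      rw [map_add, map_add, herm_add_right, herm_add_right]
      ring,
    fun a v w => by
      beta_reduce
      rw [map_smul, map_smul, herm_smul_right, herm_smul_right]
      ring,
    fun v w => by
      rw [map_add, ← herm_symm, ← herm_symm, add_comm]⟩
  map_add' X Y := by
    ext v w
    simp only [LinearMap.add_apply, herm_add_right, herm_add_left, Submodule.coe_add, Pi.add_apply]
    ring
  map_smul' c X := by
    ext v w
    have e1 : h (m v) (c • X w) = c • h (m v) (X w) := by
      rw [← algebraMap_smul E c (X w), herm_smul_right, Algebra.smul_def]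
    have e2 : h (c • X v) (m w) = c • h (X v) (m w) := by
      rw [← algebraMap_smul E c (X v), herm_smul_left, AlgEquiv.commutes, Algebra.smul_def]
    simp only [LinearMap.smul_apply, e1, e2, Submodule.coe_smul, RingHom.id_apply, smul_add,
      Pi.smul_apply]

/-- `drho h m` is the part of `ρ(m + X) - ρ(m)` that is linear in `X`. -/
theorem rho_add (h : hermForms σ V) (m X : Module.End E V) :
    rho h (m + X) = rho h m + drho h m X + rho h X := by
  ext v w
  simp only [rho, drho, LinearMap.add_apply, herm_add_right, herm_add_left, Submodule.coe_add,
    LinearMap.coe_mk, AddHom.coe_mk, Pi.add_apply]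
  ring

/-- The `F`-points `G(F) = ρ⁻¹(h)` of the unitary group `U(V, h)`, inside `End_E V`. -/
def unitaryPts (h : hermForms σ V) : Set (Module.End E V) := {g | rho h g = h}

/-- `X₁, …, X_d` are tangent vectors of `ρ⁻¹(h)` at `g`. -/
def IsTangent {ι : Type*} (h : hermForms σ V) (g : Module.End E V) (X : ι → Module.End E V) :
    Prop :=
  ∀ j, drho h g (X j) = 0

open Classical in
/-- The quotient form `τ = ω_M / ρ^* ω_H` on `G = ρ⁻¹(h)`, evaluated at `g ∈ G(F)` on tangent
vectors `X₁, …, X_d`. It is the restriction to `G` of any form `τ` with `ω_M = τ ∧ ρ^* ω_H`;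
explicitly
`ω_M(X₁, …, X_d, Y₁, …, Y_k) = τ_g(X₁, …, X_d) · ω_H(dρ_g Y₁, …, dρ_g Y_k)` for all `Y`.
(As `dρ_g` is onto, `Y` with `ω_H(dρ_g Y) ≠ 0` exists, and the value does not depend on it.) -/
def quotForm {ι κ : Type*} (h : hermForms σ V)
    (ωM : (Module.End E V) [⋀^(ι ⊕ κ)]→ₗ[F] F) (ωH : (hermForms σ V) [⋀^κ]→ₗ[F] F)
    (g : Module.End E V) (X : ι → Module.End E V) : F :=
  if hY : ∃ Y : κ → Module.End E V, ωH (fun j => drho h g (Y j)) ≠ 0 then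
    ωM (Sum.elim X hY.choose) / ωH (fun j => drho h g (hY.choose j))
  else 0

end Quotient

/-! ### The measure of a top degree form on the `F`-analytic manifold `G(F)` -/

section Charts

variable {F E V : Type*} [NontriviallyNormedField F] [Field E] [Algebra F E] [AddCommGroup V]
  [Module E V] [Module F V] [IsScalarTower F E V] {σ : E ≃ₐ[F] E}

/-- An analytic parametrization of an open piece of the manifold `G(F)`, which has dimension `d`:
an injective analytic immersion of an open subset of `F^d` into `End_E V` with image in `G(F)`.
Analyticity and partial derivatives are tested on linear functionals (i.e. in coordinates). -/
structure Param (h : hermForms σ V) (d : ℕ) where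
  /-- the domain -/
  source : Set (Fin d → F)
  /-- the map -/
  toFun : (Fin d → F) → Module.End E V
  /-- its partial derivatives -/
  pderiv : (Fin d → F) → Fin d → Module.End E V
  isOpen_source : IsOpen source
  mem_group : ∀ u ∈ source, toFun u ∈ unitaryPts h
  injOn : Set.InjOn toFun source
  analytic : ∀ l : Module.Dual F (Module.End E V), AnalyticOnNhd F (fun u => l (toFun u)) source
  pderiv_eq : ∀ u ∈ source, ∀ j, ∀ l : Module.Dual F (Module.End E V),
    fderiv F (fun u => l (toFun u)) u (Pi.single j 1) = l (pderiv u j)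
  immersion : ∀ u ∈ source, LinearIndependent F (pderiv u)

variable [NormedAlgebra ℚ_[2] F] [FiniteDimensional ℚ_[2] F] [MeasurableSpace F] [BorelSpace F]

/-- The measure `|τ|` on the image of one parametrization `φ`: the image under `φ` of
`|τ_{φ(u)}(∂₁φ(u), …, ∂_dφ(u))| du`. -/
def Param.measure {h : hermForms σ V} {d : ℕ} (φ : Param h d)
    (τ : Module.End E V → (Fin d → Module.End E V) → F) :
    @Measure (Module.End E V) (linMeasurableSpace F (Module.End E V)) :=
  letI : MeasurableSpace (Module.End E V) := linMeasurableSpace F (Module.End E V)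
  (((Measure.pi fun _ : Fin d => stdHaar F).restrict φ.source).withDensity
    fun u => (nabs (τ (φ.toFun u) (φ.pderiv u)) : ℝ≥0∞)).map φ.toFun

/-- The measure `|τ|` on `G(F)` (as a measure on `End_E V` carried by `G(F)`): the local measures
agree on overlaps by the change of variables formula, and `|τ|` is glued from them, i.e. it is
their supremum. -/
def groupMeasure (h : hermForms σ V) {d : ℕ}
    (τ : Module.End E V → (Fin d → Module.End E V) → F) :
    @Measure (Module.End E V) (linMeasurableSpace F (Module.End E V)) :=
  ⨆ φ : Param (F := F) h d, φ.measure τ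

end Charts

end HermLat

end

noncomputable section

namespace HermLat

set_option linter.unusedSectionVars false

/-! ### The norm and the ring of integers of the unramified field F. -/

section LocalField

variable {F : Type*} [NontriviallyNormedField F] [NormedAlgebra ℚ_[2] F]

/-! The three formulas reduce to two lattice indices. The sets `modelM` and `modelH` are translates,
by the identity and by `h`, of sublattices of End_B(L) and of the lattice of integral hermitian
forms. Invariant top degree forms on one space are proportional, so if such a sublattice has index
q^n with q = #(A/2A), which is the inverse of |2|, the normalizations force |ω| = |2|^n |ω'|
(`nabs_apply_basis_eq`). Writing ω_M = a ω_M' and ω_H = c ω_H', the quotient form is multiplied by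
the constant a / c, which settles the third formula both pointwise and for measures.

To compute the indices, a basis x of L adapted to the Jordan splitting is chosen together with its
dual basis u, scaled so that h(u_k, x_k) = π^(d k) (`IsFrame`). Since the residue field is perfect
of characteristic 2, each component can be arranged to contain at most one "leader", a basis vector
whose norm has the smallest possible valuation; all other norms are more divisible. The trace maps
π^(2m-1)B into π^(2m+2)B. Hence v ↦ h(v,v) is additive on A_i modulo π^(2m+2), and there it is the
square of the linear functional `phi` built from leader coordinates. In this way B_i, W_i, the dual
quotients and even the quadratic conditions on Z_i become linear congruences. `isModelM_iff` and
`isModelH_iff` express the two models by divisibility of matrix entries, one congruence modulo π for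
every row and every column of type I degree (for forms, rows and columns coincide), and one further
congruence for every leader of even degree.

These congruences are made triangular by selecting for each one a pivot entry (`IsPivot`), after
which the index is a product over entries (`relIndex_unipotent`). The row and the column congruence
sit at different entries, except at (t,t) when t is the pivot of its own degree. There they
coincide. In even degree the further congruence makes up for the loss; in odd degree the coincidence
occurs exactly for free components of type I, and this accounts for the term -a. For hermitian forms
one counts entries up to symmetry, with diagonal entries in F. -/

theorem norm_two_eq : ‖(2 : F)‖ = 1 / 2 := by
  have h : ‖algebraMap ℚ_[2] F 2‖ = 1 / 2 := by
    rw [norm_algebraMap', show (2 : ℚ_[2]) = ((2 : ℕ) : ℚ_[2]) by norm_num,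
      Padic.norm_p]
    norm_num
  rwa [map_ofNat] at h

theorem isUltrametricDist_of_padic : IsUltrametricDist F := by
  refine IsUltrametricDist.isUltrametricDist_of_forall_norm_natCast_le_one fun n => ?_
  have h : ‖algebraMap ℚ_[2] F n‖ ≤ 1 := by
    rw [norm_algebraMap']
    exact_mod_cast Padic.norm_int_le_one (p := 2) (n : ℤ)
  rwa [map_natCast] at h

theorem two_ne_zero_of_padic : (2 : F) ≠ 0 := by
  rw [← norm_pos_iff, norm_two_eq]
  norm_num

variable [FiniteDimensional ℚ_[2] F]

/-- If the norm exceeds 1, the leading term of a monic integral equation dominates all the others.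
Conversely the norm is the spectral norm, so norm at most 1 makes the coefficients of the minimal
polynomial integral. -/
theorem mem_intRing_iff {x : F} : x ∈ intRing F ↔ ‖x‖ ≤ 1 := by
  have := isUltrametricDist_of_padic (F := F)
  have hint : IsIntegral ℚ_[2] x := Algebra.IsIntegral.isIntegral x
  constructor
  · intro hx
    obtain ⟨p, hp, hpx⟩ := (mem_integralClosure_iff _ _).1 hx
    by_contra! hlt
    have hsum : ∑ i ∈ Finset.range p.natDegree,
        ((p.coeff i : ℚ_[2]) : ℚ_[2]) • x ^ i = -x ^ p.natDegree := by
      rw [Polynomial.eval₂_eq_sum_range, Finset.sum_range_succ, hp.coeff_natDegree, map_one,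
        one_mul] at hpx
      rw [← eq_neg_iff_add_eq_zero] at hpx
      rw [← hpx]
      refine Finset.sum_congr rfl fun i _ => ?_
      rw [Algebra.smul_def]
      rfl
    have hle : ‖-x ^ p.natDegree‖ < ‖x‖ ^ p.natDegree := by
      rw [← hsum]
      rcases Nat.eq_zero_or_pos p.natDegree with h0 | h0
      · rw [h0] at hsum ⊢
        simp at hsum
      · refine lt_of_le_of_lt (IsUltrametricDist.norm_sum_le_of_forall_le_of_nonneg
          (C := ‖x‖ ^ (p.natDegree - 1)) (by positivity) fun i hi => ?_) ?_
        · rw [norm_smul, norm_pow]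
          have h1 : ‖((p.coeff i : ℚ_[2]) : ℚ_[2])‖ ≤ 1 := (p.coeff i).2
          calc _ ≤ 1 * ‖x‖ ^ i := by gcongr
            _ = ‖x‖ ^ i := one_mul _
            _ ≤ _ := pow_le_pow_right₀ hlt.le (by have := Finset.mem_range.1 hi; omega)
        · exact pow_lt_pow_right₀ hlt (by omega)
    rw [norm_neg, norm_pow] at hle
    exact lt_irrefl _ hle
  · intro hx
    rw [NormedAlgebra.norm_eq_spectralNorm ℚ_[2] x, spectralNorm,
      spectralValue_le_one_iff (minpoly.monic hint)] at hx
    refine (mem_integralClosure_iff _ _).2 ?_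
    let T : Subring ℚ_[2] := PadicInt.subring 2
    have hc : ↑(minpoly ℚ_[2] x).coeffs ⊆ (T : Set ℚ_[2]) := by
      intro c hc
      obtain ⟨n, -, rfl⟩ := Polynomial.mem_coeffs_iff.1 hc
      exact hx n
    refine ⟨(minpoly ℚ_[2] x).toSubring T hc, (Polynomial.monic_toSubring _ _ _).2
      (minpoly.monic hint), ?_⟩
    have h := minpoly.aeval ℚ_[2] x
    rw [Polynomial.aeval_def] at h
    have e : ((minpoly ℚ_[2] x).toSubring T hc).map T.subtype = minpoly ℚ_[2] x :=
      Polynomial.map_toSubring _ _ _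
    rw [← e, Polynomial.eval₂_map] at h
    exact h

variable (hunram : Irreducible (2 : intRing F))
include hunram

/-- An x with norm strictly between 1/2 and 1 would give a factorization 2 = x · (2/x) into two
integral non-units. -/
theorem norm_le_half {x : F} (hx : ‖x‖ < 1) : ‖x‖ ≤ 1 / 2 := by
  by_contra! hlt
  have hx0 : x ≠ 0 := by
    rintro rfl
    simp at hlt
    linarith
  have h1 : x ∈ intRing F := mem_intRing_iff.2 hx.le
  have h2 : 2 / x ∈ intRing F := by
    rw [mem_intRing_iff, norm_div, norm_two_eq]
    exact (div_le_one (by linarith)).2 hlt.le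
  have h3 : (2 : intRing F) = ⟨x, h1⟩ * ⟨2 / x, h2⟩ := by
    apply Subtype.ext
    change (2 : F) = x * (2 / x)
    field_simp
  have key : ∀ y : intRing F, IsUnit y → ‖(y : F)‖ = 1 := by
    rintro y ⟨u, rfl⟩
    have e : ((u : intRing F) : F) * ((u⁻¹ : (intRing F)ˣ) : intRing F) = 1 := by
      exact_mod_cast congrArg Subtype.val u.mul_inv
    have e2 := congrArg norm e
    rw [norm_mul, norm_one] at e2
    have a1 := mem_intRing_iff.1 (u : intRing F).2
    have a2 := mem_intRing_iff.1 ((u⁻¹ : (intRing F)ˣ) : intRing F).2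
    nlinarith [norm_nonneg ((u : intRing F) : F)]
  rcases hunram.isUnit_or_isUnit h3 with h | h
  · have := key _ h
    exact absurd this hx.ne
  · have := key _ h
    change ‖2 / x‖ = 1 at this
    rw [norm_div, norm_two_eq, div_eq_one_iff_eq (by linarith)] at this
    linarith

/-- Scaling by a power of 2 brings the norm into (1/2, 1], where `norm_le_half` leaves only the
value 1. -/
theorem exists_norm_eq_zpow {x : F} (hx : x ≠ 0) : ∃ k : ℤ, ‖x‖ = (2 : ℝ) ^ k := by
  obtain ⟨k, hk1, hk2⟩ := exists_mem_Ioc_zpow (norm_pos_iff.2 hx) (one_lt_two (α := ℝ))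
  refine ⟨k + 1, le_antisymm hk2 ?_⟩
  by_contra! hlt
  have h2 : ‖x * 2 ^ (k + 1)‖ = ‖x‖ / 2 ^ (k + 1) := by
    rw [norm_mul, norm_zpow, norm_two_eq, one_div, inv_zpow, div_eq_mul_inv]
  have h3 : ‖x * 2 ^ (k + 1)‖ ≤ 1 / 2 := by
    apply norm_le_half hunram
    rw [h2, div_lt_one (by positivity)]
    exact hlt
  rw [h2, div_le_iff₀ (by positivity), zpow_add₀ (by norm_num)] at h3
  norm_num at h3
  linarith

end LocalField

/-! ### Indices of product lattices and unipotent changes of coordinates. -/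

section Index

theorem relIndex_pi_univ {ι : Type*} [Fintype ι] {M : ι → Type*} [∀ i, AddGroup (M i)]
    (G' G : ∀ i, AddSubgroup (M i)) :
    (AddSubgroup.pi Set.univ G').relIndex (AddSubgroup.pi Set.univ G) =
      ∏ i, (G' i).relIndex (G i) := by
  let f : (∀ i, G i) →+ (∀ i, M i) :=
    { toFun := fun x i => (x i : M i), map_zero' := rfl, map_add' := fun _ _ => rfl }
  have hr : f.range = AddSubgroup.pi Set.univ G := by
    ext x
    simp only [AddMonoidHom.mem_range, AddSubgroup.mem_pi, Set.mem_univ, forall_true_left]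
    exact ⟨by rintro ⟨y, rfl⟩ i; exact (y i).2, fun hx => ⟨fun i => ⟨x i, hx i⟩, rfl⟩⟩
  have hc : (AddSubgroup.pi Set.univ G').comap f =
      AddSubgroup.pi Set.univ fun i => (G' i).addSubgroupOf (G i) := by
    ext x
    simp [AddSubgroup.mem_pi, AddSubgroup.mem_addSubgroupOf, f]
  have h1 := AddSubgroup.index_comap (AddSubgroup.pi Set.univ G') f
  rw [hr, hc] at h1
  rw [← h1]
  simp only [AddSubgroup.relIndex, AddSubgroup.index]
  rw [← Nat.card_pi]
  refine Nat.card_congr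
    ((Quotient.congrRight (fun x y => ?_)).trans (Setoid.piQuotientEquiv _).symm)
  rw [QuotientAddGroup.leftRel_pi]

/-- The index of a sublattice cut out by congruences on coordinates that have been changed by a
unipotent transformation `y ↦ y + g y`; here `g y p` depends only on the coordinates of `y` whose
rank is smaller than that of `p`. -/
theorem relIndex_unipotent {ι : Type*} [Fintype ι] {M : ι → Type*} [∀ i, AddCommGroup (M i)]
    (G' G : ∀ i, AddSubgroup (M i)) (g : (∀ i, M i) →+ (∀ i, M i)) (rk : ι → ℕ)
    (hG : ∀ y, (∀ p, y p ∈ G p) → ∀ p, g y p ∈ G p)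
    (hrk : ∀ y, ∀ p, (∀ s, rk s < rk p → y s = 0) → g y p = 0) :
    ((AddSubgroup.pi Set.univ G').comap (AddMonoidHom.id _ + g)).relIndex
      (AddSubgroup.pi Set.univ G) = ∏ i, (G' i).relIndex (G i) := by
  -- The index of a preimage is an index relative to the image, so it is enough that y ↦ y + g y
  -- maps the product of the `G i` onto itself.
  rw [AddSubgroup.relIndex_comap, ← relIndex_pi_univ]
  congr 1
  apply le_antisymm
  · rintro _ ⟨y, hy, rfl⟩
    have hy' : ∀ p, y p ∈ G p := fun p => hy p (Set.mem_univ p)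
    exact fun p _ => (G p).add_mem (hy' p) (hG y hy' p)
  · intro r hr
    have hr' : ∀ p, r p ∈ G p := fun p => hr p (Set.mem_univ p)
    -- The equation y + g y = r is solved by iterating y ↦ r - g y: the coordinate p no longer
    -- changes once more than `rk p` steps have been made, because g only feeds lower ranks into it.
    let z : ℕ → ∀ i, M i := fun n => Nat.rec r (fun _ y => r - g y) n
    have hz : ∀ n, z (n + 1) = r - g (z n) := fun n => rfl
    have hzG : ∀ n p, z n p ∈ G p := by
      intro n
      induction n with
      | zero => exact hr'
      | succ n ih => exact fun p => (G p).sub_mem (hr' p) (hG _ ih p)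
    have hst : ∀ n p, rk p < n → z n p = z (n + 1) p := by
      intro n
      induction n with
      | zero => exact fun p hp => absurd hp (Nat.not_lt_zero _)
      | succ n ih =>
        intro p hp
        rw [hz (n + 1), hz n, Pi.sub_apply, Pi.sub_apply, sub_right_inj, ← sub_eq_zero,
          ← Pi.sub_apply, ← map_sub]
        refine hrk _ _ fun s hs => ?_
        rw [Pi.sub_apply, sub_eq_zero]
        exact ih s (by omega)
    let n := Finset.univ.sup rk + 1
    have hn : z n = z (n + 1) := by
      funext p
      exact hst n p (Nat.lt_succ_of_le (Finset.le_sup (Finset.mem_univ p)))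
    refine ⟨z n, fun p _ => hzG n p, ?_⟩
    rw [AddMonoidHom.add_apply, AddMonoidHom.id_apply]
    nth_rewrite 1 [hn]
    rw [hz, sub_add_cancel]

end Index

/-! ### The fractional ideals of F and the cardinality of A/2A. -/

section ResidueCard

variable {F : Type*} [NontriviallyNormedField F] [NormedAlgebra ℚ_[2] F]

variable (F) in
/-- The fractional ideal `2^j A` of `F`. -/
def dyad (j : ℤ) : AddSubgroup F where
  carrier := {x | ‖x‖ ≤ 2 ^ (-j)}
  zero_mem' := by
    simp only [Set.mem_ofPred_eq, norm_zero]
    positivity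
  add_mem' {x y} hx hy := by
    have := isUltrametricDist_of_padic (F := F)
    exact (IsUltrametricDist.norm_add_le_max x y).trans (max_le hx hy)
  neg_mem' {x} hx := by
    simpa using hx

theorem mem_dyad {x : F} {j : ℤ} : x ∈ dyad F j ↔ ‖x‖ ≤ 2 ^ (-j) := Iff.rfl

theorem dyad_mono {i j : ℤ} (h : i ≤ j) : dyad F j ≤ dyad F i := fun x hx =>
  le_trans (mem_dyad.1 hx) (zpow_le_zpow_right₀ one_le_two (by omega))

theorem mul_mem_dyad {x y : F} {i j : ℤ} (hx : x ∈ dyad F i) (hy : y ∈ dyad F j) :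
    x * y ∈ dyad F (i + j) := by
  rw [mem_dyad, norm_mul, neg_add, zpow_add₀ two_ne_zero]
  exact mul_le_mul hx hy (norm_nonneg _) (by positivity)

theorem two_zpow_mul_mem_dyad {x : F} {i j : ℤ} :
    2 ^ j * x ∈ dyad F (i + j) ↔ x ∈ dyad F i := by
  rw [mem_dyad, mem_dyad, norm_mul, norm_zpow, norm_two_eq, one_div, inv_zpow, ← zpow_neg,
    neg_add, zpow_add₀ two_ne_zero, mul_comm]
  exact mul_le_mul_iff_left₀ (by positivity)

theorem relIndex_dyad_shift (i j k : ℤ) :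
    (dyad F (i + k)).relIndex (dyad F (j + k)) = (dyad F i).relIndex (dyad F j) := by
  let f : F →+ F := AddMonoidHom.mulLeft (2 ^ k)
  have hf : Function.Injective f := mul_right_injective₀ (zpow_ne_zero k two_ne_zero_of_padic)
  have h : ∀ i, (dyad F i).map f = dyad F (i + k) := by
    intro i
    ext x
    constructor
    · rintro ⟨y, hy, rfl⟩
      exact two_zpow_mul_mem_dyad.2 hy
    · intro hx
      have e : (2 : F) ^ k * (x / 2 ^ k) = x :=
        mul_div_cancel₀ _ (zpow_ne_zero k two_ne_zero_of_padic)
      exact ⟨x / 2 ^ k, two_zpow_mul_mem_dyad.1 (by rw [e]; exact hx), e⟩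
  rw [← h i, ← h j, AddSubgroup.relIndex_map_map_of_injective _ _ hf]

theorem relIndex_dyad_padic (j : ℤ) :
    (dyad ℚ_[2] (j + 1)).relIndex (dyad ℚ_[2] j) = 2 := by
  have h := relIndex_dyad_shift (F := ℚ_[2]) 1 0 j
  rw [zero_add, add_comm 1 j] at h
  rw [h]
  let f : ℤ_[2] →+ ℚ_[2] := (PadicInt.Coe.ringHom (p := 2)).toAddMonoidHom
  have hr : f.range = dyad ℚ_[2] 0 := by
    ext x
    rw [mem_dyad, neg_zero, zpow_zero]
    exact ⟨by rintro ⟨y, rfl⟩; exact y.2, fun hx => ⟨⟨x, hx⟩, rfl⟩⟩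
  have hk : (dyad ℚ_[2] 1).comap f = (PadicInt.toZMod (p := 2)).toAddMonoidHom.ker := by
    ext x
    rw [AddMonoidHom.mem_ker]
    change ‖(x : ℚ_[2])‖ ≤ 2 ^ (-1 : ℤ) ↔ x ∈ RingHom.ker (PadicInt.toZMod (p := 2))
    rw [PadicInt.ker_toZMod, PadicInt.maximalIdeal_eq_span_p]
    have := PadicInt.norm_le_pow_iff_mem_span_pow x 1
    rw [pow_one] at this
    rw [← this]
    simp
  rw [← hr, ← AddSubgroup.index_comap, hk, AddSubgroup.index_ker]
  have hs : Function.Surjective (PadicInt.toZMod (p := 2)) := ZMod.ringHom_surjective _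
  have : (PadicInt.toZMod (p := 2)).toAddMonoidHom.range = ⊤ :=
    AddMonoidHom.range_eq_top.2 hs
  rw [this]
  simp

variable [FiniteDimensional ℚ_[2] F]

/-- `A / 2A` has `2^[F : ℚ₂]` elements. -/
theorem relIndex_dyad_zero :
    (dyad F 1).relIndex (dyad F 0) = 2 ^ finrank ℚ_[2] F := by
  let b := Module.finBasis ℚ_[2] F
  -- Λ j is 2^j times the ℤ₂-lattice spanned by a basis, so consecutive indices are visibly 2^[F :
  -- ℚ₂]. The ring A is commensurable with it, and multiplication by 2 carries the pair (Λ n₁, A) to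
  -- (Λ (n₁+1), 2A) without changing the index.
  let Λ : ℤ → AddSubgroup F := fun j =>
    (AddSubgroup.pi Set.univ fun _ => dyad ℚ_[2] j).comap b.equivFun.toAddMonoidHom
  have hmem : ∀ j x, x ∈ Λ j ↔ ∀ k, ‖b.repr x k‖ ≤ 2 ^ (-j) := by
    intro j x
    simp only [Λ, AddSubgroup.mem_comap, AddSubgroup.mem_pi, Set.mem_univ, forall_true_left,
      mem_dyad]
    rfl
  have hindex : ∀ j n : ℕ, ∀ i : ℤ, (Λ (i + n)).relIndex (Λ i) =
      ((dyad ℚ_[2] (i + n)).relIndex (dyad ℚ_[2] i)) ^ finrank ℚ_[2] F := by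
    intro _ n i
    change (AddSubgroup.comap _ _).relIndex (AddSubgroup.comap _ _) = _
    rw [AddSubgroup.relIndex_comap, AddSubgroup.map_comap_eq_self_of_surjective, relIndex_pi_univ,
      Finset.prod_const, Finset.card_univ, Fintype.card_fin]
    exact b.equivFun.surjective
  have hone : ∀ i : ℤ, (Λ (i + 1)).relIndex (Λ i) = 2 ^ finrank ℚ_[2] F := by
    intro i
    have := hindex 0 1 i
    rw [Nat.cast_one] at this
    rw [this, relIndex_dyad_padic]
  have hmono : ∀ {i j : ℤ}, i ≤ j → Λ j ≤ Λ i := fun h x hx k _ => dyad_mono h (hx k trivial)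
  have hfin : ∀ (n : ℕ) (i : ℤ), (Λ (i + n)).relIndex (Λ i) ≠ 0 := by
    intro n
    induction n with
    | zero => intro i; simp
    | succ n ih =>
      intro i
      have := AddSubgroup.relIndex_mul_relIndex (Λ (i + (n + 1 : ℕ))) (Λ (i + n)) (Λ i)
        (hmono (by push_cast; omega)) (hmono (by omega))
      rw [← this]
      refine mul_ne_zero ?_ (ih i)
      have h2 := hone (i + n)
      rw [add_assoc] at h2
      push_cast
      rw [h2]
      positivity
  obtain ⟨n₁, h₁⟩ : ∃ n : ℕ, Λ n ≤ dyad F 0 := by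
    obtain ⟨C, hC⟩ : ∃ C : ℝ, ∀ k, ‖b k‖ ≤ C := by
      obtain ⟨C, hC⟩ := (Set.finite_range fun k => ‖b k‖).bddAbove
      exact ⟨C, fun k => hC ⟨k, rfl⟩⟩
    obtain ⟨n, hn⟩ := pow_unbounded_of_one_lt C (one_lt_two (α := ℝ))
    refine ⟨n, fun x hx => ?_⟩
    rw [hmem] at hx
    rw [← b.sum_repr x]
    refine AddSubgroup.sum_mem _ fun k _ => ?_
    rw [mem_dyad, norm_smul, neg_zero, zpow_zero]
    calc _ ≤ (2 : ℝ) ^ (-(n : ℤ)) * 2 ^ n := by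
          gcongr
          · exact hx k
          · exact (hC k).trans hn.le
      _ = 1 := by
          rw [zpow_neg, zpow_natCast, inv_mul_cancel₀ (by positivity)]
  obtain ⟨n₂, h₂⟩ : ∃ n : ℕ, dyad F 0 ≤ Λ (-n) := by
    let T : F →L[ℚ_[2]] (Fin (finrank ℚ_[2] F) → ℚ_[2]) :=
      LinearMap.toContinuousLinearMap b.equivFun.toLinearMap
    obtain ⟨n, hn⟩ := pow_unbounded_of_one_lt ‖T‖ (one_lt_two (α := ℝ))
    refine ⟨n, fun x hx => ?_⟩
    rw [hmem]
    intro k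
    rw [mem_dyad, neg_zero, zpow_zero] at hx
    have h3 : ‖T x k‖ ≤ ‖T x‖ := norm_le_pi_norm (T x) k
    rw [neg_neg, zpow_natCast]
    calc _ ≤ ‖T x‖ := h3
      _ ≤ ‖T‖ * ‖x‖ := T.le_opNorm x
      _ ≤ ‖T‖ * 1 := by gcongr
      _ ≤ _ := by rw [mul_one]; exact hn.le
  have hΛfin : (Λ n₁).relIndex (dyad F 0) ≠ 0 := by
    have := hfin (n₁ + n₂) (-n₂)
    rw [show -(n₂ : ℤ) + (n₁ + n₂ : ℕ) = n₁ by push_cast; ring] at this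
    rw [← AddSubgroup.relIndex_mul_relIndex _ _ _ h₁ h₂] at this
    exact left_ne_zero_of_mul this
  have hshift : (Λ (n₁ + 1)).relIndex (dyad F 1) = (Λ n₁).relIndex (dyad F 0) := by
    let f : F →+ F := AddMonoidHom.mulLeft 2
    have hf : Function.Injective f := mul_right_injective₀ two_ne_zero_of_padic
    have e1 : (dyad F 0).map f = dyad F 1 := by
      ext x
      constructor
      · rintro ⟨y, hy, rfl⟩
        have := (two_zpow_mul_mem_dyad (j := 1)).2 hy
        rwa [zpow_one] at this
      · intro hx
        refine ⟨x / 2, (two_zpow_mul_mem_dyad (j := 1)).1 ?_,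
          mul_div_cancel₀ _ two_ne_zero_of_padic⟩
        rw [zpow_one, mul_div_cancel₀ _ two_ne_zero_of_padic]
        exact hx
    have e2 : (Λ n₁).map f = Λ (n₁ + 1) := by
      have h2 : ∀ y k, b.repr (2 * y) k = 2 * b.repr y k := by
        intro y k
        have : (2 : F) * y = (2 : ℚ_[2]) • y := by
          rw [Algebra.smul_def, map_ofNat]
        rw [this, map_smul]
        rfl
      ext x
      constructor
      · rintro ⟨y, hy, rfl⟩
        refine (hmem _ _).2 fun k => ?_
        change ‖b.repr (2 * y) k‖ ≤ _
        rw [h2]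
        have := (two_zpow_mul_mem_dyad (j := 1)).2 (mem_dyad.2 ((hmem _ _).1 hy k))
        rwa [zpow_one] at this
      · intro hx
        refine ⟨x / 2, (hmem _ _).2 fun k => ?_, mul_div_cancel₀ _ two_ne_zero_of_padic⟩
        refine mem_dyad.1 ((two_zpow_mul_mem_dyad (j := 1)).1 ?_)
        rw [zpow_one, ← h2, mul_div_cancel₀ _ two_ne_zero_of_padic]
        exact (hmem _ _).1 hx k
    rw [← e1, ← e2, AddSubgroup.relIndex_map_map_of_injective _ _ hf]
  have a1 := AddSubgroup.relIndex_mul_relIndex (Λ (n₁ + 1)) (Λ n₁) (dyad F 0)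
    (hmono (by omega)) h₁
  have h1' : Λ (n₁ + 1) ≤ dyad F 1 := by
    intro x hx
    have e : (2 : F) * (x / 2) = x := mul_div_cancel₀ _ two_ne_zero_of_padic
    rw [← e]
    have h3 : x / 2 ∈ Λ n₁ := by
      refine (hmem _ _).2 fun k => ?_
      refine mem_dyad.1 ((two_zpow_mul_mem_dyad (j := 1)).1 ?_)
      have : (2 : F) * (x / 2) = (2 : ℚ_[2]) • (x / 2) := by
        rw [Algebra.smul_def, map_ofNat]
      have h4 : b.repr x k = 2 * b.repr (x / 2) k := by
        conv_lhs => rw [← e, this, map_smul]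
        rfl
      rw [zpow_one, ← h4]
      exact (hmem _ _).1 hx k
    have := (two_zpow_mul_mem_dyad (j := 1)).2 (h₁ h3)
    rwa [zpow_one] at this
  have a2 := AddSubgroup.relIndex_mul_relIndex (Λ (n₁ + 1)) (dyad F 1) (dyad F 0) h1'
    (dyad_mono (by norm_num))
  -- The index of 2Λ in A is computed once through Λ and once through 2A; the common finite factor
  -- cancels.
  rw [hone] at a1
  rw [hshift, ← a1, mul_comm] at a2
  exact Nat.eq_of_mul_eq_mul_right (Nat.pos_of_ne_zero hΛfin) a2

theorem relIndex_dyad (j : ℤ) (n : ℕ) :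
    (dyad F (j + n)).relIndex (dyad F j) = (2 ^ finrank ℚ_[2] F) ^ n := by
  induction n with
  | zero => simp
  | succ n ih =>
    rw [← AddSubgroup.relIndex_mul_relIndex (dyad F (j + (n + 1 : ℕ))) (dyad F (j + n)) (dyad F j)
      (dyad_mono (by push_cast; omega)) (dyad_mono (by omega)), ih, pow_succ']
    congr 1
    have := relIndex_dyad_shift (F := F) 1 0 (j + n)
    rw [zero_add, relIndex_dyad_zero] at this
    rw [← this]
    congr 2
    push_cast
    ring

-- The value is the inverse of #(A/2A); this is how a lattice index turns into a power of |2|.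
omit [FiniteDimensional ℚ_[2] F] in
theorem nabs_two : nabs (2 : F) = ((2 : ℝ≥0) ^ finrank ℚ_[2] F)⁻¹ := by
  rw [nabs]
  have : Algebra.norm ℚ_[2] (2 : F) = 2 ^ finrank ℚ_[2] F := by
    have := Algebra.norm_algebraMap (S := F) (2 : ℚ_[2])
    rwa [map_ofNat] at this
  rw [this, nnnorm_pow, ← inv_pow]
  congr 1
  apply NNReal.eq
  rw [coe_nnnorm, norm_two_eq]
  simp

omit [FiniteDimensional ℚ_[2] F] in
theorem nabs_two_ne_zero : nabs (2 : F) ≠ 0 := by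
  rw [nabs_two]
  positivity

end ResidueCard

/-! ### Arithmetic of the ramified quadratic extension. -/

section Ramified

variable {F E : Type*} [NontriviallyNormedField F] [NormedAlgebra ℚ_[2] F]
  [Field E] [Algebra F E]

variable (F) in
/-- The fractional ideal `π^i B`. -/
def pideal (π : E) (i : ℤ) : AddSubgroup E where
  carrier := {x | InIdeal F (π ^ i) x}
  zero_mem' := ⟨0, zero_mem _, by simp⟩
  add_mem' := by
    rintro x y ⟨b, hb, rfl⟩ ⟨c, hc, rfl⟩
    exact ⟨b + c, add_mem hb hc, by ring⟩
  neg_mem' := by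
    rintro x ⟨b, hb, rfl⟩
    exact ⟨-b, neg_mem hb, by ring⟩

theorem mem_pideal {π x : E} {i : ℤ} : x ∈ pideal F π i ↔ InIdeal F (π ^ i) x := Iff.rfl

theorem mem_pideal_zero {π x : E} : x ∈ pideal F π 0 ↔ x ∈ intRingExt F E := by
  rw [mem_pideal]
  constructor
  · rintro ⟨b, hb, rfl⟩
    simpa using hb
  · exact fun hx => ⟨x, hx, by simp⟩

theorem mul_mem_pideal {π x y : E} (hπ : π ≠ 0) {i j : ℤ} (hx : x ∈ pideal F π i)
    (hy : y ∈ pideal F π j) : x * y ∈ pideal F π (i + j) := by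
  obtain ⟨b, hb, rfl⟩ := hx
  obtain ⟨c, hc, rfl⟩ := hy
  exact ⟨b * c, mul_mem hb hc, by rw [zpow_add₀ hπ]; ring⟩

theorem zpow_mem_pideal (π : E) (i : ℤ) : π ^ i ∈ pideal F π i :=
  ⟨1, one_mem _, by simp⟩

theorem zpow_mul_mem_pideal {π x : E} (hπ : π ≠ 0) {i j : ℤ} :
    π ^ j * x ∈ pideal F π (j + i) ↔ x ∈ pideal F π i := by
  refine ⟨fun h => ?_, fun h => mul_mem_pideal hπ (zpow_mem_pideal π j) h⟩
  have := mul_mem_pideal hπ (zpow_mem_pideal (F := F) π (-j)) h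
  rwa [← mul_assoc, ← zpow_add₀ hπ, neg_add_cancel, zpow_zero, one_mul, neg_add_cancel_left] at this

/-- The arithmetic of the ramified extension `E / F` used below. -/
structure IsRamified (F : Type*) {E : Type*} [NontriviallyNormedField F] [NormedAlgebra ℚ_[2] F]
    [Field E] [Algebra F E] (σ : E ≃ₐ[F] E) (π : E) : Prop where
  ne_zero : π ≠ 0
  map_pi : σ π = -π
  invol : ∀ x, σ (σ x) = x
  anti : ∀ {i j : ℤ}, i ≤ j → pideal F π j ≤ pideal F π i
  sub_two : (2 : E) - π ^ 2 ∈ pideal F π 4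
  inv_mem : ∀ {x}, x ∈ pideal F π 0 → x ∉ pideal F π 1 → x⁻¹ ∈ pideal F π 0
  exists_mem : ∀ x, ∃ n : ℕ, x ∈ pideal F π (-n)
  map_mem : ∀ {x i}, x ∈ pideal F π i → σ x ∈ pideal F π i
  map_sub_mem : ∀ {x i}, x ∈ pideal F π i → σ x - x ∈ pideal F π (i + 1)
  fixed : ∀ {x} {m : ℤ}, σ x = x → x ∈ pideal F π (2 * m - 1) → x ∈ pideal F π (2 * m)
  trace_mem : ∀ {x} {m : ℤ}, x ∈ pideal F π (2 * m - 1) → x + σ x ∈ pideal F π (2 * m + 2)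
  of_trace_mem : ∀ {x} {m : ℤ}, x ∈ pideal F π (2 * m) → x + σ x ∈ pideal F π (2 * m + 4) →
    x ∈ pideal F π (2 * m + 1)
  exists_sqrt : ∀ {x}, x ∈ pideal F π 0 → ∃ y ∈ pideal F π 0, x - y ^ 2 ∈ pideal F π 1
  one_notMem : (1 : E) ∉ pideal F π 1
  coord : ∃ re im : E →ₗ[F] F, ∀ i x,
    x ∈ pideal F π i ↔ re x ∈ dyad F ((i + 1) / 2) ∧ im x ∈ dyad F (i / 2)
  relIndex_succ : ∀ i, (pideal F π (i + 1)).relIndex (pideal F π i) = 2 ^ finrank ℚ_[2] F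
  relIndex_fixed : ∀ j : ℤ, (pideal F π (2 * j + 2) ⊓ (σ.toAlgHom.toLinearMap - 1).toAddMonoidHom.ker).relIndex
    (pideal F π (2 * j) ⊓ (σ.toAlgHom.toLinearMap - 1).toAddMonoidHom.ker) = 2 ^ finrank ℚ_[2] F

variable [FiniteDimensional ℚ_[2] F]

omit [FiniteDimensional ℚ_[2] F] in
theorem norm_sq_add_sq {a b : F} (h : ‖a‖ ≠ ‖b‖) : ‖a - b‖ = max ‖a‖ ‖b‖ := by
  have := isUltrametricDist_of_padic (F := F)
  rw [sub_eq_add_neg, IsUltrametricDist.norm_add_eq_max_of_norm_ne_norm (by rwa [norm_neg]), norm_neg]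

/-- Squaring is additive on the finite group A/2A and has trivial kernel, since non-integrality of
x/2 means that x is a unit; being injective, it is surjective. -/
theorem exists_sqrt_mod_two (hunram : Irreducible (2 : intRing F)) {a : F} (ha : a ∈ dyad F 0) :
    ∃ c ∈ dyad F 0, a - c ^ 2 ∈ dyad F 1 := by
  let S := (dyad F 0) ⧸ ((dyad F 1).addSubgroupOf (dyad F 0))
  have hidx : ((dyad F 1).addSubgroupOf (dyad F 0)).index ≠ 0 := by
    change (dyad F 1).relIndex (dyad F 0) ≠ 0
    rw [relIndex_dyad_zero]
    positivity
  have hfin : Finite S := by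
    have : ((dyad F 1).addSubgroupOf (dyad F 0)).FiniteIndex := ⟨hidx⟩
    exact AddSubgroup.finite_quotient_of_finiteIndex
  have h2 : ∀ x ∈ dyad F 0, 2 * x ∈ dyad F 1 := fun x hx => by
    have := (two_zpow_mul_mem_dyad (j := 1)).2 hx
    rwa [zpow_one] at this
  have hmul : ∀ x ∈ dyad F 0, ∀ y ∈ dyad F 0, x * y ∈ dyad F 0 := fun x hx y hy =>
    mul_mem_dyad hx hy
  have hsq : ∀ x ∈ dyad F 0, x ^ 2 ∈ dyad F 0 := fun x hx => by
    rw [sq]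
    exact hmul x hx x hx
  let fr : dyad F 0 →+ S :=
    { toFun := fun x => QuotientAddGroup.mk ⟨(x : F) ^ 2, hsq x x.2⟩
      map_zero' := by
        rw [QuotientAddGroup.eq_zero_iff, AddSubgroup.mem_addSubgroupOf]
        simp [zero_mem]
      map_add' := fun x y => by
        rw [← QuotientAddGroup.mk_add, QuotientAddGroup.eq, AddSubgroup.mem_addSubgroupOf]
        have e : (((-⟨((x + y : dyad F 0) : F) ^ 2, hsq _ (x + y).2⟩ + (⟨(x : F) ^ 2, hsq x x.2⟩ +
          ⟨(y : F) ^ 2, hsq y y.2⟩) : dyad F 0)) : F) = -(2 * ((x : F) * y)) := by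
            simp only [AddSubgroup.coe_add, AddSubgroup.coe_neg]
            ring
        rw [e]
        exact neg_mem (h2 _ (hmul _ x.2 _ y.2)) }
  have hker : fr.ker = (dyad F 1).addSubgroupOf (dyad F 0) := by
    ext x
    rw [AddMonoidHom.mem_ker]
    change (QuotientAddGroup.mk _ : S) = 0 ↔ _
    rw [QuotientAddGroup.eq_zero_iff, AddSubgroup.mem_addSubgroupOf, AddSubgroup.mem_addSubgroupOf,
      mem_dyad, mem_dyad]
    have hx := mem_dyad.1 x.2
    rw [norm_pow]
    have hn := norm_nonneg (x : F)
    constructor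
    · intro h
      have hl : ‖(x : F)‖ < 1 := by
        by_contra! hge
        have : (1 : ℝ) ≤ ‖(x : F)‖ ^ 2 := one_le_pow₀ hge
        norm_num at h
        linarith
      have := norm_le_half hunram hl
      norm_num
      exact this
    · intro h
      norm_num at h hx ⊢
      nlinarith
  have hinj : Function.Injective (QuotientAddGroup.lift _ fr hker.ge) := by
    rw [injective_iff_map_eq_zero]
    intro x
    induction x using QuotientAddGroup.induction_on with
    | H x =>
      intro hx
      rw [QuotientAddGroup.eq_zero_iff, ← hker]
      exact hx
  obtain ⟨x, hx⟩ := (Finite.injective_iff_surjective.1 hinj)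
    (QuotientAddGroup.mk (⟨a, ha⟩ : dyad F 0))
  induction x using QuotientAddGroup.induction_on with
  | H x =>
    refine ⟨x, x.2, ?_⟩
    have h3 : (QuotientAddGroup.mk ⟨(x : F) ^ 2, hsq x x.2⟩ : S) =
      QuotientAddGroup.mk (⟨a, ha⟩ : dyad F 0) := hx
    rw [QuotientAddGroup.eq, AddSubgroup.mem_addSubgroupOf] at h3
    have e : a - (x : F) ^ 2 = -(x : F) ^ 2 + a := by ring
    rw [e]
    exact h3

/-- The integers of `E = F(π)`: `B = A ⊕ Aπ`. -/
theorem add_mul_pi_mem_iff (hunram : Irreducible (2 : intRing F)) {π : E} {δ : intRing F}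
    (hδ1 : ‖(δ : F)‖ = 1) (hπ : π ^ 2 = algebraMap F E (2 * (δ : F))) (σ : E ≃ₐ[F] E)
    (hσπ : σ π = -π) (a b : F) :
    algebraMap F E a + algebraMap F E b * π ∈ intRingExt F E ↔
      a ∈ dyad F 0 ∧ b ∈ dyad F 0 := by
  have hA : ∀ {x : F}, x ∈ dyad F 0 ↔ x ∈ intRing F := fun {x} => by
    rw [mem_dyad, mem_intRing_iff, neg_zero, zpow_zero]
  have hint : ∀ {x : F}, x ∈ intRing F → IsIntegral (intRing F) (algebraMap F E x) := by
    intro x hx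
    exact isIntegral_algebraMap (R := intRing F) (A := E) (x := ⟨x, hx⟩)
  have hint' : ∀ {x : F}, IsIntegral (intRing F) (algebraMap F E x) → x ∈ intRing F := by
    intro x hx
    have h1 : IsIntegral (intRing F) x :=
      (isIntegral_algebraMap_iff (algebraMap F E).injective).1 hx
    exact isIntegral_trans (R := PadicInt.subring 2) (A := intRing F) x h1
  have hπi : IsIntegral (intRing F) π := by
    refine IsIntegral.of_pow (n := 2) two_pos ?_
    rw [hπ]
    exact hint (mul_mem (by rw [mem_intRing_iff, norm_two_eq]; norm_num) δ.2)
  constructor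
  · intro h
    have h1 : IsIntegral (intRing F) (algebraMap F E a + algebraMap F E b * π) := h
    have h2 : IsIntegral (intRing F) (algebraMap F E a - algebraMap F E b * π) := by
      have := h1.map (σ.toAlgHom.restrictScalars (intRing F))
      have e : (σ.toAlgHom.restrictScalars (intRing F)) (algebraMap F E a + algebraMap F E b * π) =
          algebraMap F E a - algebraMap F E b * π := by
        change σ _ = _
        rw [map_add, map_mul, σ.commutes, σ.commutes, hσπ]
        ring
      rwa [e] at this
    have h3 := h1.mul h2
    have e3 : (algebraMap F E a + algebraMap F E b * π) * (algebraMap F E a - algebraMap F E b * π)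
        = algebraMap F E (a ^ 2 - 2 * δ * b ^ 2) := by
      simp only [map_sub, map_mul, map_pow] at hπ ⊢
      linear_combination (-(algebraMap F E b) ^ 2) * hπ
    rw [e3] at h3
    have h4 := mem_intRing_iff.1 (hint' h3)
    by_cases ha0 : a = 0
    · subst ha0
      refine ⟨zero_mem _, ?_⟩
      by_cases hb0 : b = 0
      · subst hb0
        exact zero_mem _
      obtain ⟨l, hl⟩ := exists_norm_eq_zpow hunram hb0
      rw [mem_dyad, hl]
      refine zpow_le_zpow_right₀ one_le_two ?_
      norm_num at h4
      rw [hδ1, norm_two_eq, hl, ← zpow_natCast, ← zpow_mul] at h4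
      by_contra! hlt
      have : (2 : ℝ) ^ (2 : ℤ) ≤ 2 ^ (l * (2 : ℕ)) := zpow_le_zpow_right₀ one_le_two (by omega)
      norm_num at this h4
      linarith
    by_cases hb0 : b = 0
    · subst hb0
      refine ⟨?_, zero_mem _⟩
      rw [mem_dyad, neg_zero, zpow_zero]
      norm_num at h4
      exact h4
    obtain ⟨k, hk⟩ := exists_norm_eq_zpow hunram ha0
    obtain ⟨l, hl⟩ := exists_norm_eq_zpow hunram hb0
    have n1 : ‖a ^ 2‖ = (2 : ℝ) ^ (2 * k) := by
      rw [norm_pow, hk, ← zpow_natCast, ← zpow_mul]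
      congr 1
      push_cast
      ring
    have n2 : ‖2 * δ * b ^ 2‖ = (2 : ℝ) ^ (2 * l - 1) := by
      rw [norm_mul, norm_mul, norm_pow, hl, ← zpow_natCast, ← zpow_mul, norm_two_eq, hδ1,
        zpow_sub₀ two_ne_zero, mul_comm l]
      push_cast
      ring
    -- The terms of the norm a² - 2δb² have valuations of opposite parity, so they cannot cancel and
    -- each of them must be integral.
    rw [norm_sq_add_sq, n1, n2, max_le_iff] at h4
    · rw [mem_dyad, mem_dyad, hk, hl, neg_zero]
      have o1 : 2 * k ≤ 0 := by
        by_contra! h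
        exact absurd h4.1 (not_le.2 (one_lt_zpow₀ one_lt_two h))
      have o2 : 2 * l - 1 ≤ 0 := by
        by_contra! h
        exact absurd h4.2 (not_le.2 (one_lt_zpow₀ one_lt_two h))
      exact ⟨zpow_le_zpow_right₀ one_le_two (by omega), zpow_le_zpow_right₀ one_le_two (by omega)⟩
    · rw [n1, n2]
      intro h
      have := zpow_right_injective₀ (by norm_num : (0 : ℝ) < 2) (by norm_num) h
      omega
  · rintro ⟨ha, hb⟩
    exact (hint (hA.1 ha)).add ((hint (hA.1 hb)).mul hπi)

/-- In the coordinates x = a + bπ one has σ(x) = a - bπ, and π^i B is given by separate bounds on a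
and b. All properties are then read off; the fixed elements are those with b = 0, the trace is 2a,
and σ(x) - x = -2bπ. -/
theorem isRamified (hunram : Irreducible (2 : intRing F)) (hE : finrank F E = 2)
    (π : E) (δ : intRing F) (hπ : π ^ 2 = algebraMap F E (2 * (δ : F)))
    (hδ : (2 : intRing F) ∣ δ - 1) (σ : E ≃ₐ[F] E) (hσ : σ ≠ AlgEquiv.refl) :
    IsRamified F σ π := by
  have hU := isUltrametricDist_of_padic (F := F)
  have h2F : (2 : F) ≠ 0 := two_ne_zero_of_padic
  have hδsub : ∃ y ∈ dyad F 0, (δ : F) = 1 + 2 * y := by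
    obtain ⟨y, hy⟩ := hδ
    refine ⟨y, ?_, ?_⟩
    · rw [mem_dyad, neg_zero, zpow_zero]
      exact mem_intRing_iff.1 y.2
    · have := congrArg Subtype.val hy
      change (δ : F) - 1 = 2 * y at this
      linear_combination this
  have hdtwo : ∀ {x : F} {j : ℤ}, 2 * x ∈ dyad F (j + 1) ↔ x ∈ dyad F j := by
    intro x j
    have := two_zpow_mul_mem_dyad (x := x) (i := j) (j := 1)
    rwa [zpow_one] at this
  have hδ1 : ‖(δ : F)‖ = 1 := by
    obtain ⟨y, hy, e⟩ := hδsub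
    have h := mem_dyad.1 (hdtwo.2 hy)
    rw [e, IsUltrametricDist.norm_add_eq_max_of_norm_ne_norm, norm_one, max_eq_left]
    · norm_num at h ⊢
      linarith
    · rw [norm_one]
      norm_num at h ⊢
      intro h1
      linarith
  have hδmul : ∀ {x : F} {j : ℤ}, δ * x ∈ dyad F j ↔ x ∈ dyad F j := by
    intro x j
    rw [mem_dyad, mem_dyad, norm_mul, hδ1, one_mul]
  have hE2 : (2 : E) ≠ 0 := by
    rw [← map_ofNat (algebraMap F E) 2]
    exact (map_ne_zero _).2 h2F
  have hπ0 : π ≠ 0 := by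
    rintro rfl
    rw [zero_pow two_ne_zero, eq_comm, map_eq_zero, mul_eq_zero] at hπ
    rcases hπ with h | h
    · exact h2F h
    · rw [h, norm_zero] at hδ1
      exact zero_ne_one hδ1
  have hπF : ∀ a : F, algebraMap F E a ≠ π := by
    intro a ha
    rw [← ha, ← map_pow] at hπ
    have h1 := congrArg norm ((algebraMap F E).injective hπ)
    have ha0 : a ≠ 0 := by
      rintro rfl
      exact hπ0 (by rw [← ha, map_zero])
    obtain ⟨k, hk⟩ := exists_norm_eq_zpow hunram ha0
    rw [norm_pow, norm_mul, hδ1, norm_two_eq, hk, mul_one, ← zpow_natCast, ← zpow_mul,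
      show (1 / 2 : ℝ) = 2 ^ (-1 : ℤ) by norm_num] at h1
    have := zpow_right_injective₀ (by norm_num : (0 : ℝ) < 2) (by norm_num) h1
    omega
  have hfd : FiniteDimensional F E := FiniteDimensional.of_finrank_eq_succ hE
  have hli : LinearIndependent F ![(1 : E), π] := by
    rw [LinearIndependent.pair_iff]
    intro s t hst
    have ht : t = 0 := by
      by_contra ht
      refine hπF (-s / t) ?_
      rw [Algebra.smul_def, Algebra.smul_def, mul_one] at hst
      rw [map_div₀, map_neg, div_eq_iff ((map_ne_zero _).2 ht)]
      linear_combination -hst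
    subst ht
    rw [zero_smul, add_zero, Algebra.smul_def, mul_one, map_eq_zero] at hst
    exact ⟨hst, rfl⟩
  let b : Basis (Fin 2) F E := basisOfLinearIndependentOfCardEqFinrank hli (by rw [hE]; rfl)
  let re : E →ₗ[F] F := b.coord 0
  let im : E →ₗ[F] F := b.coord 1
  have hdec : ∀ x : E, x = algebraMap F E (re x) + algebraMap F E (im x) * π := by
    intro x
    conv_lhs => rw [← b.sum_repr x, Fin.sum_univ_two]
    rw [Algebra.smul_def, Algebra.smul_def]
    have e0 : b 0 = 1 := by simp [b]
    have e1 : b 1 = π := by simp [b]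
    rw [e0, e1, mul_one]
    rfl
  have hcoords : ∀ a c : F, re (algebraMap F E a + algebraMap F E c * π) = a ∧
      im (algebraMap F E a + algebraMap F E c * π) = c := by
    intro a c
    have e0 : b 0 = 1 := by simp [b]
    have e1 : b 1 = π := by simp [b]
    have : algebraMap F E a + algebraMap F E c * π = a • b 0 + c • b 1 := by
      rw [e0, e1, Algebra.smul_def, Algebra.smul_def, mul_one]
    rw [this]
    simp [re, im]
  have hext : ∀ {x y : E}, re x = re y → im x = im y → x = y := by
    intro x y h1 h2
    rw [hdec x, hdec y, h1, h2]
  have hσπ : σ π = -π := by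
    have h1 : (σ π) ^ 2 = π ^ 2 := by rw [← map_pow, hπ, σ.commutes]
    rcases sq_eq_sq_iff_eq_or_eq_neg.1 h1 with h | h
    · exfalso
      apply hσ
      ext x
      rw [hdec x, map_add, map_mul, σ.commutes, σ.commutes, h]
      rfl
    · exact h
  have hσc : ∀ x, re (σ x) = re x ∧ im (σ x) = -im x := by
    intro x
    have : σ x = algebraMap F E (re x) + algebraMap F E (-im x) * π := by
      conv_lhs => rw [hdec x, map_add, map_mul, σ.commutes, σ.commutes, hσπ]
      rw [map_neg]
      ring
    rw [this]
    exact hcoords _ _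
  have hB : ∀ x, x ∈ intRingExt F E ↔ re x ∈ dyad F 0 ∧ im x ∈ dyad F 0 := by
    intro x
    conv_lhs => rw [hdec x]
    exact add_mul_pi_mem_iff hunram hδ1 hπ σ hσπ _ _
  have hπc : ∀ x, re (π * x) = 2 * (δ * im x) ∧ im (π * x) = re x := by
    intro x
    have : π * x = algebraMap F E (2 * (δ * im x)) + algebraMap F E (re x) * π := by
      conv_lhs => rw [hdec x]
      simp only [map_mul] at hπ ⊢
      linear_combination (algebraMap F E (im x)) * hπ
    rw [this]
    exact hcoords _ _
  -- Multiplication by π sends (a, b) to (2δb, a). Hence the description for i and for i + 1 are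
  -- equivalent, and both directions of induction start from B = A ⊕ Aπ.
  have hcoord : ∀ i x, x ∈ pideal F π i ↔ re x ∈ dyad F ((i + 1) / 2) ∧ im x ∈ dyad F (i / 2) := by
    have hstep : ∀ i x, (re x ∈ dyad F ((i + 1) / 2) ∧ im x ∈ dyad F (i / 2)) ↔
        (re (π * x) ∈ dyad F ((i + 1 + 1) / 2) ∧ im (π * x) ∈ dyad F ((i + 1) / 2)) := by
      intro i x
      rw [(hπc x).1, (hπc x).2, show (i + 1 + 1) / 2 = i / 2 + 1 by omega, hdtwo, hδmul, and_comm]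
    have hstep' : ∀ i x, x ∈ pideal F π i ↔ π * x ∈ pideal F π (i + 1) := by
      intro i x
      have := zpow_mul_mem_pideal (F := F) (x := x) hπ0 (i := i) (j := 1)
      rw [zpow_one, add_comm] at this
      exact this.symm
    intro i
    induction i using Int.induction_on with
    | zero => exact fun x => mem_pideal_zero.trans (hB x)
    | succ n ih =>
      intro x
      have e : π * (π⁻¹ * x) = x := mul_inv_cancel_left₀ hπ0 x
      have h1 := hstep' n (π⁻¹ * x)
      have h2 := hstep n (π⁻¹ * x)
      rw [e] at h1 h2
      rw [← h1, ih, h2]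
    | pred n ih =>
      intro x
      have h1 := hstep' (-n - 1) x
      have h2 := hstep (-n - 1) x
      rw [sub_add_cancel] at h1 h2
      rw [h1, ih, ← h2, sub_add_cancel]
  have hre2 : ∀ x : E, re (2 * x) = 2 * re x ∧ im (2 * x) = 2 * im x := by
    intro x
    have : (2 : E) * x = (2 : F) • x := by rw [Algebra.smul_def, map_ofNat]
    rw [this, map_smul, map_smul]
    exact ⟨rfl, rfl⟩
  have hanti : ∀ {i j : ℤ}, i ≤ j → pideal F π j ≤ pideal F π i := by
    intro i j hij x hx
    rw [hcoord] at hx ⊢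
    exact ⟨dyad_mono (by omega) hx.1, dyad_mono (by omega) hx.2⟩
  have hfixim : ∀ x, σ x = x ↔ im x = 0 := by
    intro x
    constructor
    · intro h
      have := (hσc x).2
      rw [h] at this
      have h2 : 2 * im x = 0 := by linear_combination this
      exact (mul_eq_zero.1 h2).resolve_left h2F
    · intro h
      apply hext (hσc x).1
      rw [(hσc x).2, h, neg_zero]
  have hfixmem : ∀ j x, x ∈ pideal F π (2 * j) ⊓ (σ.toAlgHom.toLinearMap - 1).toAddMonoidHom.ker ↔
      re x ∈ dyad F j ∧ im x = 0 := by
    intro j x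
    rw [AddSubgroup.mem_inf, AddMonoidHom.mem_ker]
    change _ ∧ σ x - x = 0 ↔ _
    rw [sub_eq_zero, hfixim, hcoord, show (2 * j + 1) / 2 = j by omega]
    constructor
    · exact fun h => ⟨h.1.1, h.2⟩
    · exact fun h => ⟨⟨h.1, by rw [h.2]; exact zero_mem _⟩, h.2⟩
  refine ⟨hπ0, hσπ, ?_, hanti, ?_, ?_, ?_, ?_, ?_, ?_, ?_, ?_, ?_, ?_, ⟨re, im, hcoord⟩, ?_, ?_⟩
  · intro x
    apply hext
    · rw [(hσc _).1, (hσc _).1]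
    · rw [(hσc _).2, (hσc _).2, neg_neg]
  -- Here δ = 1 + 2y, so 2 - π² = 2(1 - δ) = -4y.
  · obtain ⟨y, hy, e⟩ := hδsub
    have e2 : (2 : E) - π ^ 2 = algebraMap F E (2 * (2 * (-y))) + algebraMap F E 0 * π := by
      rw [hπ, e]
      simp only [map_mul, map_add, map_one, map_neg, map_ofNat, map_zero]
      ring
    rw [e2, hcoord, (hcoords _ _).1, (hcoords _ _).2]
    refine ⟨?_, zero_mem _⟩
    have := hdtwo.2 (hdtwo.2 (neg_mem hy))
    exact this
  · intro x hx hx1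
    rw [hcoord] at hx hx1
    norm_num at hx hx1
    have ha : ‖re x‖ = 1 := by
      have h1 := mem_dyad.1 hx.1
      rw [neg_zero, zpow_zero] at h1
      refine le_antisymm h1 ?_
      by_contra! h
      refine hx1 ?_ hx.2
      rw [mem_dyad]
      have := norm_le_half hunram h
      norm_num
      exact this
    -- n = xσ(x) is a unit because its first term is one and its second term is even; the inverse of
    -- x is σ(x)/n.
    let n : F := re x ^ 2 - 2 * δ * im x ^ 2
    have hn : ‖n‖ = 1 := by
      have h1 := mem_dyad.1 hx.2
      rw [neg_zero, zpow_zero] at h1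
      have h2 : ‖2 * δ * im x ^ 2‖ ≤ 1 / 2 := by
        rw [norm_mul, norm_mul, norm_pow, hδ1, norm_two_eq]
        have : ‖im x‖ ^ 2 ≤ 1 := pow_le_one₀ (norm_nonneg _) h1
        linarith
      have h3 : ‖re x ^ 2‖ = 1 := by rw [norm_pow, ha, one_pow]
      rw [norm_sq_add_sq, h3, max_eq_left (by linarith)]
      rw [h3]
      intro h
      linarith
    have hn0 : n ≠ 0 := by
      rw [← norm_pos_iff, hn]
      exact one_pos
    have hxinv : x⁻¹ = algebraMap F E (re x / n) + algebraMap F E (-im x / n) * π := by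
      have hmul : x * (algebraMap F E (re x) - algebraMap F E (im x) * π) = algebraMap F E n := by
        conv_lhs => rw [hdec x]
        rw [← hdec x]
        simp only [n, map_sub, map_mul, map_pow] at hπ ⊢
        linear_combination (-(algebraMap F E (im x)) ^ 2) * hπ +
          (algebraMap F E (re x) - algebraMap F E (im x) * π) * hdec x
      have hn0' : algebraMap F E n ≠ 0 := (map_ne_zero _).2 hn0
      apply inv_eq_of_mul_eq_one_right
      rw [map_div₀, map_div₀, map_neg]
      field_simp
      linear_combination hmul
    rw [hxinv, hcoord, (hcoords _ _).1, (hcoords _ _).2]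
    norm_num
    rw [mem_dyad, mem_dyad, norm_div, norm_div, hn, div_one, div_one, norm_neg]
    exact ⟨mem_dyad.1 hx.1, mem_dyad.1 hx.2⟩
  · intro x
    obtain ⟨n, hn⟩ := pow_unbounded_of_one_lt (max ‖re x‖ ‖im x‖) (one_lt_two (α := ℝ))
    refine ⟨2 * n, ?_⟩
    rw [hcoord, mem_dyad, mem_dyad, show -((-((2 * n : ℕ) : ℤ) + 1) / 2) = (n : ℤ) by omega,
      show -(-((2 * n : ℕ) : ℤ) / 2) = (n : ℤ) by omega, zpow_natCast]
    exact ⟨(le_max_left _ _).trans hn.le, (le_max_right _ _).trans hn.le⟩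
  · intro x i hx
    rw [hcoord] at hx ⊢
    rw [(hσc x).1, (hσc x).2]
    exact ⟨hx.1, neg_mem hx.2⟩
  · intro x i hx
    rw [hcoord] at hx ⊢
    rw [map_sub, map_sub, (hσc x).1, (hσc x).2, sub_self]
    refine ⟨zero_mem _, ?_⟩
    have := hdtwo.2 (neg_mem hx.2)
    have e : -im x - im x = 2 * -im x := by ring
    rw [e]
    exact dyad_mono (by omega) this
  · intro x m hσx hx
    rw [hcoord] at hx ⊢
    rw [(hfixim x).1 hσx] at hx ⊢
    exact ⟨dyad_mono (by omega) hx.1, zero_mem _⟩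
  · intro x m hx
    rw [hcoord] at hx ⊢
    rw [map_add, map_add, (hσc x).1, (hσc x).2, add_neg_cancel, ← two_mul]
    refine ⟨?_, zero_mem _⟩
    have := hdtwo.2 hx.1
    exact dyad_mono (by omega) this
  · intro x m hx hx2
    rw [hcoord] at hx hx2 ⊢
    rw [map_add, map_add, (hσc x).1, (hσc x).2, add_neg_cancel, ← two_mul,
      show (2 * m + 4 + 1) / 2 = m + 1 + 1 by omega, hdtwo] at hx2
    exact ⟨dyad_mono (by omega) hx2.1, dyad_mono (by omega) hx.2⟩
  · intro x hx
    rw [hcoord] at hx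
    norm_num at hx
    obtain ⟨c, hc, hc2⟩ := exists_sqrt_mod_two hunram hx.1
    refine ⟨algebraMap F E c + algebraMap F E 0 * π, ?_, ?_⟩
    · rw [hcoord, (hcoords _ _).1, (hcoords _ _).2]
      exact ⟨hc, zero_mem _⟩
    · have e : (algebraMap F E c + algebraMap F E 0 * π) ^ 2 =
          algebraMap F E (c ^ 2) + algebraMap F E 0 * π := by
        rw [map_zero, map_pow]
        ring
      rw [e, hcoord, map_sub, map_sub, (hcoords _ _).1, (hcoords _ _).2, sub_zero]
      norm_num
      exact ⟨hc2, hx.2⟩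
  · rw [hcoord]
    have e : (1 : E) = algebraMap F E 1 + algebraMap F E 0 * π := by simp
    rw [e, (hcoords _ _).1]
    rintro ⟨h, -⟩
    rw [mem_dyad] at h
    norm_num at h
  · let f : E →+ (Fin 2 → F) :=
      { toFun := fun x => ![re x, im x]
        map_zero' := by ext k; fin_cases k <;> simp
        map_add' := fun x y => by ext k; fin_cases k <;> simp }
    have hf : Function.Surjective f := by
      intro y
      refine ⟨algebraMap F E (y 0) + algebraMap F E (y 1) * π, ?_⟩
      ext k
      fin_cases k
      · exact (hcoords _ _).1
      · exact (hcoords _ _).2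
    have hc : ∀ i, pideal F π i =
        (AddSubgroup.pi Set.univ ![dyad F ((i + 1) / 2), dyad F (i / 2)]).comap f := by
      intro i
      ext x
      rw [hcoord]
      simp [AddSubgroup.mem_pi, f, Fin.forall_fin_two]
    intro i
    rw [hc, hc i, AddSubgroup.relIndex_comap, AddSubgroup.map_comap_eq_self_of_surjective hf,
      relIndex_pi_univ, Fin.prod_univ_two]
    simp only [Matrix.cons_val_zero, Matrix.cons_val_one]
    rcases Int.even_or_odd' i with ⟨j, rfl | rfl⟩
    · rw [show (2 * j + 1 + 1) / 2 = j + (1 : ℕ) by omega, show (2 * j + 1) / 2 = j by omega,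
        show 2 * j / 2 = j by omega, relIndex_dyad, AddSubgroup.relIndex_self, mul_one, pow_one]
    · rw [show (2 * j + 1 + 1 + 1) / 2 = j + 1 by omega, show (2 * j + 1 + 1) / 2 = j + (1 : ℕ) by omega,
        show (2 * j + 1) / 2 = j by omega, relIndex_dyad, Nat.cast_one, AddSubgroup.relIndex_self,
        one_mul, pow_one]
  · intro j
    have hc : ∀ j, pideal F π (2 * j) ⊓ (σ.toAlgHom.toLinearMap - 1).toAddMonoidHom.ker =
        (dyad F j).map (algebraMap F E).toAddMonoidHom := by
      intro j
      ext x
      rw [hfixmem]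
      constructor
      · rintro ⟨h1, h2⟩
        refine ⟨re x, h1, ?_⟩
        conv_rhs => rw [hdec x, h2, map_zero, zero_mul, add_zero]
        rfl
      · rintro ⟨a, ha, rfl⟩
        have e : algebraMap F E a = algebraMap F E a + algebraMap F E 0 * π := by simp
        change re (algebraMap F E a) ∈ _ ∧ im (algebraMap F E a) = 0
        rw [e, (hcoords _ _).1, (hcoords _ _).2]
        exact ⟨ha, rfl⟩
    rw [show 2 * j + 2 = 2 * (j + 1) by ring, hc, hc,
      AddSubgroup.relIndex_map_map_of_injective _ _ (algebraMap F E).injective]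
    have := relIndex_dyad (F := F) j 1
    rwa [Nat.cast_one, pow_one] at this

end Ramified

/-! ### Valuations in E and norms of sums of vectors. -/

section Ideals

variable {F E : Type*} [NontriviallyNormedField F] [NormedAlgebra ℚ_[2] F]
  [Field E] [Algebra F E] {σ : E ≃ₐ[F] E} {π : E}

/-- `c` generates the fractional ideal `π^n B`. -/
def IsOrd (F : Type*) {E : Type*} [NontriviallyNormedField F] [NormedAlgebra ℚ_[2] F]
    [Field E] [Algebra F E] (π c : E) (n : ℤ) : Prop :=
  c ≠ 0 ∧ c ∈ pideal F π n ∧ c⁻¹ ∈ pideal F π (-n)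

theorem isOrd_zpow (R : IsRamified F σ π) (n : ℤ) : IsOrd F π (π ^ n) n :=
  ⟨zpow_ne_zero _ R.ne_zero, zpow_mem_pideal π n, by
    rw [← zpow_neg]; exact zpow_mem_pideal π (-n)⟩

theorem IsOrd.mul (R : IsRamified F σ π) {c c' : E} {n n' : ℤ} (h : IsOrd F π c n)
    (h' : IsOrd F π c' n') : IsOrd F π (c * c') (n + n') :=
  ⟨mul_ne_zero h.1 h'.1, mul_mem_pideal R.ne_zero h.2.1 h'.2.1, by
    rw [mul_inv, neg_add]; exact mul_mem_pideal R.ne_zero h.2.2 h'.2.2⟩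

theorem IsOrd.inv {c : E} {n : ℤ} (h : IsOrd F π c n) : IsOrd F π c⁻¹ (-n) :=
  ⟨inv_ne_zero h.1, h.2.2, by rw [inv_inv, neg_neg]; exact h.2.1⟩

theorem isOrd_one : IsOrd F π (1 : E) 0 := by
  refine ⟨one_ne_zero, mem_pideal_zero.2 (one_mem _), ?_⟩
  rw [inv_one, neg_zero]
  exact mem_pideal_zero.2 (one_mem _)

theorem IsOrd.neg {c : E} {n : ℤ} (h : IsOrd F π c n) : IsOrd F π (-c) n :=
  ⟨neg_ne_zero.2 h.1, neg_mem h.2.1, by rw [inv_neg]; exact neg_mem h.2.2⟩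

theorem IsOrd.zpow (R : IsRamified F σ π) {c : E} {n : ℤ} (h : IsOrd F π c n) (m : ℤ) :
    IsOrd F π (c ^ m) (n * m) := by
  have hnat : ∀ k : ℕ, IsOrd F π (c ^ k) (n * k) := by
    intro k
    induction k with
    | zero => simpa using isOrd_one (F := F)
    | succ k ih =>
      rw [pow_succ]
      have := ih.mul R h
      push_cast
      rwa [show n * k + n = n * (k + 1 : ℤ) by ring] at this
  cases m with
  | ofNat k => simpa using hnat k
  | negSucc k =>
    rw [zpow_negSucc]
    have := (hnat (k + 1)).inv
    rwa [← mul_neg, show -((k + 1 : ℕ) : ℤ) = Int.negSucc k from rfl] at this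

theorem IsOrd.mul_mem (R : IsRamified F σ π) {c x : E} {n j : ℤ} (h : IsOrd F π c n) :
    c * x ∈ pideal F π (n + j) ↔ x ∈ pideal F π j := by
  refine ⟨fun hx => ?_, fun hx => mul_mem_pideal R.ne_zero h.2.1 hx⟩
  have := mul_mem_pideal R.ne_zero h.2.2 hx
  rwa [inv_mul_cancel_left₀ h.1, neg_add_cancel_left] at this

theorem IsOrd.mul_mem_iff (R : IsRamified F σ π) {c x : E} {n j k : ℤ} (h : IsOrd F π c n)
    (hk : k = n + j) : c * x ∈ pideal F π k ↔ x ∈ pideal F π j := by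
  rw [hk, h.mul_mem R]

theorem IsOrd.inIdeal_iff (R : IsRamified F σ π) {c x : E} {n : ℤ} (h : IsOrd F π c n) :
    InIdeal F c x ↔ x ∈ pideal F π n := by
  constructor
  · rintro ⟨b, hb, rfl⟩
    have := mul_mem_pideal R.ne_zero h.2.1 (mem_pideal_zero (F := F).2 hb)
    rwa [add_zero] at this
  · intro hx
    refine ⟨c⁻¹ * x, ?_, (mul_inv_cancel_left₀ h.1 x).symm⟩
    have := mul_mem_pideal R.ne_zero h.2.2 hx
    rwa [neg_add_cancel, mem_pideal_zero] at this

theorem isOrd_of_unit (R : IsRamified F σ π) {c : E} (h0 : c ∈ pideal F π 0)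
    (h1 : c ∉ pideal F π 1) : IsOrd F π c 0 :=
  ⟨by rintro rfl; exact h1 (zero_mem _), h0, by rw [neg_zero]; exact R.inv_mem h0 h1⟩

theorem isOrd_two (R : IsRamified F σ π) : IsOrd F π 2 2 := by
  have h1 : π ^ (-2 : ℤ) * 2 - 1 ∈ pideal F π 2 := by
    have h := mul_mem_pideal R.ne_zero (zpow_mem_pideal (F := F) π (-2)) R.sub_two
    rw [mul_sub, ← zpow_natCast, ← zpow_add₀ R.ne_zero] at h
    norm_num at h ⊢
    exact h
  have h2 : IsOrd F π (π ^ (-2 : ℤ) * 2) 0 := by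
    have hone := (isOrd_one (F := F) (π := π)).2.1
    refine isOrd_of_unit R ?_ ?_
    · have := add_mem (R.anti (by norm_num : (0 : ℤ) ≤ 2) h1) hone
      rwa [sub_add_cancel] at this
    · intro h
      refine R.one_notMem ?_
      have := sub_mem h (R.anti (by norm_num : (1 : ℤ) ≤ 2) h1)
      rwa [sub_sub_cancel] at this
  have := (isOrd_zpow R 2).mul R h2
  rwa [← mul_assoc, ← zpow_add₀ R.ne_zero, show (2 : ℤ) + -2 = 0 by norm_num, zpow_zero,
    one_mul, add_zero] at this

theorem isOrd_four (R : IsRamified F σ π) : IsOrd F π 4 4 := by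
  have := (isOrd_two R).mul R (isOrd_two R)
  norm_num at this
  exact this

theorem isOrd_xi (R : IsRamified F σ π) : IsOrd F π (π * σ π) 2 := by
  have h : IsOrd F π π 1 := by simpa using isOrd_zpow R 1
  rw [R.map_pi]
  exact h.mul R h.neg

/-- Since ξ = -π², normalizing by powers of ξ or of π differs by a sign only, which membership in an
ideal does not see. -/
theorem xi_zpow (R : IsRamified F σ π) (m : ℤ) :
    (π * σ π) ^ m = π ^ (2 * m) ∨ (π * σ π) ^ m = -π ^ (2 * m) := by
  have : π * σ π = -1 * π ^ (2 : ℤ) := by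
    rw [R.map_pi, zpow_ofNat]
    ring
  rw [this, mul_zpow, ← zpow_mul]
  rcases Int.even_or_odd m with h | h
  · rw [h.neg_one_zpow, one_mul]
    exact Or.inl rfl
  · rw [h.neg_one_zpow, neg_one_mul]
    exact Or.inr rfl

theorem map_pi_zpow (R : IsRamified F σ π) (m : ℤ) : σ (π ^ m) = π ^ m ∨ σ (π ^ m) = -π ^ m := by
  rw [map_zpow₀, R.map_pi, neg_eq_neg_one_mul, mul_zpow]
  rcases Int.even_or_odd m with h | h
  · rw [h.neg_one_zpow, one_mul]
    exact Or.inl rfl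
  · rw [h.neg_one_zpow, neg_one_mul]
    exact Or.inr rfl

theorem map_mem_iff (R : IsRamified F σ π) {x : E} {i : ℤ} :
    σ x ∈ pideal F π i ↔ x ∈ pideal F π i :=
  ⟨fun h => by have := R.map_mem h; rwa [R.invol] at this, R.map_mem⟩

theorem mul_mem_of_le (R : IsRamified F σ π) {x y : E} {i j k : ℤ} (hx : x ∈ pideal F π i)
    (hy : y ∈ pideal F π j) (h : k ≤ i + j) : x * y ∈ pideal F π k :=
  R.anti h (mul_mem_pideal R.ne_zero hx hy)

theorem mem_one_of_sq_mem (R : IsRamified F σ π) {x : E} (h0 : x ∈ pideal F π 0)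
    (h : x ^ 2 ∈ pideal F π 1) : x ∈ pideal F π 1 := by
  by_contra h1
  have hx : x ≠ 0 := by rintro rfl; exact h1 (zero_mem _)
  have := mul_mem_pideal R.ne_zero h (R.inv_mem h0 h1)
  rw [sq, mul_assoc, mul_inv_cancel₀ hx, mul_one, add_zero] at this
  exact h1 this

/-- The cross terms carry the factor 2, which has valuation 2. -/
theorem sum_sq_sub_mem (R : IsRamified F σ π) {ι : Type*} (s : Finset ι) (a : ι → E)
    (ha : ∀ t ∈ s, a t ∈ pideal F π 0) :
    (∑ t ∈ s, a t) ^ 2 - ∑ t ∈ s, a t ^ 2 ∈ pideal F π 2 := by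
  classical
  induction s using Finset.induction_on with
  | empty => simp [zero_mem]
  | insert t s ht ih =>
    rw [Finset.sum_insert ht, Finset.sum_insert ht]
    have h1 := ih fun t' h' => ha t' (Finset.mem_insert_of_mem h')
    have h2 : ∑ t ∈ s, a t ∈ pideal F π 0 :=
      AddSubgroup.sum_mem _ fun t' h' => ha t' (Finset.mem_insert_of_mem h')
    have h3 := mul_mem_of_le R (isOrd_two R).2.1
      (mul_mem_pideal R.ne_zero (ha t (Finset.mem_insert_self _ _)) h2) (k := 2) (by norm_num)
    have e : (a t + ∑ t ∈ s, a t) ^ 2 - (a t ^ 2 + ∑ t ∈ s, a t ^ 2) =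
        ((∑ t ∈ s, a t) ^ 2 - ∑ t ∈ s, a t ^ 2) + 2 * (a t * ∑ t ∈ s, a t) := by ring
    rw [e]
    exact add_mem h1 h3

variable {V : Type*} [AddCommGroup V] [Module E V]

theorem herm_sum_right (g : hermForms σ V) {ι : Type*} (s : Finset ι) (v : V) (w : ι → V) :
    g v (∑ t ∈ s, w t) = ∑ t ∈ s, g v (w t) :=
  map_sum (⟨⟨fun w => g v w, by simpa using herm_smul_right g 0 v 0⟩,
    herm_add_right g v⟩ : V →+ E) w s

theorem herm_sum_left (g : hermForms σ V) {ι : Type*} (s : Finset ι) (v : ι → V) (w : V) :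
    g (∑ t ∈ s, v t) w = ∑ t ∈ s, g (v t) w := by
  rw [herm_symm, herm_sum_right, map_sum]
  exact Finset.sum_congr rfl fun t _ => (herm_symm g w (v t)).symm

theorem herm_zero_right (g : hermForms σ V) (v : V) : g v 0 = 0 := by
  simpa using herm_smul_right g 0 v 0

theorem herm_neg_right (g : hermForms σ V) (v w : V) : g v (-w) = -g v w := by
  simpa using herm_smul_right g (-1) v w

theorem herm_neg_left (g : hermForms σ V) (v w : V) : g (-v) w = -g v w := by
  simpa using herm_smul_left g (-1) v w

theorem herm_sub_right (g : hermForms σ V) (v w w' : V) : g v (w - w') = g v w - g v w' := by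
  rw [sub_eq_add_neg, herm_add_right, herm_neg_right, sub_eq_add_neg]

theorem herm_sub_left (g : hermForms σ V) (v v' w : V) : g (v - v') w = g v w - g v' w := by
  rw [sub_eq_add_neg, herm_add_left, herm_neg_left, sub_eq_add_neg]

theorem herm_mem_symm (R : IsRamified F σ π) (g : hermForms σ V) {v w : V} {i : ℤ} :
    g v w ∈ pideal F π i ↔ g w v ∈ pideal F π i := by
  rw [herm_symm g v w, map_mem_iff R]

theorem herm_self_fixed (g : hermForms σ V) (v : V) : σ (g v v) = g v v := (herm_symm g v v).symm

theorem herm_self_mem (R : IsRamified F σ π) (g : hermForms σ V) {v : V} {m : ℤ}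
    (h : g v v ∈ pideal F π (2 * m - 1)) : g v v ∈ pideal F π (2 * m) :=
  R.fixed (herm_self_fixed g v) h

/-- The defect of additivity is the trace of g(v,w), and the trace raises the exponent from 2M - 1
to 2M + 2. This gain linearizes the quadratic conditions that define B_i and Z_i. -/
theorem herm_add_self_sub_mem (R : IsRamified F σ π) (g : hermForms σ V) {v w : V} {M : ℤ}
    (h : g v w ∈ pideal F π (2 * M - 1)) :
    g (v + w) (v + w) - g v v - g w w ∈ pideal F π (2 * M + 2) := by
  have e : g (v + w) (v + w) - g v v - g w w = g v w + σ (g v w) := by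
    rw [← herm_symm, herm_add_left, herm_add_right, herm_add_right]
    ring
  rw [e]
  exact R.trace_mem h

theorem herm_sum_self_sub_mem (R : IsRamified F σ π) (g : hermForms σ V) {ι : Type*}
    (s : Finset ι) (v : ι → V) {M : ℤ}
    (h : ∀ k l, k ≠ l → g (v k) (v l) ∈ pideal F π (2 * M - 1)) :
    g (∑ t ∈ s, v t) (∑ t ∈ s, v t) - ∑ t ∈ s, g (v t) (v t) ∈ pideal F π (2 * M + 2) := by
  classical
  induction s using Finset.induction_on with
  | empty => simp [zero_mem, herm_zero_right]
  | insert t s ht ih =>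
    rw [Finset.sum_insert ht, Finset.sum_insert ht]
    have h1 : g (v t) (∑ t ∈ s, v t) ∈ pideal F π (2 * M - 1) := by
      rw [herm_sum_right]
      exact AddSubgroup.sum_mem _ fun t' h' => h t t' (by rintro rfl; exact ht h')
    have := add_mem (herm_add_self_sub_mem R g h1) ih
    convert! this using 1
    ring

end Ideals

/-! ### Lattices in terms of a basis and its scaled dual basis. -/

section DualPairs

variable {F E : Type*} [NontriviallyNormedField F] [NormedAlgebra ℚ_[2] F]
  [Field E] [Algebra F E] {σ : E ≃ₐ[F] E} {π : E}
  {V : Type*} [AddCommGroup V] [Module E V] {K : Type*} [Fintype K]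

variable (F) in
/-- The lattice of vectors whose coordinates with respect to `b` lie in `π^{r k} B`. -/
def box (π : E) (b : Basis K E V) (r : K → ℤ) : AddSubgroup V where
  carrier := {v | ∀ k, b.repr v k ∈ pideal F π (r k)}
  zero_mem' k := by simp [zero_mem]
  add_mem' hv hw k := by
    rw [map_add, Finsupp.add_apply]
    exact add_mem (hv k) (hw k)
  neg_mem' hv k := by
    rw [map_neg, Finsupp.neg_apply]
    exact neg_mem (hv k)

theorem box_mono (R : IsRamified F σ π) {b : Basis K E V} {r s : K → ℤ} (h : ∀ k, s k ≤ r k) :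
    box F π b r ≤ box F π b s := fun _ hv k => R.anti (h k) (hv k)

theorem smul_mem_box (R : IsRamified F σ π) {b : Basis K E V} {r s : K → ℤ} {v : V} {c : E} {n : ℤ}
    (hc : c ∈ pideal F π n) (hv : v ∈ box F π b r) (h : ∀ k, s k ≤ n + r k) :
    c • v ∈ box F π b s := fun k => by
  rw [map_smul, Finsupp.smul_apply, smul_eq_mul]
  exact mul_mem_of_le R hc (hv k) (h k)

theorem smul_mem_box_zero (R : IsRamified F σ π) {b : Basis K E V} {r : K → ℤ} {v : V} {c : E}
    (hc : c ∈ pideal F π 0) (hv : v ∈ box F π b r) : c • v ∈ box F π b r :=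
  smul_mem_box R hc hv fun k => by omega

theorem basis_mem_box [DecidableEq K] {b : Basis K E V} {r : K → ℤ} {k : K}
    {c : E} (hc : c ∈ pideal F π (r k)) : c • b k ∈ box F π b r := fun l => by
  rw [map_smul, Finsupp.smul_apply, b.repr_self, smul_eq_mul, Finsupp.single_apply]
  split_ifs with h
  · subst h
    rwa [mul_one]
  · rw [mul_zero]
    exact zero_mem _

/-- Two bases of `L` that are dual to each other up to scaling by `π^{d k}`. -/
structure IsDualPair (h : hermForms σ V) (π : E) (L : Submodule (intRingExt F E) V) (d : K → ℤ)
    (x u : Basis K E V) : Prop where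
  orth : ∀ {k l}, k ≠ l → h (u k) (x l) = 0
  ord : ∀ k, IsOrd F π (h (u k) (x k)) (d k)
  mem_left : ∀ v, v ∈ L ↔ v ∈ box F π x 0
  mem_right : ∀ v, v ∈ L ↔ v ∈ box F π u 0

variable {h : hermForms σ V} {L : Submodule (intRingExt F E) V} {d : K → ℤ} {x u : Basis K E V}

theorem isOrd_map (R : IsRamified F σ π) {c : E} {n : ℤ} (hc : IsOrd F π c n) :
    IsOrd F π (σ c) n :=
  ⟨(map_ne_zero σ).2 hc.1, R.map_mem hc.2.1, by rw [← map_inv₀]; exact R.map_mem hc.2.2⟩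

/-- By this symmetry every coordinate description proved below for x holds verbatim for u. An
endomorphism can therefore be tested on coordinates with respect to u while its values are measured
in coordinates with respect to x. -/
theorem IsDualPair.swap (R : IsRamified F σ π) (D : IsDualPair h π L d x u) :
    IsDualPair h π L d u x where
  orth {k l} hkl := by rw [herm_symm, D.orth hkl.symm, map_zero]
  ord k := by
    rw [herm_symm]
    exact isOrd_map R (D.ord k)
  mem_left := D.mem_right
  mem_right := D.mem_left

theorem IsDualPair.herm_right (D : IsDualPair h π L d x u) (k : K) (v : V) :
    h (u k) v = h (u k) (x k) * x.repr v k := by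
  classical
  conv_lhs => rw [← x.sum_repr v, herm_sum_right]
  rw [Finset.sum_eq_single k]
  · rw [herm_smul_right, mul_comm]
  · intro l _ hl
    rw [herm_smul_right, D.orth hl.symm, mul_zero]
  · exact fun hk => absurd (Finset.mem_univ k) hk

theorem IsDualPair.repr_mem_iff (R : IsRamified F σ π) (D : IsDualPair h π L d x u) {k : K} {v : V}
    {n : ℤ} : x.repr v k ∈ pideal F π n ↔ h v (u k) ∈ pideal F π (d k + n) := by
  rw [herm_mem_symm R, D.herm_right, (D.ord k).mul_mem R]

theorem herm_mem_of_box (R : IsRamified F σ π) (g : hermForms σ V) {b b' : Basis K E V}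
    {r s : K → ℤ} {v w : V} {n : ℤ} (hv : v ∈ box F π b r) (hw : w ∈ box F π b' s)
    (hg : ∀ k l, ∃ e, g (b k) (b' l) ∈ pideal F π e ∧ n ≤ r k + s l + e) :
    g v w ∈ pideal F π n := by
  rw [← b.sum_repr v, ← b'.sum_repr w, herm_sum_left]
  refine AddSubgroup.sum_mem _ fun k _ => ?_
  rw [herm_sum_right]
  refine AddSubgroup.sum_mem _ fun l _ => ?_
  obtain ⟨e, he, hle⟩ := hg k l
  rw [herm_smul_left, herm_smul_right]
  have := mul_mem_pideal R.ne_zero (R.map_mem (hv k)) (mul_mem_pideal R.ne_zero (hw l) he)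
  exact R.anti (by omega) this

theorem IsDualPair.herm_mem (R : IsRamified F σ π) (D : IsDualPair h π L d x u) {r s : K → ℤ}
    {v w : V} {n : ℤ} (hv : v ∈ box F π x r) (hw : w ∈ box F π u s)
    (hn : ∀ k, n ≤ r k + s k + d k) : h v w ∈ pideal F π n := by
  refine herm_mem_of_box R h hv hw fun k l => ?_
  by_cases hkl : k = l
  · subst hkl
    refine ⟨d k, ?_, hn k⟩
    rw [herm_mem_symm R]
    exact (D.ord k).2.1
  · refine ⟨n - r k - s l, ?_, by omega⟩
    rw [herm_symm, D.orth (Ne.symm hkl), map_zero]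
    exact zero_mem _

/-- Pairing with `u k` reads off the k-th coordinate up to a factor of valuation `d k`, so h(v, L) ⊂
π^i B bounds each coordinate separately. -/
theorem IsDualPair.mem_latA (R : IsRamified F σ π) (D : IsDualPair h π L d x u) {i : ℤ} {v : V} :
    v ∈ latA π h L i ↔ v ∈ box F π x fun k => max 0 (i - d k) := by
  classical
  constructor
  · rintro ⟨hv, hvL⟩ k
    have h1 := (D.mem_left v).1 hv k
    have hu : u k ∈ L := by
      rw [D.mem_right, ← one_smul E (u k)]
      exact basis_mem_box (isOrd_one).2.1
    have h2 : h v (u k) ∈ pideal F π (d k + (i - d k)) := by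
      rw [add_sub_cancel]
      exact hvL _ hu
    rw [← D.repr_mem_iff R] at h2
    rcases le_total 0 (i - d k) with hle | hle
    · simpa only [max_eq_right hle] using h2
    · simp only [max_eq_left hle]
      exact h1
  · intro hv
    refine ⟨(D.mem_left v).2 (box_mono R (fun k => le_max_left _ _) hv), fun y hy => ?_⟩
    refine D.herm_mem R hv ((D.mem_right y).1 hy) fun k => ?_
    have := le_max_right 0 (i - d k)
    simp only [Pi.zero_apply]
    omega

/-- The exponents of the coordinates of the vectors of `X_i`. -/
def expX (i d : ℤ) : ℤ := if d = i then 1 else max 0 (i - d)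

theorem mem_latX_iff (R : IsRamified F σ π) {i : ℤ} {v : V} :
    v ∈ latX π h L i ↔ v ∈ latA π h L i ∧ ∀ y ∈ latA π h L i, h v y ∈ pideal F π (i + 1) := by
  refine and_congr_right fun _ => forall₂_congr fun y _ => ?_
  have : IsOrd F π π 1 := by simpa using isOrd_zpow R 1
  rw [this.inIdeal_iff R, (isOrd_zpow R (-i)).mul_mem_iff R (show (1 : ℤ) = -i + (i + 1) by ring)]

/-- Only the coordinates of degree i are constrained beyond A_i: for `d k = i` the vector `u k` lies
in A_i and can be used as a test vector, and for other degrees the pairing on A_i already gains a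
factor π. -/
theorem IsDualPair.mem_latX (R : IsRamified F σ π) (D : IsDualPair h π L d x u) {i : ℤ} {v : V} :
    v ∈ latX π h L i ↔ v ∈ box F π x fun k => expX i (d k) := by
  classical
  rw [mem_latX_iff R]
  constructor
  · rintro ⟨hv, hvA⟩ k
    have h1 := (D.mem_latA R).1 hv k
    by_cases hk : d k = i
    · have hu : u k ∈ latA π h L i := by
        rw [(D.swap R).mem_latA R, ← one_smul E (u k)]
        refine basis_mem_box ?_
        rw [hk, sub_self, max_self]
        exact (isOrd_one).2.1
      have h2 := hvA _ hu
      rw [← hk, ← D.repr_mem_iff R] at h2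
      simpa [expX, hk] using h2
    · simpa [expX, hk] using h1
  · intro hv
    have hvA : v ∈ latA π h L i := by
      rw [D.mem_latA R]
      refine box_mono R (fun k => ?_) hv
      unfold expX
      split_ifs <;> omega
    refine ⟨hvA, fun y hy => ?_⟩
    refine D.herm_mem R hv (((D.swap R).mem_latA R).1 hy) fun k => ?_
    unfold expX
    split_ifs <;> omega

/-- The lattice A_i is spanned by multiples of the `u k`, and max 0 (i - d) + d = max i d. -/
theorem IsDualPair.mem_latDual_latA (R : IsRamified F σ π) (D : IsDualPair h π L d x u) {i : ℤ}
    {v : V} : v ∈ latDual F h (latA π h L i) ↔ v ∈ box F π x fun k => -max i (d k) := by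
  classical
  constructor
  · intro hv k
    have hu : π ^ (max 0 (i - d k)) • u k ∈ latA π h L i := by
      rw [(D.swap R).mem_latA R]
      exact basis_mem_box (zpow_mem_pideal π _)
    have h1 := mem_pideal_zero (π := π).2 (hv _ hu)
    rw [herm_smul_right, (isOrd_zpow R _).mul_mem_iff R
      (show 0 = max 0 (i - d k) + (d k + -max i (d k)) by omega), ← D.repr_mem_iff R] at h1
    exact h1
  · intro hv y hy
    rw [← mem_pideal_zero (π := π)]
    refine D.herm_mem R hv (((D.swap R).mem_latA R).1 hy) fun k => ?_
    omega

end DualPairs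

/-! ### Leaders, and the norm as the square of a linear functional. -/

section Frames

variable {F E : Type*} [NontriviallyNormedField F] [NormedAlgebra ℚ_[2] F]
  [Field E] [Algebra F E] {σ : E ≃ₐ[F] E} {π : E}
  {V : Type*} [AddCommGroup V] [Module E V] {K : Type*} [Fintype K]

/-- Coordinates adapted to a Jordan splitting: `x` is a basis of `L` (the vector `x k` lies in the
component of index `d k`), `u` is the dual basis up to scaling, and `T` consists of the
indices `k` for which `h (x k) (x k)` generates the largest possible ideal; at most one for each
component. -/
structure IsFrame (h : hermForms σ V) (π : E) (L : Submodule (intRingExt F E) V) (d : K → ℤ)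
    (x u : Basis K E V) (T : Finset K) : Prop extends IsDualPair h π L d x u where
  pairing : ∀ k, h (u k) (x k) = π ^ d k
  gram_orth : ∀ {k l}, d k ≠ d l → h (x k) (x l) = 0
  gram_mem : ∀ {k l}, d k = d l → h (x k) (x l) ∈ pideal F π (d k)
  leader_inj : ∀ {k l}, k ∈ T → l ∈ T → d k = d l → k = l
  leader_norm : ∀ {k}, k ∈ T → h (x k) (x k) - π ^ (2 * ((d k + 1) / 2)) ∈
    pideal F π (2 * ((d k + 1) / 2) + 1)
  nonleader_norm : ∀ {k}, k ∉ T → h (x k) (x k) ∈ pideal F π (2 * ((d k + 1) / 2) + 1)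

variable {h : hermForms σ V} {L : Submodule (intRingExt F E) V} {d : K → ℤ} {x u : Basis K E V}
  {T : Finset K}

/-- Modulo a higher power of `π`, the norm of a vector is a square of a linear functional. -/
theorem IsFrame.norm_sub_mem (R : IsRamified F σ π) (f : IsFrame h π L d x u T) {r : K → ℤ} {M : ℤ}
    {v : V} (hv : v ∈ box F π x r) (h1 : ∀ k, 2 * M - 1 ≤ 2 * r k + d k)
    (h2 : ∀ k, M ≤ r k + (d k + 1) / 2) :
    h v v - π ^ (2 * M) * (∑ t ∈ T with r t + (d t + 1) / 2 = M, π ^ (-r t) * x.repr v t) ^ 2 ∈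
      pideal F π (2 * M + 1) := by
  classical
  -- The off-diagonal Gram entries contribute traces only; for two indices of equal degree the
  -- hypothesis `h1` is applied to the one with the smaller exponent r.
  have hoff := herm_sum_self_sub_mem R h Finset.univ (fun k => x.repr v k • x k) (M := M) (by
    intro k l _
    rw [herm_smul_left, herm_smul_right]
    by_cases hd : d k = d l
    · by_cases hr : r k ≤ r l
      · have := mul_mem_pideal R.ne_zero (R.map_mem (hv k))
          (mul_mem_pideal R.ne_zero (hv l) (f.gram_mem hd))
        exact R.anti (by have := h1 k; omega) this
      · have := mul_mem_pideal R.ne_zero (R.map_mem (hv k))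
          (mul_mem_pideal R.ne_zero (hv l) (f.gram_mem hd))
        exact R.anti (by have := h1 l; omega) this
    · rw [f.gram_orth hd, mul_zero, mul_zero]
      exact zero_mem _)
  rw [x.sum_repr] at hoff
  -- Modulo π^(2M+1) one may replace σ(a)a by a². Non-leaders and leaders with r + ⌈d/2⌉ > M then
  -- vanish, and the remaining leaders have norm congruent to an even power of π.
  have hterm : ∀ k, h (x.repr v k • x k) (x.repr v k • x k) -
      (if k ∈ T ∧ r k + (d k + 1) / 2 = M then π ^ (2 * M) * (π ^ (-r k) * x.repr v k) ^ 2 else 0) ∈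
      pideal F π (2 * M + 1) := by
    intro k
    have hlow : h (x k) (x k) ∈ pideal F π (2 * ((d k + 1) / 2)) := by
      refine herm_self_mem R h (R.anti ?_ (f.gram_mem rfl))
      omega
    have e1 : h (x.repr v k • x k) (x.repr v k • x k) - x.repr v k ^ 2 * h (x k) (x k) ∈
        pideal F π (2 * M + 1) := by
      have e : h (x.repr v k • x k) (x.repr v k • x k) - x.repr v k ^ 2 * h (x k) (x k) =
          (σ (x.repr v k) - x.repr v k) * (x.repr v k * h (x k) (x k)) := by
        rw [herm_smul_left, herm_smul_right]
        ring
      rw [e]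
      refine mul_mem_of_le R (R.map_sub_mem (hv k)) (mul_mem_pideal R.ne_zero (hv k) hlow) ?_
      have := h2 k
      omega
    have hsq : x.repr v k ^ 2 ∈ pideal F π (r k + r k) := by
      rw [sq]
      exact mul_mem_pideal R.ne_zero (hv k) (hv k)
    have e2 : x.repr v k ^ 2 * h (x k) (x k) - (if k ∈ T ∧ r k + (d k + 1) / 2 = M then
        π ^ (2 * M) * (π ^ (-r k) * x.repr v k) ^ 2 else 0) ∈ pideal F π (2 * M + 1) := by
      have h2k := h2 k
      split_ifs with hk
      · have e : π ^ (2 * M) * (π ^ (-r k) * x.repr v k) ^ 2 =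
            x.repr v k ^ 2 * π ^ (2 * ((d k + 1) / 2)) := by
          rw [mul_pow, ← zpow_natCast, ← zpow_mul, ← mul_assoc, ← zpow_add₀ R.ne_zero, mul_comm]
          congr 2
          push_cast
          omega
        rw [e, ← mul_sub]
        exact mul_mem_of_le R hsq (f.leader_norm hk.1) (by omega)
      · rw [sub_zero]
        by_cases hkT : k ∈ T
        · have hne : r k + (d k + 1) / 2 ≠ M := fun e => hk ⟨hkT, e⟩
          exact mul_mem_of_le R hsq hlow (by omega)
        · exact mul_mem_of_le R hsq (f.nonleader_norm hkT) (by omega)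
    have := add_mem e1 e2
    rwa [sub_add_sub_cancel] at this
  have hsum := AddSubgroup.sum_mem _ fun k (_ : k ∈ Finset.univ) => hterm k
  rw [Finset.sum_sub_distrib, ← Finset.sum_filter] at hsum
  have hfil : (Finset.univ.filter fun k => k ∈ T ∧ r k + (d k + 1) / 2 = M) =
      T.filter fun t => r t + (d t + 1) / 2 = M := by
    ext
    simp
  rw [hfil, ← Finset.mul_sum] at hsum
  -- In residue characteristic 2 a sum of squares is the square of the sum.
  have hsquare := sum_sq_sub_mem R (T.filter fun t => r t + (d t + 1) / 2 = M)
    (fun t => π ^ (-r t) * x.repr v t) fun t _ => by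
      have := (isOrd_zpow R (-r t)).mul_mem R (x := x.repr v t) (j := r t)
      rw [neg_add_cancel] at this
      exact this.2 (hv t)
  have h3 := mul_mem_pideal R.ne_zero (zpow_mem_pideal (F := F) π (2 * M)) hsquare
  have := sub_mem (add_mem (R.anti (by omega) hoff) hsum) (R.anti (by omega : 2 * M + 1 ≤ 2 * M + 2) h3)
  convert! this using 1
  ring

/-- A norm is fixed by σ and so has even valuation: lying in π^(2M+1)B already means lying in
π^(2M+2)B. Modulo π the vanishing of a square is the vanishing of its root, which gives a linear
condition. -/
theorem IsFrame.norm_mem_iff (R : IsRamified F σ π) (f : IsFrame h π L d x u T) {r : K → ℤ} {M : ℤ}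
    {v : V} (hv : v ∈ box F π x r) (h1 : ∀ k, 2 * M - 1 ≤ 2 * r k + d k)
    (h2 : ∀ k, M ≤ r k + (d k + 1) / 2) :
    h v v ∈ pideal F π (2 * M + 2) ↔
      ∑ t ∈ T with r t + (d t + 1) / 2 = M, π ^ (-r t) * x.repr v t ∈ pideal F π 1 := by
  have hn := f.norm_sub_mem R hv h1 h2
  set S := ∑ t ∈ T with r t + (d t + 1) / 2 = M, π ^ (-r t) * x.repr v t with hS
  have hS0 : S ∈ pideal F π 0 := AddSubgroup.sum_mem _ fun t _ => by
    have := (isOrd_zpow R (-r t)).mul_mem R (x := x.repr v t) (j := r t)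
    rw [neg_add_cancel] at this
    exact this.2 (hv t)
  have e1 : h v v ∈ pideal F π (2 * M + 2) ↔ h v v ∈ pideal F π (2 * M + 1) := by
    refine ⟨fun h => R.anti (by omega) h, fun hh => ?_⟩
    have := herm_self_mem R h (m := M + 1) (v := v) (by
      rwa [show 2 * (M + 1) - 1 = 2 * M + 1 by ring])
    rwa [show 2 * (M + 1) = 2 * M + 2 by ring] at this
  have e2 : h v v ∈ pideal F π (2 * M + 1) ↔ π ^ (2 * M) * S ^ 2 ∈ pideal F π (2 * M + 1) := by
    constructor
    · intro hh
      have := sub_mem hh hn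
      rwa [sub_sub_cancel] at this
    · intro hh
      have := add_mem hn hh
      rwa [sub_add_cancel] at this
  rw [e1, e2, (isOrd_zpow R _).mul_mem R]
  refine ⟨mem_one_of_sq_mem R hS0, fun hh => ?_⟩
  rw [sq]
  exact mul_mem_of_le R hh hS0 (by omega)

open Classical in
/-- The leaders that contribute to `h(v,v)` on `A_i / B_i`. -/
def near (d : K → ℤ) (T : Finset K) (i : ℤ) : Finset K :=
  T.filter fun t => max 0 (i - d t) + (d t + 1) / 2 = (i + 1) / 2

/-- The norm of the multiple of a leader that lies in A_i has valuation 2(max 0 (i - d) + ⌈d/2⌉).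
For odd i the value 2⌈i/2⌉ is also attained by leaders in the two adjacent even degrees; this is the
source of bound (non-free) components. -/
theorem mem_near {d : K → ℤ} {T : Finset K} {i : ℤ} {t : K} :
    t ∈ near d T i ↔ t ∈ T ∧ (d t = i ∨ (Odd i ∧ (d t = i - 1 ∨ d t = i + 1))) := by
  rw [near, Finset.mem_filter]
  refine and_congr_right fun _ => ?_
  rcases Int.even_or_odd' i with ⟨j, rfl | rfl⟩
  · have : ¬ Odd (2 * j) := by simp
    simp only [this, false_and, or_false]
    omega
  · have : Odd (2 * j + 1) := odd_two_mul_add_one j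
    simp only [this, true_and]
    omega

/-- The linear functional on `A_i` whose square is `2^{-m} h(v,v)` modulo `π`. -/
def phi (π : E) (d : K → ℤ) (x : Basis K E V) (T : Finset K) (i : ℤ) : V →ₗ[E] E :=
  ∑ t ∈ near d T i, π ^ (-max 0 (i - d t)) • x.coord t

theorem phi_apply (i : ℤ) (v : V) :
    phi π d x T i v = ∑ t ∈ near d T i, π ^ (-max 0 (i - d t)) * x.repr v t := by
  simp [phi]

/-- This is `norm_mem_iff` for the exponents of A_i and M = ⌈i/2⌉. In particular B_i is a lattice,
although it is defined by a quadratic condition. -/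
theorem IsFrame.mem_latB (R : IsRamified F σ π) (f : IsFrame h π L d x u T) {i : ℤ} {v : V} :
    v ∈ latB π h L i ↔ v ∈ latA π h L i ∧ phi π d x T i v ∈ pideal F π 1 := by
  refine and_congr_right fun hv => ?_
  have hv' := (f.mem_latA R).1 hv
  rw [phi_apply, near, (isOrd_two R).inIdeal_iff R]
  have h2 : IsOrd F π ((2 : E) ^ (-((i + 1) / 2))) (2 * -((i + 1) / 2)) := (isOrd_two R).zpow R _
  rw [h2.mul_mem_iff R (show (2 : ℤ) = 2 * -((i + 1) / 2) + (2 * ((i + 1) / 2) + 2) by ring)]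
  rw [f.norm_mem_iff R hv' (M := (i + 1) / 2) (fun k => by omega) (fun k => by omega)]

theorem IsFrame.norm_mem_of_latB (R : IsRamified F σ π) {i : ℤ} {v : V}
    (hv : v ∈ latB π h L i) : h v v ∈ pideal F π (2 * ((i + 1) / 2) + 2) := by
  have := (isOrd_two R).inIdeal_iff R |>.1 hv.2
  have h2 : IsOrd F π ((2 : E) ^ (-((i + 1) / 2))) (2 * -((i + 1) / 2)) := (isOrd_two R).zpow R _
  exact (h2.mul_mem_iff R (show (2 : ℤ) = 2 * -((i + 1) / 2) + (2 * ((i + 1) / 2) + 2) by ring)).1 this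

end Frames

/-! ### The lattices W_i, Z_i and the dual of B_i in a frame. -/

section FrameLattices

variable {F E : Type*} [NontriviallyNormedField F] [NormedAlgebra ℚ_[2] F]
  [Field E] [Algebra F E] {σ : E ≃ₐ[F] E} {π : E}
  {V : Type*} [AddCommGroup V] [Module E V] {K : Type*} [Fintype K]
  {h : hermForms σ V} {L : Submodule (intRingExt F E) V} {d : K → ℤ} {x u : Basis K E V}
  {T : Finset K}

theorem conj_zpow_mul_sub_mem (R : IsRamified F σ π) {a : E} {n : ℤ} (ha : a ∈ pideal F π n)
    (j : ℤ) : σ (π ^ j) * σ a - π ^ j * a ∈ pideal F π (j + n + 1) := by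
  have h1 := mul_mem_of_le R (zpow_mem_pideal π j) (R.map_sub_mem ha)
    (show j + n + 1 ≤ j + (n + 1) by omega)
  rcases map_pi_zpow R j with h | h <;> rw [h]
  · rwa [← mul_sub]
  · have h2 := mul_mem_of_le R (zpow_mem_pideal π j) (mul_mem_pideal R.ne_zero (isOrd_two R).2.1 ha)
      (show j + n + 1 ≤ j + (2 + n) by omega)
    have := neg_mem (add_mem h1 h2)
    convert! this using 1
    ring

theorem IsFrame.herm_u (f : IsFrame h π L d x u T) (k : K) (v : V) :
    h (u k) v = π ^ d k * x.repr v k := by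
  rw [f.herm_right, f.pairing]

theorem IsFrame.herm_u' (f : IsFrame h π L d x u T) (k : K) (v : V) :
    h v (u k) = σ (π ^ d k) * σ (x.repr v k) := by
  rw [herm_symm h (u k) v, f.herm_u, map_mul]

theorem IsFrame.near_of_even (f : IsFrame h π L d x u T) {i : ℤ} (hi : Even i) {t : K}
    (ht : t ∈ T) (hdt : d t = i) : near d T i = {t} := by
  ext s
  rw [mem_near, Finset.mem_singleton]
  have hno : ¬ Odd i := Int.not_odd_iff_even.2 hi
  constructor
  · rintro ⟨hs, h1 | h1⟩
    · exact f.leader_inj hs ht (h1.trans hdt.symm)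
    · exact absurd h1.1 hno
  · rintro rfl
    exact ⟨ht, Or.inl hdt⟩

theorem near_eq_empty_of_even {i : ℤ} (hi : Even i) (hT : ∀ t ∈ T, d t ≠ i) : near d T i = ∅ := by
  ext s
  rw [mem_near]
  have hno : ¬ Odd i := Int.not_odd_iff_even.2 hi
  simp only [hno, false_and, or_false, Finset.notMem_empty, iff_false, not_and]
  exact hT s

theorem IsFrame.phi_of_even (f : IsFrame h π L d x u T) {i : ℤ} (hi : Even i) {t : K}
    (ht : t ∈ T) (hdt : d t = i) (v : V) : phi π d x T i v = x.repr v t := by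
  rw [phi_apply, f.near_of_even hi ht hdt, Finset.sum_singleton, hdt]
  simp

theorem phi_mem (R : IsRamified F σ π) {i : ℤ} {v : V}
    (hv : v ∈ box F π x fun k => max 0 (i - d k)) : phi π d x T i v ∈ pideal F π 0 := by
  rw [phi_apply]
  refine AddSubgroup.sum_mem _ fun t _ => ?_
  rw [(isOrd_zpow R _).mul_mem_iff R (neg_add_cancel _).symm]
  exact hv t

/-- The normalized norm of v is congruent to the square of `phi`, and a² ≡ b² modulo π is equivalent
to a ≡ b. So a characteristic vector is one that represents `phi` through h. -/
theorem IsFrame.isCharVec_iff (R : IsRamified F σ π) (f : IsFrame h π L d x u T) {i : ℤ}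
    (hi : Even i) {e : V} : IsCharVec π h L i e ↔
      e ∈ latA π h L i ∧ ∀ v ∈ latA π h L i, π ^ (-i) * h v e - phi π d x T i v ∈ pideal F π 1 := by
  obtain ⟨m, rfl⟩ := hi
  refine and_congr_right fun he => forall₂_congr fun v hv => ?_
  have hone : IsOrd F π π 1 := by simpa using isOrd_zpow R 1
  rw [hone.inIdeal_iff R, show (m + m) / 2 = m by omega]
  have hvA := (f.mem_latA R).1 hv
  have hhvv : h v v ∈ pideal F π (m + m) := hv.2 v hv.1
  have hhve : h v e ∈ pideal F π (m + m) := hv.2 e he.1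
  set a := π ^ (-(m + m)) * h v e with ha
  set b := phi π d x T (m + m) v with hb
  have ha0 : a ∈ pideal F π 0 := mul_mem_of_le R (zpow_mem_pideal π _) hhve (by omega)
  have hb0 : b ∈ pideal F π 0 := phi_mem R hvA
  have hn : π ^ (-(m + m)) * h v v - b ^ 2 ∈ pideal F π 1 := by
    have h1 := f.norm_sub_mem R hvA (M := m) (fun k => by omega) (fun k => by omega)
    have h2 := mul_mem_of_le R (zpow_mem_pideal π (-(m + m))) h1 (show 1 ≤ _ by omega)
    rw [mul_sub, ← mul_assoc, ← zpow_add₀ R.ne_zero, show -(m + m) + 2 * m = 0 by ring, zpow_zero,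
      one_mul] at h2
    rw [hb, phi_apply, near, show (m + m + 1) / 2 = m by omega]
    exact h2
  have hsgn : (π * σ π) ^ (-m) * h v v - π ^ (-(m + m)) * h v v ∈ pideal F π 1 := by
    have h0 : π ^ (-(m + m)) * h v v ∈ pideal F π 0 :=
      mul_mem_of_le R (zpow_mem_pideal π _) hhvv (by omega)
    have e : 2 * -m = -(m + m) := by ring
    rcases xi_zpow R (-m) with h1 | h1 <;> rw [h1, e]
    · rw [sub_self]
      exact zero_mem _
    · have := neg_mem (mul_mem_of_le R (isOrd_two R).2.1 h0 (show 1 ≤ _ by omega))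
      convert! this using 1
      ring
  have hsq : ((π * σ π) ^ (-m) * h v e) ^ 2 = a ^ 2 := by
    have e : 2 * -m = -(m + m) := by ring
    rcases xi_zpow R (-m) with h1 | h1 <;> rw [h1, e]
    rw [neg_mul, neg_sq]
  rw [hsq]
  have h1 : a ^ 2 - (π * σ π) ^ (-m) * h v v ∈ pideal F π 1 ↔ a ^ 2 - b ^ 2 ∈ pideal F π 1 := by
    have h2 := add_mem hsgn hn
    constructor
    · intro h3
      have := add_mem h3 h2
      convert! this using 1
      ring
    · intro h3
      have := sub_mem h3 h2
      convert! this using 1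
      ring
  rw [h1]
  constructor
  · intro h3
    refine mem_one_of_sq_mem R (sub_mem ha0 hb0) ?_
    have h4 := mul_mem_of_le R (isOrd_two R).2.1 (mul_mem_pideal R.ne_zero hb0 (sub_mem hb0 ha0))
      (show 1 ≤ _ by omega)
    have := add_mem h3 h4
    convert! this using 1
    ring
  · intro h3
    have := mul_mem_of_le R h3 (add_mem ha0 hb0) (show 1 ≤ _ by omega)
    convert! this using 1
    ring

theorem IsFrame.isCharVec_u (R : IsRamified F σ π) (f : IsFrame h π L d x u T) {t : K}
    (hi : Even (d t)) (ht : t ∈ T) : IsCharVec π h L (d t) (u t) := by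
  classical
  rw [f.isCharVec_iff R hi]
  constructor
  · rw [(f.swap R).mem_latA R, ← one_smul E (u t)]
    refine basis_mem_box ?_
    rw [sub_self, max_self]
    exact isOrd_one.2.1
  · intro v hv
    have hvt := (f.mem_latA R).1 hv t
    simp only [sub_self, max_self] at hvt
    rw [f.phi_of_even hi ht rfl, f.herm_u']
    have h1 := mul_mem_of_le R (zpow_mem_pideal π (-d t)) (conj_zpow_mul_sub_mem R hvt (d t))
      (show 1 ≤ _ by omega)
    rwa [mul_sub, ← mul_assoc _ (π ^ d t), ← zpow_add₀ R.ne_zero, neg_add_cancel, zpow_zero,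
      one_mul] at h1

theorem latX_add (R : IsRamified F σ π) (f : IsFrame h π L d x u T) {i : ℤ} {v w : V}
    (hv : v ∈ latX π h L i) (hw : w ∈ latX π h L i) : v + w ∈ latX π h L i := by
  rw [f.mem_latX R] at *
  exact add_mem hv hw

theorem latX_smul (R : IsRamified F σ π) (f : IsFrame h π L d x u T) {i : ℤ} {v : V} {c : E}
    (hc : c ∈ pideal F π 0) (hv : v ∈ latX π h L i) : c • v ∈ latX π h L i := by
  rw [f.mem_latX R] at *
  exact smul_mem_box_zero R hc hv

theorem latA_add (R : IsRamified F σ π) (f : IsFrame h π L d x u T) {i : ℤ} {v w : V}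
    (hv : v ∈ latA π h L i) (hw : w ∈ latA π h L i) : v + w ∈ latA π h L i := by
  rw [f.mem_latA R] at *
  exact add_mem hv hw

theorem latA_sub (R : IsRamified F σ π) (f : IsFrame h π L d x u T) {i : ℤ} {v w : V}
    (hv : v ∈ latA π h L i) (hw : w ∈ latA π h L i) : v - w ∈ latA π h L i := by
  rw [f.mem_latA R] at *
  exact sub_mem hv hw

theorem latA_smul (R : IsRamified F σ π) (f : IsFrame h π L d x u T) {i : ℤ} {v : V} {c : E}
    (hc : c ∈ pideal F π 0) (hv : v ∈ latA π h L i) : c • v ∈ latA π h L i := by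
  rw [f.mem_latA R] at *
  exact smul_mem_box_zero R hc hv

theorem latB_add (R : IsRamified F σ π) (f : IsFrame h π L d x u T) {i : ℤ} {v w : V}
    (hv : v ∈ latB π h L i) (hw : w ∈ latB π h L i) : v + w ∈ latB π h L i := by
  rw [f.mem_latB R] at *
  refine ⟨latA_add R f hv.1 hw.1, ?_⟩
  rw [map_add]
  exact add_mem hv.2 hw.2

/-- Two characteristic vectors represent the same functional and hence differ by an element of X_i.
The dual vector `u t` of the leader of degree i is one of them; without such a leader `phi` is zero
and the zero vector serves. -/
theorem IsFrame.mem_latW (R : IsRamified F σ π) (f : IsFrame h π L d x u T) {i : ℤ} (hi : Even i)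
    {v : V} : v ∈ latW π h L i ↔ v ∈ latX π h L i ∨
      ∃ t ∈ T, d t = i ∧ ∃ c ∈ pideal F π 0, v - c • u t ∈ latX π h L i := by
  classical
  rw [latW, if_pos hi]
  have hdiff : ∀ {e e' : V}, IsCharVec π h L i e → IsCharVec π h L i e' → e - e' ∈ latX π h L i := by
    intro e e' he he'
    rw [f.isCharVec_iff R hi] at he he'
    refine (mem_latX_iff R).2 ⟨latA_sub R f he.1 he'.1, fun y hy => ?_⟩
    rw [herm_mem_symm R, herm_sub_right]
    have := sub_mem (he.2 y hy) (he'.2 y hy)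
    rw [sub_sub_sub_cancel_right, ← mul_sub,
      (isOrd_zpow R (-i)).mul_mem_iff R (show 1 = -i + (i + 1) by omega)] at this
    exact this
  constructor
  · rintro ⟨e, he, c, hc, hv⟩
    rw [← mem_pideal_zero (π := π)] at hc
    by_cases hT : ∃ t ∈ T, d t = i
    · obtain ⟨t, ht, rfl⟩ := hT
      refine Or.inr ⟨t, ht, rfl, c, hc, ?_⟩
      have := latX_add R f hv (latX_smul R f hc (hdiff he (f.isCharVec_u R hi ht)))
      rwa [smul_sub, sub_add_sub_cancel] at this
    · push Not at hT
      have h0 : IsCharVec π h L i 0 := by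
        rw [f.isCharVec_iff R hi]
        refine ⟨?_, fun v _ => ?_⟩
        · rw [f.mem_latA R]
          exact zero_mem _
        · rw [herm_zero_right, phi_apply, near_eq_empty_of_even hi hT]
          simp [zero_mem]
      have := hdiff he h0
      rw [sub_zero] at this
      have := latX_add R f hv (latX_smul R f hc this)
      rw [sub_add_cancel] at this
      exact Or.inl this
  · rintro (hv | ⟨t, ht, rfl, c, hc, hv⟩)
    · by_cases hT : ∃ t ∈ T, d t = i
      · obtain ⟨t, ht, rfl⟩ := hT
        exact ⟨u t, f.isCharVec_u R hi ht, 0, zero_mem _, by simpa using hv⟩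
      · push Not at hT
        refine ⟨0, ?_, 0, zero_mem _, by simpa using hv⟩
        rw [f.isCharVec_iff R hi]
        refine ⟨?_, fun v _ => ?_⟩
        · rw [f.mem_latA R]
          exact zero_mem _
        · rw [herm_zero_right, phi_apply, near_eq_empty_of_even hi hT]
          simp [zero_mem]
    · exact ⟨u t, f.isCharVec_u R hi ht, c, mem_pideal_zero.1 hc, hv⟩

theorem IsFrame.latX_subset_latB (R : IsRamified F σ π) (f : IsFrame h π L d x u T) {i : ℤ}
    (hi : Even i) {v : V} (hv : v ∈ latX π h L i) : v ∈ latB π h L i := by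
  rw [f.mem_latB R]
  refine ⟨hv.1, ?_⟩
  by_cases hT : ∃ t ∈ T, d t = i
  · obtain ⟨t, ht, rfl⟩ := hT
    rw [f.phi_of_even hi ht rfl]
    simpa [expX] using (f.mem_latX R).1 hv t
  · push Not at hT
    rw [phi_apply, near_eq_empty_of_even hi hT]
    simp [zero_mem]

theorem mem_latZ (R : IsRamified F σ π) {i : ℤ} (hi : Even i) {v : V} :
    v ∈ latZ π h L i ↔ v ∈ latB π h L i ∧ h v v ∈ pideal F π (i + 4) ∧
      ∀ y ∈ latB π h L i, h (v + y) (v + y) - h v v - h y y ∈ pideal F π (i + 4) := by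
  obtain ⟨m, rfl⟩ := hi
  have h2 : IsOrd F π ((2 : E) ^ (-((m + m) / 2 + 1))) (2 * -((m + m) / 2 + 1)) :=
    (isOrd_two R).zpow R _
  have hz : ∀ z, InIdeal F 2 ((2 : E) ^ (-((m + m) / 2 + 1)) * z) ↔ z ∈ pideal F π (m + m + 4) :=
    fun z => by
      rw [(isOrd_two R).inIdeal_iff R, h2.mul_mem_iff R (show 2 = _ + (m + m + 4) by omega)]
  simp only [latZ, hz]
  rfl

/-- For v in X_i the values h(v, y) lie in π^(i+1)B, whose traces lie in π^(i+4)B. The condition on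
the polar form is thus automatic, and only the norm of v matters. -/
theorem IsFrame.mem_latX_inter_latZ (R : IsRamified F σ π) (f : IsFrame h π L d x u T) {i : ℤ}
    (hi : Even i) {v : V} (hv : v ∈ latX π h L i) (hn : h v v ∈ pideal F π (i + 4)) :
    v ∈ latX π h L i ∩ latZ π h L i := by
  refine ⟨hv, (mem_latZ R hi).2 ⟨f.latX_subset_latB R hi hv, hn, fun y hy => ?_⟩⟩
  obtain ⟨m, rfl⟩ := hi
  have h1 := ((mem_latX_iff R).1 hv).2 y hy.1
  have := herm_add_self_sub_mem R h (v := v) (w := y) (M := m + 1) (R.anti (by omega) h1)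
  exact R.anti (by omega) this

/-- Addition of an element of `X_i ∩ Z_i` preserves `Z_i`. -/
theorem IsFrame.latZ_add (R : IsRamified F σ π) (f : IsFrame h π L d x u T) {i : ℤ}
    (hi : Even i) {v w : V} (hv : v ∈ latZ π h L i) (hw : w ∈ latX π h L i ∩ latZ π h L i) :
    v + w ∈ latZ π h L i := by
  have hv' := (mem_latZ R hi).1 hv
  have hw' := (mem_latZ R hi).1 hw.2
  refine (mem_latZ R hi).2 ⟨latB_add R f hv'.1 hw'.1, ?_, fun y hy => ?_⟩
  · have := add_mem (add_mem (hv'.2.2 w hw'.1) hv'.2.1) hw'.2.1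
    convert! this using 1
    ring
  · have := add_mem (hv'.2.2 y hy) (hw'.2.2 y hy)
    convert! this using 1
    simp only [herm_add_left, herm_add_right]
    ring

theorem IsFrame.sub_smul_mem_latB (R : IsRamified F σ π) (f : IsFrame h π L d x u T) {i : ℤ}
    {a w : V} (ha : a ∈ latA π h L i) (hw : w ∈ latA π h L i) (hw1 : phi π d x T i w = 1) :
    a - phi π d x T i a • w ∈ latB π h L i := by
  rw [f.mem_latB R]
  refine ⟨latA_sub R f ha (latA_smul R f (phi_mem R ((f.mem_latA R).1 ha)) hw), ?_⟩
  rw [map_sub, map_smul, hw1, smul_eq_mul, mul_one, sub_self]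
  exact zero_mem _

theorem IsFrame.exists_phi_eq_one (f : IsFrame h π L d x u T) (R : IsRamified F σ π) {i : ℤ} {t : K}
    (ht : t ∈ near d T i) : ∃ w ∈ latA π h L i, phi π d x T i w = 1 := by
  classical
  refine ⟨π ^ max 0 (i - d t) • x t, ?_, ?_⟩
  · rw [f.mem_latA R]
    exact basis_mem_box (zpow_mem_pideal π _)
  · rw [phi_apply, Finset.sum_eq_single t]
    · rw [map_smul, Finsupp.smul_apply, x.repr_self, Finsupp.single_eq_same, smul_eq_mul, mul_one,
        ← zpow_add₀ R.ne_zero, neg_add_cancel, zpow_zero]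
    · intro s _ hs
      rw [map_smul, Finsupp.smul_apply, x.repr_self, Finsupp.single_eq_of_ne hs, smul_zero, mul_zero]
    · exact fun h => absurd ht h

/-- Divisibility of the trace of h(v, y) forces h(v, y) ∈ π^(i+1)B on B_i. The functional induced by
v on A_i modulo π therefore kills the kernel of `phi`, so it is a multiple of `phi` and v lies in
B·u_t + X_i. Stability of Z_i will follow from the condition on W_i. -/
theorem IsFrame.latZ_subset_latW (R : IsRamified F σ π) (f : IsFrame h π L d x u T) {i : ℤ}
    (hi : Even i) {v : V} (hv : v ∈ latZ π h L i) : v ∈ latW π h L i := by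
  classical
  have hv' := (mem_latZ R hi).1 hv
  have hB : ∀ y ∈ latB π h L i, h v y ∈ pideal F π (i + 1) := by
    intro y hy
    have h1 := hv'.2.2 y hy
    have h2 : h v y ∈ pideal F π i := hv'.1.1.2 y hy.1.1
    have e : h (v + y) (v + y) - h v v - h y y = h v y + σ (h v y) := by
      rw [← herm_symm, herm_add_left, herm_add_right, herm_add_right]
      ring
    rw [e] at h1
    obtain ⟨m, rfl⟩ := hi
    rw [← two_mul] at *
    exact R.of_trace_mem h2 h1
  rw [f.mem_latW R hi]
  by_cases hT : ∃ t ∈ T, d t = i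
  · obtain ⟨t, ht, rfl⟩ := hT
    obtain ⟨w, hw, hw1⟩ := f.exists_phi_eq_one R (i := d t) (t := t)
      (mem_near.2 ⟨ht, Or.inl rfl⟩)
    set c := σ (π ^ (-d t) * h v w) with hc
    have hvw : h v w ∈ pideal F π (d t) := hv'.1.1.2 w hw.1
    have hc0 : c ∈ pideal F π 0 :=
      R.map_mem (mul_mem_of_le R (zpow_mem_pideal π _) hvw (by omega))
    have huA : u t ∈ latA π h L (d t) := (f.isCharVec_u R hi ht).1
    refine Or.inr ⟨t, ht, rfl, c, hc0,
      (mem_latX_iff R).2 ⟨latA_sub R f hv'.1.1 (latA_smul R f hc0 huA), fun y hy => ?_⟩⟩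
    have h1 := hB _ (f.sub_smul_mem_latB R hy hw hw1)
    rw [herm_sub_right, herm_smul_right, f.phi_of_even hi ht rfl] at h1
    rw [herm_sub_left, herm_smul_left, hc, R.invol, f.herm_u]
    convert! h1 using 2
    rw [mul_comm (x.repr y t), zpow_neg]
    have : π ^ d t ≠ 0 := zpow_ne_zero _ R.ne_zero
    field_simp
  · push Not at hT
    refine Or.inl ((mem_latX_iff R).2 ⟨hv'.1.1, fun y hy => hB y ?_⟩)
    rw [f.mem_latB R, phi_apply, near_eq_empty_of_even hi hT]
    exact ⟨hy, by simp [zero_mem]⟩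

/-- A vector `ε_i` with `B_i = {x ∈ A_i | h(ε_i, x) ∈ B}`. -/
def eps (π : E) (d : K → ℤ) (u : Basis K E V) (T : Finset K) (i : ℤ) : V :=
  ∑ t ∈ near d T i, π ^ (-1 - max i (d t)) • u t

theorem IsFrame.herm_eps_sub_mem (R : IsRamified F σ π) (f : IsFrame h π L d x u T) {i : ℤ} {v : V}
    (hv : v ∈ latA π h L i) :
    h (eps π d u T i) v - π ^ (-1 : ℤ) * phi π d x T i v ∈ pideal F π 0 := by
  rw [eps, phi_apply, herm_sum_left, Finset.mul_sum, ← Finset.sum_sub_distrib]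
  refine AddSubgroup.sum_mem _ fun t _ => ?_
  rw [herm_smul_left, f.herm_u]
  have hvt : x.repr v t ∈ pideal F π (max 0 (i - d t)) := (f.mem_latA R).1 hv t
  have e : π ^ (-1 : ℤ) * (π ^ (-max 0 (i - d t)) * x.repr v t) =
      π ^ (-1 - max i (d t)) * (π ^ d t * x.repr v t) := by
    rw [← mul_assoc, ← mul_assoc, ← zpow_add₀ R.ne_zero, ← zpow_add₀ R.ne_zero]
    congr 2
    omega
  rw [e]
  rcases map_pi_zpow R (-1 - max i (d t)) with h1 | h1 <;> rw [h1]
  · rw [sub_self]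
    exact zero_mem _
  · have h2 := mul_mem_pideal R.ne_zero (zpow_mem_pideal π (-1 - max i (d t)))
      (mul_mem_pideal R.ne_zero (zpow_mem_pideal π (d t)) hvt)
    have := neg_mem (mul_mem_of_le R (isOrd_two R).2.1 h2 (show 0 ≤ _ by omega))
    convert! this using 1
    ring

theorem IsFrame.eps_mem_latDual (R : IsRamified F σ π) (f : IsFrame h π L d x u T) (i : ℤ) :
    eps π d u T i ∈ latDual F h (latB π h L i) := by
  intro v hv
  rw [f.mem_latB R] at hv
  have h1 := f.herm_eps_sub_mem R hv.1
  have h2 := mul_mem_of_le R (zpow_mem_pideal π (-1)) hv.2 (show 0 ≤ _ by omega)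
  have := add_mem h1 h2
  rw [sub_add_cancel] at this
  exact mem_pideal_zero.1 this

/-- B_i is all of A_i or has A_i/B_i a line over the residue field; `eps` accounts for the whole
quotient of the duals. The coefficient is found by pairing v with πw, where `phi` takes the value 1
at w. -/
theorem IsFrame.exists_of_mem_latDual_latB (R : IsRamified F σ π) (f : IsFrame h π L d x u T) {i : ℤ}
    {v : V} (hv : v ∈ latDual F h (latB π h L i)) :
    ∃ c ∈ pideal F π 0, v - c • eps π d u T i ∈ latDual F h (latA π h L i) := by
  rcases (near d T i).eq_empty_or_nonempty with hT | ⟨t, ht⟩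
  · refine ⟨0, zero_mem _, ?_⟩
    rw [zero_smul, sub_zero]
    refine fun y hy => hv y ((f.mem_latB R).2 ⟨hy, ?_⟩)
    rw [phi_apply, hT]
    simp [zero_mem]
  · obtain ⟨w, hw, hw1⟩ := f.exists_phi_eq_one R ht
    have hone : π ∈ pideal F π 1 := by simpa using zpow_mem_pideal (F := F) π 1
    have hπw : π • w ∈ latB π h L i := by
      rw [f.mem_latB R, map_smul, hw1, smul_eq_mul, mul_one]
      exact ⟨latA_smul R f (R.anti zero_le_one hone) hw, hone⟩
    have h1 : π * h v w ∈ pideal F π 0 := by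
      rw [← herm_smul_right]
      exact mem_pideal_zero.2 (hv _ hπw)
    refine ⟨σ (π * h v w), R.map_mem h1, fun y hy => mem_pideal_zero (π := π).1 ?_⟩
    have h2 := mem_pideal_zero (π := π).2 (hv _ (f.sub_smul_mem_latB R hy hw hw1))
    have h3 := mul_mem_of_le R h1 (f.herm_eps_sub_mem R hy) (show 0 ≤ _ by omega)
    rw [herm_sub_right, herm_smul_right] at h2
    rw [herm_sub_left, herm_smul_left, R.invol]
    have := sub_mem h2 h3
    convert! this using 1
    rw [zpow_neg_one]
    have := R.ne_zero
    field_simp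
    ring

end FrameLattices

/-! ### Coordinate description of the model of End_E V. -/

section ModelM

variable {F E : Type*} [NontriviallyNormedField F] [NormedAlgebra ℚ_[2] F]
  [Field E] [Algebra F E] {σ : E ≃ₐ[F] E} {π : E}
  {V : Type*} [AddCommGroup V] [Module E V] {K : Type*} [Fintype K]
  {h : hermForms σ V} {L : Submodule (intRingExt F E) V} {d : K → ℤ} {x u : Basis K E V}
  {T : Finset K}

/-- The congruences, in coordinates, that define the translate `M(A) - 1` of `M(A)`. -/
structure MCond (F : Type*) {E V K : Type*} [NontriviallyNormedField F] [NormedAlgebra ℚ_[2] F]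
    [Field E] [Algebra F E] [AddCommGroup V] [Module E V]
    (π : E) (d : K → ℤ) (x u : Basis K E V) (T : Finset K) (X : Module.End E V) : Prop where
  entry : ∀ k l, x.repr (X (u l)) k ∈ pideal F π (max 0 (d l - d k))
  row : ∀ l, phi π d x T (d l) (X (u l)) ∈ pideal F π 1
  col : ∀ k, ∑ t ∈ near d T (d k), π ^ (-max 0 (d t - d k)) * x.repr (X (u t)) k ∈ pideal F π 1
  diag : ∀ t ∈ T, Even (d t) → ∑ s ∈ T with expX (d t) (d s) + (d s + 1) / 2 = d t / 2 + 1,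
    π ^ (-expX (d t) (d s)) * x.repr (X (u t)) s ∈ pideal F π 1

theorem MCond.map_mem_box (R : IsRamified F σ π) {X : Module.End E V} (C : MCond F π d x u T X)
    {r s : K → ℤ} {v : V} (hv : v ∈ box F π u r) (h : ∀ k l, s k ≤ r l + max 0 (d l - d k)) :
    X v ∈ box F π x s := by
  intro k
  rw [← u.sum_repr v, map_sum, map_sum, Finsupp.finsetSum_apply]
  refine AddSubgroup.sum_mem _ fun l _ => ?_
  rw [map_smul, map_smul, Finsupp.smul_apply, smul_eq_mul]
  exact mul_mem_of_le R (hv l) (C.entry k l) (h k l)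

theorem expX_cond {i : ℤ} (dk dl : ℤ) : expX i dk ≤ expX i dl + max 0 (dl - dk) := by
  unfold expX
  split_ifs <;> omega

variable (f : IsFrame h π L d x u T) (R : IsRamified F σ π)
include f R

theorem MCond.map_latA {X : Module.End E V} (C : MCond F π d x u T X) {i : ℤ} {v : V}
    (hv : v ∈ latA π h L i) : X v ∈ latA π h L i := by
  rw [(f.swap R).mem_latA R] at hv
  rw [f.mem_latA R]
  exact C.map_mem_box R hv fun k l => by omega

theorem MCond.map_latX {X : Module.End E V} (C : MCond F π d x u T X) {i : ℤ} {v : V}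
    (hv : v ∈ latX π h L i) : X v ∈ latX π h L i := by
  rw [(f.swap R).mem_latX R] at hv
  rw [f.mem_latX R]
  exact C.map_mem_box R hv fun k l => expX_cond _ _

/-- Basis vectors of degree i are handled by the row congruence; for all other degrees no congruence
of index i is needed. -/
theorem MCond.map_latA_mem_latB {X : Module.End E V} (C : MCond F π d x u T X) {i : ℤ} {v : V}
    (hv : v ∈ latA π h L i) : X v ∈ latB π h L i := by
  rw [f.mem_latB R]
  refine ⟨C.map_latA f R hv, ?_⟩
  rw [(f.swap R).mem_latA R] at hv
  rw [← u.sum_repr v, map_sum, map_sum]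
  refine AddSubgroup.sum_mem _ fun l _ => ?_
  rw [map_smul, map_smul, smul_eq_mul]
  by_cases hl : d l = i
  · subst hl
    have := hv l
    simp only [sub_self, max_self] at this
    exact mul_mem_of_le R this (C.row l) (by omega)
  · rw [phi_apply, Finset.mul_sum]
    refine AddSubgroup.sum_mem _ fun t ht => ?_
    obtain ⟨htT, ht⟩ := mem_near.1 ht
    -- For odd i, an adjacent leader t and a vector of the same even degree, the entry bound alone
    -- falls short by one factor π; this factor comes from the row congruence in that even degree.
    -- For unequal degrees the entry bound suffices.
    by_cases htl : d t = d l
    · have hodd : Odd i := by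
        rcases ht with ht | ht
        · exact absurd (htl.symm.trans ht) hl
        · exact ht.1
      have hev : Even (d l) := by
        rcases ht.resolve_left (fun h => hl (htl.symm.trans h)) with ⟨-, h1 | h1⟩ <;>
          rw [← htl, h1]
        · exact hodd.sub_odd odd_one
        · exact hodd.add_odd odd_one
      have h1 := C.row l
      rw [f.phi_of_even hev htT htl] at h1
      exact mul_mem_of_le R (hv l) (mul_mem_pideal R.ne_zero (zpow_mem_pideal π _) h1) (by beta_reduce; omega)
    · refine mul_mem_of_le R (hv l) (mul_mem_pideal R.ne_zero (zpow_mem_pideal π _)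
        (C.entry t l)) ?_
      rcases ht with ht | ⟨-, ht | ht⟩ <;> beta_reduce <;> omega

/-- `X_i = A_{i+1} + π A_{i-1}`. -/
theorem IsFrame.exists_of_mem_latX {i : ℤ} {v : V} (hv : v ∈ latX π h L i) :
    ∃ a ∈ latA π h L (i + 1), ∃ b ∈ latA π h L (i - 1), v = a + π • b := by
  classical
  have hv' := (f.mem_latX R).1 hv
  have hrepr : ∀ c : K → E, ∀ k, x.repr (∑ l, c l • x l) k = c k := fun c k => by
    rw [x.repr_sum_self]
  refine ⟨∑ k, (if i < d k then x.repr v k else 0) • x k, ?_,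
    ∑ k, (if i < d k then 0 else π ^ (-1 : ℤ) * x.repr v k) • x k, ?_, ?_⟩
  · rw [f.mem_latA R]
    intro k
    rw [hrepr]
    split_ifs with hk
    · have := hv' k
      refine R.anti ?_ this
      beta_reduce
      unfold expX
      split_ifs <;> omega
    · exact zero_mem _
  · rw [f.mem_latA R]
    intro k
    rw [hrepr]
    split_ifs with hk
    · exact zero_mem _
    · refine mul_mem_of_le R (zpow_mem_pideal π _) (hv' k) ?_
      simp only [expX]
      split_ifs <;> omega
  · conv_lhs => rw [← x.sum_repr v]
    rw [Finset.smul_sum, ← Finset.sum_add_distrib]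
    refine Finset.sum_congr rfl fun k _ => ?_
    rw [smul_smul, ← add_smul]
    congr 1
    split_ifs
    · ring
    · rw [zpow_neg_one, mul_inv_cancel_left₀ R.ne_zero, zero_add]

-- The cross term is the trace of an element of π^(i+1)B, which lies in π^(i+4)B for even i.
omit f in
theorem norm_add_mem {i : ℤ} (hi : Even i) {v w : V}
    (hvw : h v w ∈ pideal F π (i + 1)) (hv : h v v ∈ pideal F π (i + 4))
    (hw : h w w ∈ pideal F π (i + 4)) : h (v + w) (v + w) ∈ pideal F π (i + 4) := by
  obtain ⟨m, rfl⟩ := hi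
  have := herm_add_self_sub_mem R h (v := v) (w := w) (M := m + 1) (R.anti (by omega) hvw)
  have := add_mem (add_mem (R.anti (by omega) this) hv) hw
  convert! this using 1
  ring

omit f in
theorem norm_smul_mem {c : E} {v : V} {n j : ℤ} (hc : c ∈ pideal F π n)
    (hv : h v v ∈ pideal F π j) : h (c • v) (c • v) ∈ pideal F π (n + n + j) := by
  rw [herm_smul_left, herm_smul_right]
  exact mul_mem_of_le R (R.map_mem hc) (mul_mem_pideal R.ne_zero hc hv) (by omega)

/-- A vector of X_i is a + πb with a in A_(i+1) and b in A_(i-1). The images of a and b lie in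
B_(i+1) and B_(i-1), and for these odd indices the norm conditions are exactly strong enough. -/
theorem MCond.norm_map_latX {X : Module.End E V} (C : MCond F π d x u T X) {i : ℤ} (hi : Even i)
    {v : V} (hv : v ∈ latX π h L i) : h (X v) (X v) ∈ pideal F π (i + 4) := by
  obtain ⟨a, ha, b, hb, rfl⟩ := f.exists_of_mem_latX R hv
  have hone : π ∈ pideal F π 1 := by simpa using zpow_mem_pideal (F := F) π 1
  have h1 := IsFrame.norm_mem_of_latB R (C.map_latA_mem_latB f R ha)
  have h2 := IsFrame.norm_mem_of_latB R (C.map_latA_mem_latB f R hb)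
  rw [map_add, map_smul]
  obtain ⟨m, rfl⟩ := hi
  refine norm_add_mem R ⟨m, rfl⟩ ?_ (R.anti (by omega) h1)
    (R.anti (by omega) (norm_smul_mem R hone h2))
  rw [herm_smul_right]
  have h3 : h (X a) (X b) ∈ pideal F π (m + m + 1) :=
    (C.map_latA f R ha).2 _ (C.map_latA f R hb).1
  exact mul_mem_of_le R hone h3 (by omega)

theorem MCond.map_u_mem_latX {X : Module.End E V} (C : MCond F π d x u T X) {t : K} (ht : t ∈ T)
    (hi : Even (d t)) : X (u t) ∈ latX π h L (d t) := by
  rw [f.mem_latX R]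
  intro k
  by_cases hk : d k = d t
  · have := C.col k
    rw [hk, f.near_of_even hi ht rfl, Finset.sum_singleton] at this
    simpa [expX, hk] using this
  · have := C.entry k t
    simpa [expX, hk] using this

/-- `norm_mem_iff` with the exponents of X_i and M = i/2 + 1 translates membership in Z_i into the
congruence `diag`. -/
theorem mem_latX_norm_iff {i : ℤ} (hi : Even i) {v : V} (hv : v ∈ latX π h L i) :
    h v v ∈ pideal F π (i + 4) ↔ ∑ s ∈ T with expX i (d s) + (d s + 1) / 2 = i / 2 + 1,
      π ^ (-expX i (d s)) * x.repr v s ∈ pideal F π 1 := by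
  obtain ⟨m, rfl⟩ := hi
  have := f.norm_mem_iff R ((f.mem_latX R).1 hv) (M := (m + m) / 2 + 1)
    (fun k => by unfold expX; split_ifs <;> omega) (fun k => by unfold expX; split_ifs <;> omega)
  rw [← this, show 2 * ((m + m) / 2 + 1) + 2 = m + m + 4 by omega]

theorem MCond.map_latW {X : Module.End E V} (C : MCond F π d x u T X) {i : ℤ} (hi : Even i)
    {v : V} (hv : v ∈ latW π h L i) : X v ∈ latX π h L i ∩ latZ π h L i := by
  rcases (f.mem_latW R hi).1 hv with hv | ⟨t, ht, rfl, c, hc, hv⟩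
  · exact f.mem_latX_inter_latZ R hi (C.map_latX f R hv) (C.norm_map_latX f R hi hv)
  · have e : X v = X (v - c • u t) + c • X (u t) := by
      rw [map_sub, map_smul, sub_add_cancel]
    have hut := C.map_u_mem_latX f R ht hi
    have hcut := latX_smul R f hc hut
    have hXv := C.map_latX f R hv
    rw [e]
    refine f.mem_latX_inter_latZ R hi (latX_add R f hXv hcut) (norm_add_mem R hi
      (((mem_latX_iff R).1 hXv).2 _ hcut.1) (C.norm_map_latX f R hi hv) ?_)
    have := norm_smul_mem R hc ((mem_latX_norm_iff f R hi hut).2 (C.diag t ht hi))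
    rwa [add_zero, zero_add] at this

/-- This mirrors `MCond.map_latA_mem_latB` with columns in place of rows: coordinates of degree i
use the column congruence of odd degree, coordinates in an adjacent even degree use that of the
leader there. -/
theorem MCond.map_eps {X : Module.End E V} (C : MCond F π d x u T X) {i : ℤ} (hi : Odd i) :
    X (eps π d u T i) ∈ latDual F h (latA π h L i) := by
  rw [f.mem_latDual_latA R]
  intro k
  rw [eps, map_sum, map_sum, Finsupp.finsetSum_apply]
  by_cases hk : d k = i
  · subst hk
    have h1 := mul_mem_pideal R.ne_zero (zpow_mem_pideal (F := F) π (-1 - d k)) (C.col k)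
    rw [Finset.mul_sum] at h1
    beta_reduce
    rw [max_self, show -d k = -1 - d k + 1 by ring]
    convert! h1 using 1
    refine Finset.sum_congr rfl fun t _ => ?_
    rw [map_smul, map_smul, Finsupp.smul_apply, smul_eq_mul, ← mul_assoc, ← zpow_add₀ R.ne_zero]
    congr 2
    omega
  · refine AddSubgroup.sum_mem _ fun t ht => ?_
    rw [map_smul, map_smul, Finsupp.smul_apply, smul_eq_mul]
    obtain ⟨htT, ht⟩ := mem_near.1 ht
    by_cases htk : d t = d k
    · have hev : Even (d k) := by
        rcases ht.resolve_left (fun h => hk (htk.symm.trans h)) with ⟨-, h1 | h1⟩ <;>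
          rw [← htk, h1]
        · exact hi.sub_odd odd_one
        · exact hi.add_odd odd_one
      have h1 := C.col k
      rw [f.near_of_even hev htT htk, Finset.sum_singleton, htk, sub_self, max_self, neg_zero,
        zpow_zero, one_mul] at h1
      exact mul_mem_of_le R (zpow_mem_pideal π _) h1 (by beta_reduce; omega)
    · refine mul_mem_of_le R (zpow_mem_pideal π _) (C.entry k t) ?_
      rcases ht with ht | ⟨-, ht | ht⟩ <;> beta_reduce <;> omega

theorem MCond.map_latDual {X : Module.End E V} (C : MCond F π d x u T X) {i : ℤ} (hi : Odd i)
    {v : V} (hv : v ∈ latDual F h (latB π h L i)) : X v ∈ latDual F h (latA π h L i) := by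
  obtain ⟨c, hc, hv'⟩ := f.exists_of_mem_latDual_latB R hv
  have e : X v = X (v - c • eps π d u T i) + c • X (eps π d u T i) := by
    rw [map_sub, map_smul, sub_add_cancel]
  rw [e, f.mem_latDual_latA R]
  refine add_mem (C.map_mem_box R (((f.swap R).mem_latDual_latA R).1 hv') fun k l => by omega)
    (smul_mem_box_zero R hc ?_)
  rw [← f.mem_latDual_latA R]
  exact C.map_eps f R hi

/-- Applied to the vectors `u l`, the identity on A_i/B_i gives `entry` and `row`. The identity on
W_i/X_i (even i) and on the dual quotients (odd i) gives `col`, and the Z_i part of the condition on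
W_i gives `diag`. Conversely these imply everything, stability being a consequence of the conditions
on m - 1. -/
theorem isModelM_iff {m : Module.End E V} : IsModelM π h L m ↔ MCond F π d x u T (m - 1) := by
  classical
  have huA : ∀ l, u l ∈ latA π h L (d l) := fun l => by
    rw [(f.swap R).mem_latA R, ← one_smul E (u l)]
    refine basis_mem_box ?_
    rw [sub_self, max_self]
    exact isOrd_one.2.1
  constructor
  · intro H
    have hAB : ∀ l, (m - 1) (u l) ∈ latB π h L (d l) := fun l => H.id_AB _ _ (huA l)
    have hW : ∀ t ∈ T, Even (d t) → (m - 1) (u t) ∈ latX π h L (d t) ∩ latZ π h L (d t) := by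
      intro t ht hi
      refine H.id_WXZ _ hi _ ((f.mem_latW R hi).2 (Or.inr ⟨t, ht, rfl, 1, isOrd_one.2.1, ?_⟩))
      rw [one_smul, sub_self, f.mem_latX R]
      exact zero_mem _
    refine ⟨fun k l => (f.mem_latA R).1 (hAB l).1 k, fun l => ((f.mem_latB R).1 (hAB l)).2,
      fun k => ?_, fun t ht hi => ?_⟩
    · rcases Int.even_or_odd (d k) with hk | hk
      · by_cases hT : ∃ t ∈ T, d t = d k
        · obtain ⟨t, ht, htk⟩ := hT
          rw [f.near_of_even hk ht htk, Finset.sum_singleton, htk, sub_self, max_self, neg_zero,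
            zpow_zero, one_mul]
          simpa [expX, htk] using (f.mem_latX R).1 (hW t ht (htk ▸ hk)).1 k
        · push Not at hT
          rw [near_eq_empty_of_even hk hT]
          simp [zero_mem]
      · have h1 := H.id_dual (d k) hk _ (f.eps_mem_latDual R (d k))
        have h2 := (f.mem_latDual_latA R).1 h1 k
        change x.repr ((m - 1) _) k ∈ _ at h2
        rw [eps, map_sum, map_sum, Finsupp.finsetSum_apply] at h2
        have h3 := mul_mem_of_le R (zpow_mem_pideal (F := F) π (d k + 1)) h2
          (show 1 ≤ _ by beta_reduce; omega)
        rw [Finset.mul_sum] at h3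
        convert! h3 using 1
        refine Finset.sum_congr rfl fun t _ => ?_
        rw [map_smul, map_smul, Finsupp.smul_apply, smul_eq_mul, ← mul_assoc,
          ← zpow_add₀ R.ne_zero]
        congr 2
        omega
    · have h1 := hW t ht hi
      exact (mem_latX_norm_iff f R hi h1.1).1 ((mem_latZ R hi).1 h1.2).2.1
  · intro C
    have e : ∀ v, m v = v + (m - 1) v := fun v => by simp
    -- For a sufficiently negative index A_i is the whole of L, so stability of L is a case of
    -- stability of the A_i.
    have hA0 : ∀ v ∈ L, v ∈ latA π h L (-∑ k, |d k|) := fun v hv => by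
      rw [f.mem_latA R]
      refine box_mono R (fun k => ?_) ((f.mem_left v).1 hv)
      have h1 := Finset.single_le_sum (f := fun k => |d k|) (fun k _ => abs_nonneg _)
        (Finset.mem_univ k)
      have h2 := neg_abs_le (d k)
      simp only [Pi.zero_apply] at h1 ⊢
      omega
    have hX : ∀ i, ∀ v ∈ latX π h L i, m v ∈ latX π h L i := fun i v hv => by
      rw [e]
      exact latX_add R f hv (C.map_latX f R hv)
    refine ⟨fun v hv => ?_, fun i v hv => ?_, fun i v hv => ?_, fun i v hv => ?_, hX,
      fun i hi v hv => ?_, fun i v hv => C.map_latA_mem_latB f R hv,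
      fun i hi v hv => C.map_latW f R hi hv, fun i hi v hv => C.map_latDual f R hi hv⟩
    · rw [e]
      exact add_mem hv (C.map_latA f R (hA0 v hv)).1
    · rw [e]
      exact latA_add R f hv (C.map_latA f R hv)
    · rw [e]
      exact latB_add R f hv (C.map_latA_mem_latB f R hv.1)
    · rcases Int.even_or_odd i with hi | hi
      · rw [e, f.mem_latW R hi]
        have h1 := (C.map_latW f R hi hv).1
        rcases (f.mem_latW R hi).1 hv with h2 | ⟨t, ht, rfl, c, hc, h2⟩
        · exact Or.inl (latX_add R f h2 h1)
        · refine Or.inr ⟨t, ht, rfl, c, hc, ?_⟩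
          have := latX_add R f h2 h1
          convert! this using 1
          abel
      · rw [latW, if_neg (Int.not_even_iff_odd.2 hi)] at *
        exact hX i v hv
    · rw [e]
      exact f.latZ_add R hi hv (C.map_latW f R hi (f.latZ_subset_latW R hi hv))

end ModelM

/-! ### Coordinate description of the model of the space of hermitian forms. -/

section ModelH

variable {F E : Type*} [NontriviallyNormedField F] [NormedAlgebra ℚ_[2] F]
  [Field E] [Algebra F E] {σ : E ≃ₐ[F] E} {π : E}
  {V : Type*} [AddCommGroup V] [Module E V] {K : Type*} [Fintype K]
  {h : hermForms σ V} {L : Submodule (intRingExt F E) V} {d : K → ℤ} {x u : Basis K E V}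
  {T : Finset K}

/-- The congruences, in coordinates, that define the translate `H(A) - h` of `H(A)`. -/
structure HCond (π : E) (d : K → ℤ) (u : Basis K E V) (T : Finset K) (g : hermForms σ V) :
    Prop where
  entry : ∀ k l, g (u k) (u l) ∈ pideal F π (max (d k) (d l))
  norm : ∀ k, g (u k) (u k) ∈ pideal F π (2 * ((d k + 1) / 2) + 2)
  col : ∀ k, ∑ t ∈ near d T (d k), π ^ (-max (d k) (d t)) * g (u k) (u t) ∈ pideal F π 1
  diag : ∀ t ∈ T, Even (d t) → g (u t) (u t) ∈ pideal F π (d t + 4)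

variable (f : IsFrame h π L d x u T) (R : IsRamified F σ π)
include f R

omit f in
theorem HCond.herm_mem {g : hermForms σ V} (C : HCond π d u T g) {r s : K → ℤ} {v w : V} {n : ℤ}
    (hv : v ∈ box F π u r) (hw : w ∈ box F π u s)
    (hn : ∀ k l, n ≤ r k + s l + max (d k) (d l)) : g v w ∈ pideal F π n :=
  herm_mem_of_box R g hv hw fun k l => ⟨_, C.entry k l, hn k l⟩

/-- The entry bounds make the norm additive to the required precision, so only the diagonal values
g(u_k, u_k) count. -/
theorem HCond.norm_mem {g : hermForms σ V} (C : HCond π d u T g) {i : ℤ} {v : V}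
    (hv : v ∈ latA π h L i) : g v v ∈ pideal F π (2 * ((i + 1) / 2) + 2) := by
  rw [(f.swap R).mem_latA R] at hv
  have h1 := herm_sum_self_sub_mem R g Finset.univ (fun k => u.repr v k • u k) (M := (i + 1) / 2) (by
    intro k l _
    rw [herm_smul_left, herm_smul_right]
    exact mul_mem_of_le R (R.map_mem (hv k)) (mul_mem_pideal R.ne_zero (hv l) (C.entry k l))
      (by beta_reduce; omega))
  rw [u.sum_repr] at h1
  have h2 : ∑ k, g (u.repr v k • u k) (u.repr v k • u k) ∈ pideal F π (2 * ((i + 1) / 2) + 2) :=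
    AddSubgroup.sum_mem _ fun k _ => R.anti (by beta_reduce; omega) (norm_smul_mem R (hv k) (C.norm k))
  have := add_mem h1 h2
  rwa [sub_add_cancel] at this

theorem HCond.herm_u_mem {g : hermForms σ V} (C : HCond π d u T g) {t : K} (ht : t ∈ T)
    (hi : Even (d t)) {v : V} (hv : v ∈ latA π h L (d t)) : g v (u t) ∈ pideal F π (d t + 1) := by
  rw [(f.swap R).mem_latA R] at hv
  rw [← u.sum_repr v, herm_sum_left]
  refine AddSubgroup.sum_mem _ fun k _ => ?_
  rw [herm_smul_left]
  by_cases hk : d k = d t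
  · have := C.col k
    rw [hk, f.near_of_even hi ht rfl, Finset.sum_singleton,
      (isOrd_zpow R _).mul_mem_iff R (show 1 = -max (d t) (d t) + (d t + 1) by omega)] at this
    exact mul_mem_of_le R (R.map_mem (hv k)) this (by beta_reduce; omega)
  · exact mul_mem_of_le R (R.map_mem (hv k)) (C.entry k t) (by beta_reduce; omega)

theorem HCond.herm_latX_mem {g : hermForms σ V} (C : HCond π d u T g) {i : ℤ} {v w : V}
    (hv : v ∈ latA π h L i) (hw : w ∈ latX π h L i) : g v w ∈ pideal F π (i + 1) := by
  refine C.herm_mem R (((f.swap R).mem_latA R).1 hv) (((f.swap R).mem_latX R).1 hw) fun k l => ?_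
  unfold expX
  split_ifs <;> omega

/-- Again X_i = A_(i+1) + πA_(i-1), and the norm bounds for the two odd indices combine. -/
theorem HCond.norm_latX {g : hermForms σ V} (C : HCond π d u T g) {i : ℤ} (hi : Even i) {v : V}
    (hv : v ∈ latX π h L i) : g v v ∈ pideal F π (i + 4) := by
  obtain ⟨a, ha, b, hb, rfl⟩ := f.exists_of_mem_latX R hv
  have hone : π ∈ pideal F π 1 := by simpa using zpow_mem_pideal (F := F) π 1
  have h1 := C.norm_mem f R ha
  have h2 := C.norm_mem f R hb
  obtain ⟨m, rfl⟩ := hi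
  refine norm_add_mem R ⟨m, rfl⟩ ?_ (R.anti (by omega) h1)
    (R.anti (by omega) (norm_smul_mem R hone h2))
  rw [herm_smul_right]
  have h3 : g a b ∈ pideal F π (m + m + 1) :=
    C.herm_mem R (((f.swap R).mem_latA R).1 ha) (((f.swap R).mem_latA R).1 hb) fun k l => by omega
  exact mul_mem_of_le R hone h3 (by omega)

theorem HCond.herm_latW_mem {g : hermForms σ V} (C : HCond π d u T g) {i : ℤ} (hi : Even i)
    {v w : V} (hv : v ∈ latA π h L i) (hw : w ∈ latW π h L i) : g v w ∈ pideal F π (i + 1) := by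
  rcases (f.mem_latW R hi).1 hw with hw | ⟨t, ht, rfl, c, hc, hw⟩
  · exact C.herm_latX_mem f R hv hw
  · have h1 := C.herm_latX_mem f R hv hw
    have h2 := mul_mem_of_le R hc (C.herm_u_mem f R ht hi hv) (show d t + 1 ≤ _ by omega)
    rw [← herm_smul_right] at h2
    have := add_mem h1 h2
    rwa [← herm_add_right, sub_add_cancel] at this

theorem HCond.norm_latW {g : hermForms σ V} (C : HCond π d u T g) {i : ℤ} (hi : Even i)
    {w : V} (hw : w ∈ latW π h L i) : g w w ∈ pideal F π (i + 4) := by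
  rcases (f.mem_latW R hi).1 hw with hw | ⟨t, ht, rfl, c, hc, hw⟩
  · exact C.norm_latX f R hi hw
  · have h1 := C.norm_latX f R hi hw
    have h2 := norm_smul_mem R hc (C.diag t ht hi)
    rw [add_zero, zero_add] at h2
    have h3 := mul_mem_of_le R hc (C.herm_u_mem f R ht hi hw.1) (show d t + 1 ≤ _ by omega)
    rw [← herm_smul_right] at h3
    have := norm_add_mem R hi h3 h1 h2
    rwa [sub_add_cancel] at this

/-- Vectors of degree i use the congruence `col` in degree i. In an adjacent even degree containing
a leader, `col` in that degree supplies the missing factor π; all other entries are divisible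
enough. -/
theorem HCond.herm_eps_mem {g : hermForms σ V} (C : HCond π d u T g) {i : ℤ} (hi : Odd i) {v : V}
    (hv : v ∈ latA π h L i) : g v (eps π d u T i) ∈ pideal F π 0 := by
  rw [(f.swap R).mem_latA R] at hv
  rw [← u.sum_repr v, herm_sum_left]
  refine AddSubgroup.sum_mem _ fun k _ => ?_
  rw [herm_smul_left]
  by_cases hk : d k = i
  · subst hk
    have h1 : g (u k) (eps π d u T (d k)) ∈ pideal F π 0 := by
      have := mul_mem_of_le R (zpow_mem_pideal (F := F) π (-1)) (C.col k) (show 0 ≤ _ by omega)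
      rw [Finset.mul_sum] at this
      rw [eps, herm_sum_right]
      convert! this using 1
      refine Finset.sum_congr rfl fun t _ => ?_
      rw [herm_smul_right, ← mul_assoc, ← zpow_add₀ R.ne_zero]
      congr 1
    exact mul_mem_of_le R (R.map_mem (hv k)) h1 (by beta_reduce; omega)
  · rw [eps, herm_sum_right, Finset.mul_sum]
    refine AddSubgroup.sum_mem _ fun t ht => ?_
    rw [herm_smul_right]
    obtain ⟨htT, ht⟩ := mem_near.1 ht
    by_cases htk : d t = d k
    · have hev : Even (d k) := by
        rcases ht.resolve_left (fun h => hk (htk.symm.trans h)) with ⟨-, h1 | h1⟩ <;>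
          rw [← htk, h1]
        · exact hi.sub_odd odd_one
        · exact hi.add_odd odd_one
      have h1 := C.col k
      rw [f.near_of_even hev htT htk, Finset.sum_singleton,
        (isOrd_zpow R _).mul_mem_iff R (show 1 = -max (d k) (d t) + (d k + 1) by omega)] at h1
      exact mul_mem_of_le R (R.map_mem (hv k)) (mul_mem_pideal R.ne_zero (zpow_mem_pideal π _) h1)
        (by beta_reduce; omega)
    · refine mul_mem_of_le R (R.map_mem (hv k)) (mul_mem_pideal R.ne_zero (zpow_mem_pideal π _)
        (C.entry k t)) ?_
      rcases ht with ht | ⟨-, ht | ht⟩ <;> beta_reduce <;> omega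

theorem HCond.herm_latDual_mem {g : hermForms σ V} (C : HCond π d u T g) {i : ℤ} (hi : Odd i)
    {v w : V} (hv : v ∈ latA π h L i) (hw : w ∈ latDual F h (latB π h L i)) :
    g v w ∈ pideal F π 0 := by
  obtain ⟨c, hc, hw'⟩ := f.exists_of_mem_latDual_latB R hw
  have h1 : g v (w - c • eps π d u T i) ∈ pideal F π 0 :=
    C.herm_mem R (((f.swap R).mem_latA R).1 hv) (((f.swap R).mem_latDual_latA R).1 hw')
      fun k l => by omega
  have h2 := mul_mem_of_le R hc (C.herm_eps_mem f R hi hv) (show 0 ≤ _ by omega)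
  rw [← herm_smul_right] at h2
  have := add_mem h1 h2
  rwa [← herm_add_right, sub_add_cancel] at this

/-- On the vectors `u k`, condition (a) is `entry`, (b) is `norm`, (d) is `diag`; `col` is (c) in
even degree and (e) in odd degree. -/
theorem isModelH_iff (hd : ∀ k, 0 ≤ d k) {g : hermForms σ V} :
    IsModelH π h L g ↔ HCond π d u T (g - h) := by
  classical
  have hsub : ∀ v w, (g - h : hermForms σ V) v w = g v w - h v w := fun v w => rfl
  have huA : ∀ l, u l ∈ latA π h L (d l) := fun l => by
    rw [(f.swap R).mem_latA R, ← one_smul E (u l)]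
    refine basis_mem_box ?_
    rw [sub_self, max_self]
    exact isOrd_one.2.1
  have hone : IsOrd F π π 1 := by simpa using isOrd_zpow R 1
  have hxi : ∀ m : ℤ, IsOrd F π ((π * σ π) ^ (-m)) (2 * -m) := fun m => (isOrd_xi R).zpow R _
  have huW : ∀ t ∈ T, Even (d t) → u t ∈ latW π h L (d t) := by
    intro t ht hi
    refine (f.mem_latW R hi).2 (Or.inr ⟨t, ht, rfl, 1, isOrd_one.2.1, ?_⟩)
    rw [one_smul, sub_self, f.mem_latX R]
    exact zero_mem _
  have hC : ∀ (i : ℤ) a w, InIdeal F π (π ^ (-i) * g a w - π ^ (-i) * h a w) ↔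
      (g - h : hermForms σ V) a w ∈ pideal F π (i + 1) := by
    intro i a w
    rw [hone.inIdeal_iff R, ← mul_sub, (isOrd_zpow R (-i)).mul_mem_iff R
      (show 1 = -i + (i + 1) by omega), hsub]
  have hB : ∀ (m : ℤ) a, InIdeal F 2 ((π * σ π) ^ (-m) * g a a - (π * σ π) ^ (-m) * h a a) ↔
      (g - h : hermForms σ V) a a ∈ pideal F π (2 * m + 2) := by
    intro m a
    rw [(isOrd_two R).inIdeal_iff R, ← mul_sub, (hxi m).mul_mem_iff R
      (show 2 = 2 * -m + (2 * m + 2) by omega), hsub]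
  have hD : ∀ (m : ℤ) a, InIdeal F 4 ((π * σ π) ^ (-m) * g a a - (π * σ π) ^ (-m) * h a a) ↔
      (g - h : hermForms σ V) a a ∈ pideal F π (2 * m + 4) := by
    intro m a
    rw [(isOrd_four R).inIdeal_iff R, ← mul_sub, (hxi m).mul_mem_iff R
      (show 4 = 2 * -m + (2 * m + 4) by omega), hsub]
  constructor
  · intro H
    have hle : ∀ k l, (g - h : hermForms σ V) (u k) (u l) ∈ pideal F π (d l) := fun k l => by
      rw [hsub]
      exact sub_mem (H.cond_a (d l) _ (huA k).1 _ (huA l))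
        ((herm_mem_symm R h).1 ((huA l).2 _ (huA k).1))
    refine ⟨fun k l => ?_, fun k => ?_, fun k => ?_, fun t ht hi => ?_⟩
    · rcases le_total (d k) (d l) with hkl | hkl
      · rw [max_eq_right hkl]
        exact hle k l
      · rw [max_eq_left hkl, herm_mem_symm R]
        exact hle l k
    · exact (hB _ _).1 (H.cond_b (d k) ((d k + 1) / 2) (by omega) _ (huA k))
    · rcases Int.even_or_odd (d k) with hk | hk
      · by_cases hT : ∃ t ∈ T, d t = d k
        · obtain ⟨t, ht, htk⟩ := hT
          rw [f.near_of_even hk ht htk, Finset.sum_singleton,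
            (isOrd_zpow R _).mul_mem_iff R (show 1 = -max (d k) (d t) + (d k + 1) by omega)]
          refine (hC _ _ _).1 (H.cond_c (d k) hk _ (huA k) _ ?_)
          rw [← htk]
          exact huW t ht (htk ▸ hk)
        · push Not at hT
          rw [near_eq_empty_of_even hk hT]
          simp [zero_mem]
      · have h1 := mem_pideal_zero (π := π).2 (H.cond_e₂ (d k) hk _ (huA k) _ (f.eps_mem_latDual R _))
        rw [← hsub, eps, herm_sum_right] at h1
        have := mul_mem_of_le R hone.2.1 h1 (show 1 ≤ _ by omega)
        rw [Finset.mul_sum] at this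
        convert! this using 1
        refine Finset.sum_congr rfl fun t _ => ?_
        rw [herm_smul_right, ← mul_assoc, ← zpow_one_add₀ R.ne_zero]
        congr 2
        omega
    · have := H.cond_d (d t) (d t / 2) (by obtain ⟨m, hm⟩ := hi; omega) _ (huW t ht hi)
      rw [hD] at this
      obtain ⟨m, hm⟩ := hi
      exact R.anti (by omega) this
  · intro C
    have hgh : ∀ v w, g v w = (g - h : hermForms σ V) v w + h v w := fun v w => by
      rw [hsub, sub_add_cancel]
    have he : ∀ i, Odd i → ∀ a ∈ latA π h L i, ∀ b ∈ latDual F h (latB π h L i),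
        g a b - h a b ∈ intRingExt F E := fun i hi a ha b hb => by
      rw [← hsub, ← mem_pideal_zero (π := π)]
      exact C.herm_latDual_mem f R hi ha hb
    have ha : ∀ i, ∀ v ∈ L, ∀ a ∈ latA π h L i, InIdeal F (π ^ i) (g v a) := by
      intro i v hv a ha
      rw [hgh]
      refine (pideal F π i).add_mem (C.herm_mem R ((f.mem_right v).1 hv)
        (((f.swap R).mem_latA R).1 ha) fun k l => ?_) ((herm_mem_symm R h).1 (ha.2 v hv))
      simp only [Pi.zero_apply]
      omega
    refine ⟨fun v hv w hw => ?_, ha, fun i m him a haa => (hB _ _).2 (R.anti (by omega)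
      (C.norm_mem f R haa)), fun i hi a ha w hw => (hC _ _ _).2 (C.herm_latW_mem f R hi ha hw),
      fun i m him w hw => (hD _ _).2 (R.anti (by omega)
        (C.norm_latW f R ⟨m, by omega⟩ hw)), fun i hi b hb b' hb' => ?_, he⟩
    · rw [← mem_pideal_zero (π := π)]
      refine ha 0 v hv w ?_
      rw [f.mem_latA R]
      refine box_mono R (fun k => ?_) ((f.mem_left w).1 hw)
      have := hd k
      simp only [Pi.zero_apply]
      omega
    -- The first half of (e) follows from the second, because h(b, b') is integral for b in B_i and
    -- b' in its dual.
    · rw [← sub_add_cancel (g b b') (h b b')]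
      refine add_mem (he i hi b hb.1 b' hb') (mem_pideal_zero (π := π).1 ?_)
      rw [herm_mem_symm R, mem_pideal_zero]
      exact hb' b hb

end ModelH

/-! ### Choice of a pivot entry for each congruence. -/

section Pivots

variable {F E : Type*} [NontriviallyNormedField F] [NormedAlgebra ℚ_[2] F]
  [Field E] [Algebra F E] {σ : E ≃ₐ[F] E} {π : E}

theorem relIndex_pideal (R : IsRamified F σ π) (i : ℤ) (n : ℕ) :
    (pideal F π (i + n)).relIndex (pideal F π i) = (2 ^ finrank ℚ_[2] F) ^ n := by
  induction n with
  | zero => simp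
  | succ n ih =>
    rw [← AddSubgroup.relIndex_mul_relIndex (pideal F π (i + (n + 1 : ℕ))) (pideal F π (i + n))
      (pideal F π i) (R.anti (by push_cast; omega)) (R.anti (by omega)), ih, pow_succ']
    congr 1
    rw [← R.relIndex_succ (i + n)]
    congr 2
    push_cast
    ring

/-- Multiplication by π^(m k) solves the congruence for the k-th entry, which keeps coefficient 1 as
needed for a unipotent change of coordinates. -/
theorem sum_zpow_mem_iff (R : IsRamified F σ π) {K : Type*} [DecidableEq K] {s : Finset K} {k : K}
    (hk : k ∈ s) (m : K → ℤ) (a : K → E) :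
    ∑ t ∈ s, π ^ (-m t) * a t ∈ pideal F π 1 ↔
      a k + ∑ t ∈ s.erase k, π ^ (m k - m t) * a t ∈ pideal F π (m k + 1) := by
  have e : ∑ t ∈ s, π ^ (-m t) * a t =
      π ^ (-m k) * (a k + ∑ t ∈ s.erase k, π ^ (m k - m t) * a t) := by
    rw [← Finset.add_sum_erase _ _ hk, mul_add, Finset.mul_sum]
    congr 1
    refine Finset.sum_congr rfl fun t _ => ?_
    rw [← mul_assoc, ← zpow_add₀ R.ne_zero]
    congr 2
    ring
  rw [e, (isOrd_zpow R _).mul_mem_iff R (show 1 = -m k + (m k + 1) by ring)]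

variable {V : Type*} [AddCommGroup V] [Module E V] {K : Type*} [Fintype K]
  {h : hermForms σ V} {L : Submodule (intRingExt F E) V} {d : K → ℤ} {x u : Basis K E V}
  {T : Finset K}

/-- A choice of an element of `near d T i` for each `i` for which this set is not empty; a leader
of degree `i` is chosen only if there is no other possibility. -/
structure IsPivot (d : K → ℤ) (T : Finset K) (ρ : ℤ → Option K) : Prop where
  eq_none_iff : ∀ i, ρ i = none ↔ near d T i = ∅
  mem_near : ∀ {i t}, ρ i = some t → t ∈ near d T i
  near_eq : ∀ {i t}, ρ i = some t → d t = i → near d T i = {t}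

/-- A leader of another degree is preferred. If none is near, all candidates have degree i, and
since a degree has at most one leader the candidate is unique. -/
theorem IsFrame.exists_isPivot (f : IsFrame h π L d x u T) : ∃ ρ, IsPivot d T ρ := by
  classical
  have key : ∀ i, ∃ o : Option K, (o = none ↔ near d T i = ∅) ∧ (∀ t, o = some t → t ∈ near d T i) ∧
      ∀ t, o = some t → d t = i → near d T i = {t} := by
    intro i
    by_cases h1 : ∃ t ∈ near d T i, d t ≠ i
    · obtain ⟨t, ht, hti⟩ := h1
      refine ⟨some t, ?_, ?_, ?_⟩
      · simp only [reduceCtorEq, false_iff]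
        exact Finset.ne_empty_of_mem ht
      · rintro s hs
        rwa [← Option.some.inj hs]
      · rintro s hs h2
        rw [← Option.some.inj hs] at h2
        exact absurd h2 hti
    · push Not at h1
      rcases (near d T i).eq_empty_or_nonempty with h2 | ⟨t, ht⟩
      · exact ⟨none, by simp [h2], by simp, by simp⟩
      · refine ⟨some t, ?_, ?_, ?_⟩
        · simp only [reduceCtorEq, false_iff]
          exact Finset.ne_empty_of_mem ht
        · rintro s hs
          rwa [← Option.some.inj hs]
        · rintro s hs -
          rw [← Option.some.inj hs]
          ext r
          rw [Finset.mem_singleton]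
          constructor
          · intro hr
            exact f.leader_inj (mem_near.1 hr).1 (mem_near.1 ht).1 ((h1 r hr).trans (h1 t ht).symm)
          · rintro rfl
            exact ht
  choose ρ h1 h2 h3 using key
  exact ⟨ρ, h1, fun {i t} => h2 i t, fun {i t} => h3 i t⟩

variable {ρ : ℤ → Option K}

theorem IsPivot.mem (P : IsPivot d T ρ) {i : ℤ} {t : K} (h : ρ i = some t) : t ∈ T :=
  (HermLat.mem_near.1 (P.mem_near h)).1

/-- A pivot of a different degree occurs only for an odd index and has even degree, so two distinct
degrees cannot be pivots of one another; two leaders of the same degree coincide. Hence row and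
column congruences can compete for an entry only on the diagonal. -/
theorem IsPivot.eq_of_eq (P : IsPivot d T ρ) (f : IsFrame h π L d x u T) {k l : K}
    (hk : ρ (d k) = some l) (hl : ρ (d l) = some k) : k = l := by
  obtain ⟨hlT, h1⟩ := HermLat.mem_near.1 (P.mem_near hk)
  obtain ⟨hkT, h2⟩ := HermLat.mem_near.1 (P.mem_near hl)
  refine f.leader_inj hkT hlT ?_
  rcases h1 with h1 | ⟨⟨a, ha⟩, h1⟩
  · exact h1.symm
  · rcases h2 with h2 | ⟨⟨b, hb⟩, h2⟩ <;> omega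

/-- The same parity argument shows that the remaining entries of a congruence with an off-diagonal
pivot are not pivots of the other kind, which makes the system triangular. -/
theorem IsPivot.ne_of_mem_near (P : IsPivot d T ρ) (f : IsFrame h π L d x u T) {k l t : K}
    (hl : ρ (d l) = some k) (hk : ρ (d k) ≠ some l) (ht : t ∈ near d T (d l)) (htk : t ≠ k) :
    ρ (d t) ≠ some l := by
  intro h3
  obtain ⟨hkT, h1⟩ := HermLat.mem_near.1 (P.mem_near hl)
  obtain ⟨htT, h2⟩ := HermLat.mem_near.1 ht
  obtain ⟨hlT, h4⟩ := HermLat.mem_near.1 (P.mem_near h3)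
  have key : d t = d l := by
    rcases h2 with h2 | ⟨⟨a, ha⟩, h2⟩
    · exact h2
    · rcases h4 with h4 | ⟨⟨b, hb⟩, h4⟩ <;> omega
  have e := f.leader_inj htT hlT key
  subst e
  rw [hl] at h3
  exact htk (Option.some.inj h3).symm

end Pivots

/-! ### The index of the model in End_B(L). -/

section IndexM

variable {F E : Type*} [NontriviallyNormedField F] [NormedAlgebra ℚ_[2] F]
  [Field E] [Algebra F E] {σ : E ≃ₐ[F] E} {π : E}
  {V : Type*} [AddCommGroup V] [Module E V] {K : Type*} [Fintype K]
  {h : hermForms σ V} {L : Submodule (intRingExt F E) V} {d : K → ℤ} {x u : Basis K E V}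
  {T : Finset K} {ρ : ℤ → Option K}

open Classical in
/-- The exponents of the congruences that cut out `M(A) - 1`. -/
def expCondM (d : K → ℤ) (ρ : ℤ → Option K) (p : K × K) : ℕ :=
  if ρ (d p.2) = some p.1 then
    if ρ (d p.1) = some p.2 then if Even (d p.1) then 2 else 1 else 1
  else if ρ (d p.1) = some p.2 then 1 else 0

open Classical in
/-- The unipotent change of coordinates that makes the congruences defining `M(A)` diagonal. -/
def shearM (π : E) (d : K → ℤ) (T : Finset K) (ρ : ℤ → Option K) :
    (K × K → E) →+ (K × K → E) where
  toFun y p :=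
    if ρ (d p.2) = some p.1 then
      if ρ (d p.1) = some p.2 then
        if Even (d p.1) then
          ∑ s ∈ (T.filter fun s => expX (d p.1) (d s) + (d s + 1) / 2 = d p.1 / 2 + 1).erase p.1,
            π ^ (1 - expX (d p.1) (d s)) * y (s, p.2)
        else 0
      else ∑ t ∈ (near d T (d p.2)).erase p.1,
        π ^ (max 0 (d p.2 - d p.1) - max 0 (d p.2 - d t)) * y (t, p.2)
    else if ρ (d p.1) = some p.2 then ∑ t ∈ (near d T (d p.1)).erase p.2,
        π ^ (max 0 (d p.2 - d p.1) - max 0 (d t - d p.1)) * y (p.1, t)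
    else 0
  map_zero' := by
    funext p
    simp
  map_add' y z := by
    funext p
    simp only [Pi.add_apply]
    split_ifs <;> simp [mul_add, Finset.sum_add_distrib]

/-- The matrix of an endomorphism with respect to the bases `u` and `x`. -/
def entriesM (x u : Basis K E V) : Module.End E V →+ (K × K → E) where
  toFun X p := x.repr (X (u p.2)) p.1
  map_zero' := by
    funext p
    simp
  map_add' X Y := by
    funext p
    simp

theorem entriesM_surjective : Function.Surjective (entriesM x u) := by
  classical
  intro y
  refine ⟨u.constr ℕ fun l => ∑ k, y (k, l) • x k, ?_⟩
  funext p
  change x.repr (u.constr ℕ (fun l => ∑ k, y (k, l) • x k) (u p.2)) p.1 = _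
  rw [u.constr_basis, x.repr_sum_self]

variable (f : IsFrame h π L d x u T) (R : IsRamified F σ π) (P : IsPivot d T ρ)
include f R

/-- The lattice `End_B(L)`. -/
theorem mem_naiveM_iff {X : Module.End E V} :
    X ∈ naiveM L ↔ ∀ p, entriesM x u X p ∈ pideal F π 0 := by
  classical
  constructor
  · intro hX p
    have hu : u p.2 ∈ L := by
      rw [f.mem_right, ← one_smul E (u p.2)]
      exact basis_mem_box isOrd_one.2.1
    exact (f.mem_left _).1 (hX _ hu) p.1
  · intro hX v hv
    rw [f.mem_right] at hv
    rw [f.mem_left]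
    intro k
    rw [← u.sum_repr v, map_sum, map_sum, Finsupp.finsetSum_apply]
    refine AddSubgroup.sum_mem _ fun l _ => ?_
    rw [map_smul, map_smul, Finsupp.smul_apply, smul_eq_mul]
    exact mul_mem_of_le R (hv l) (hX (k, l)) (by simp)

include P

/-- Each row or column congruence is attached to its pivot entry. At (k,k) with k the pivot of its
own degree, row and column congruence both say that the entry lies in πB; in even degree `diag`
replaces them by a sheared condition modulo π², which accounts for the exponent 2 against 1 in odd
degree. -/
theorem mCond_iff {X : Module.End E V} : MCond F π d x u T X ↔
    (∀ p : K × K, entriesM x u X p ∈ pideal F π (max 0 (d p.2 - d p.1))) ∧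
    ∀ p : K × K, entriesM x u X p + shearM π d T ρ (entriesM x u X) p ∈
      pideal F π (max 0 (d p.2 - d p.1) + expCondM d ρ p) := by
  classical
  have hX : ∀ k l, x.repr (X (u l)) k = entriesM x u X (k, l) := fun _ _ => rfl
  set y := entriesM x u X with hy
  have hrow : ∀ {k l}, ρ (d l) = some k → ρ (d k) ≠ some l →
      (phi π d x T (d l) (X (u l)) ∈ pideal F π 1 ↔
        y (k, l) + shearM π d T ρ y (k, l) ∈
          pideal F π (max 0 (d l - d k) + expCondM d ρ (k, l))) := by
    intro k l h1 h2
    simp only [phi_apply, hX, expCondM, shearM, AddMonoidHom.coe_mk, ZeroHom.coe_mk, h1, h2,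
      if_true, if_false, Nat.cast_one]
    exact sum_zpow_mem_iff R (P.mem_near h1) (fun t => max 0 (d l - d t)) fun t => y (t, l)
  have hcol : ∀ {k l}, ρ (d k) = some l → ρ (d l) ≠ some k →
      (∑ t ∈ near d T (d k), π ^ (-max 0 (d t - d k)) * x.repr (X (u t)) k ∈ pideal F π 1 ↔
        y (k, l) + shearM π d T ρ y (k, l) ∈
          pideal F π (max 0 (d l - d k) + expCondM d ρ (k, l))) := by
    intro k l h1 h2
    simp only [hX, expCondM, shearM, AddMonoidHom.coe_mk, ZeroHom.coe_mk, h1, h2,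
      if_true, if_false, Nat.cast_one]
    exact sum_zpow_mem_iff R (P.mem_near h1) (fun t => max 0 (d t - d k)) fun t => y (k, t)
  have hrowd : ∀ {k}, ρ (d k) = some k →
      (phi π d x T (d k) (X (u k)) ∈ pideal F π 1 ↔ y (k, k) ∈ pideal F π 1) := by
    intro k h1
    rw [phi_apply, P.near_eq h1 rfl, Finset.sum_singleton, hX]
    simp
  have hcold : ∀ {k}, ρ (d k) = some k →
      (∑ t ∈ near d T (d k), π ^ (-max 0 (d t - d k)) * x.repr (X (u t)) k ∈ pideal F π 1 ↔
        y (k, k) ∈ pideal F π 1) := by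
    intro k h1
    rw [P.near_eq h1 rfl, Finset.sum_singleton, hX]
    simp
  have hdiag : ∀ {k}, ρ (d k) = some k → Even (d k) →
      (∑ s ∈ T with expX (d k) (d s) + (d s + 1) / 2 = d k / 2 + 1,
        π ^ (-expX (d k) (d s)) * x.repr (X (u k)) s ∈ pideal F π 1 ↔
        y (k, k) + shearM π d T ρ y (k, k) ∈
          pideal F π (max 0 (d k - d k) + expCondM d ρ (k, k))) := by
    intro k h1 h2
    have hk : k ∈ T.filter fun s => expX (d k) (d s) + (d s + 1) / 2 = d k / 2 + 1 := by
      rw [Finset.mem_filter]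
      refine ⟨P.mem h1, ?_⟩
      obtain ⟨m, hm⟩ := h2
      simp only [expX, if_true]
      omega
    have := sum_zpow_mem_iff R hk (fun s => expX (d k) (d s)) fun s => y (s, k)
    simp only [hX, expCondM, shearM, AddMonoidHom.coe_mk, ZeroHom.coe_mk, h1, h2, if_true] at this ⊢
    rw [this]
    simp only [expX, if_true, sub_self, max_self]
    norm_num
  -- The condition stored at (k,k) recovers the row and column congruences: the other terms of the
  -- `diag` sum, scaled to coefficient 1 at (k,k), lie in πB by the entry bounds.
  have hdiag1 : ∀ {k}, (∀ p : K × K, y p ∈ pideal F π (max 0 (d p.2 - d p.1))) → ρ (d k) = some k →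
      y (k, k) + shearM π d T ρ y (k, k) ∈
          pideal F π (max 0 (d k - d k) + expCondM d ρ (k, k)) → y (k, k) ∈ pideal F π 1 := by
    intro k hent h1 h2
    rcases Int.even_or_odd (d k) with h3 | h3
    · simp only [expCondM, shearM, AddMonoidHom.coe_mk, ZeroHom.coe_mk, h1, h3, if_true] at h2
      have h4 : ∑ s ∈ (T.filter fun s => expX (d k) (d s) + (d s + 1) / 2 = d k / 2 + 1).erase k,
            π ^ (1 - expX (d k) (d s)) * y (s, k) ∈ pideal F π 1 := by
        refine AddSubgroup.sum_mem _ fun s hs => ?_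
        rw [Finset.mem_erase, Finset.mem_filter] at hs
        have hne : d s ≠ d k := fun e => hs.1 (f.leader_inj hs.2.1 (P.mem h1) e)
        refine mul_mem_of_le R (zpow_mem_pideal π _) (hent (s, k)) ?_
        simp only [expX, hne, if_false]
        omega
      have := sub_mem (R.anti (by push_cast; omega) h2) h4
      rwa [add_sub_cancel_right] at this
    · have h3' : ¬ Even (d k) := Int.not_even_iff_odd.2 h3
      simp only [expCondM, shearM, AddMonoidHom.coe_mk, ZeroHom.coe_mk, h1, h3', if_true,
        if_false, add_zero, sub_self, max_self] at h2
      simpa using h2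
  have hsome : ∀ {t}, t ∈ T → Even (d t) → ρ (d t) = some t := by
    intro t ht hi
    have h1 := f.near_of_even hi ht rfl
    cases h2 : ρ (d t) with
    | none =>
      rw [P.eq_none_iff, h1] at h2
      exact absurd h2 (Finset.singleton_ne_empty t)
    | some s =>
      have := P.mem_near h2
      rw [h1, Finset.mem_singleton] at this
      rw [this]
  constructor
  · intro C
    refine ⟨fun p => C.entry p.1 p.2, fun ⟨k, l⟩ => ?_⟩
    by_cases h1 : ρ (d l) = some k
    · by_cases h2 : ρ (d k) = some l
      · obtain rfl := P.eq_of_eq f h2 h1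
        rcases Int.even_or_odd (d k) with h3 | h3
        · exact (hdiag h1 h3).1 (C.diag k (P.mem h1) h3)
        · have h3' : ¬ Even (d k) := Int.not_even_iff_odd.2 h3
          have := (hrowd h1).1 (C.row k)
          simp only [expCondM, shearM, AddMonoidHom.coe_mk, ZeroHom.coe_mk, h1, h3', if_true,
            if_false, add_zero, sub_self, max_self]
          simpa using this
      · exact (hrow h1 h2).1 (C.row l)
    · by_cases h2 : ρ (d k) = some l
      · exact (hcol h2 h1).1 (C.col k)
      · simp only [expCondM, shearM, AddMonoidHom.coe_mk, ZeroHom.coe_mk, h1, h2, if_false, add_zero,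
          Nat.cast_zero]
        exact C.entry k l
  · rintro ⟨hent, hp⟩
    refine ⟨fun k l => hent (k, l), fun l => ?_, fun k => ?_, fun t ht hi =>
      (hdiag (hsome ht hi) hi).2 (hp (t, t))⟩
    · cases h1 : ρ (d l) with
      | none =>
        rw [phi_apply, (P.eq_none_iff _).1 h1]
        simp [zero_mem]
      | some k =>
        by_cases h2 : ρ (d k) = some l
        · obtain rfl := P.eq_of_eq f h2 h1
          exact (hrowd h1).2 (hdiag1 hent h1 (hp (k, k)))
        · exact (hrow h1 h2).2 (hp (k, l))
    · cases h1 : ρ (d k) with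
      | none =>
        rw [(P.eq_none_iff _).1 h1]
        simp [zero_mem]
      | some l =>
        by_cases h2 : ρ (d l) = some k
        · obtain rfl := P.eq_of_eq f h1 h2
          exact (hcold h1).2 (hdiag1 hent h1 (hp (k, k)))
        · exact (hcol h1 h2).2 (hp (k, l))

variable (L) in
omit f R P [Fintype K] in
/-- `End_B(L)` as a subgroup of `End_E(V)`. -/
def latM : AddSubgroup (Module.End E V) where
  carrier := naiveM L
  zero_mem' v _ := by simp [zero_mem]
  add_mem' hX hY v hv := add_mem (hX v hv) (hY v hv)
  neg_mem' {X} hX v hv := by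
    rw [LinearMap.neg_apply, ← neg_one_smul (intRingExt F E) (X v)]
    exact L.smul_mem _ (hX v hv)

/-- The lattice `M(A) - 1` and its index in `End_B(L)`. -/
theorem exists_lattice_modelM : ∃ S : AddSubgroup (Module.End E V),
    (∀ X, X ∈ S ↔ MCond F π d x u T X) ∧ S ≤ latM L ∧
    S.relIndex (latM L) = (2 ^ finrank ℚ_[2] F) ^
      (∑ p : K × K, (max 0 (d p.2 - d p.1)).toNat + ∑ p, expCondM d ρ p) := by
  classical
  let G : K × K → AddSubgroup E := fun p => pideal F π (max 0 (d p.2 - d p.1))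
  let G' : K × K → AddSubgroup E := fun p =>
    pideal F π (max 0 (d p.2 - d p.1) + expCondM d ρ p)
  let S' : AddSubgroup (K × K → E) :=
    (AddSubgroup.pi Set.univ G').comap (AddMonoidHom.id _ + shearM π d T ρ)
  have hM : latM L = (AddSubgroup.pi Set.univ fun _ => pideal F π 0).comap (entriesM x u) := by
    ext X
    rw [AddSubgroup.mem_comap, AddSubgroup.mem_pi]
    simp only [Set.mem_univ, forall_true_left]
    exact mem_naiveM_iff f R
  have h1 : (AddSubgroup.pi Set.univ G).relIndex (AddSubgroup.pi Set.univ fun _ => pideal F π 0) =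
      (2 ^ finrank ℚ_[2] F) ^ (∑ p : K × K, (max 0 (d p.2 - d p.1)).toNat) := by
    rw [relIndex_pi_univ, ← Finset.prod_pow_eq_pow_sum]
    refine Finset.prod_congr rfl fun p _ => ?_
    rw [← relIndex_pideal R 0]
    congr 2
    rw [Int.toNat_of_nonneg (le_max_left _ _), zero_add]
  have h2 : S'.relIndex (AddSubgroup.pi Set.univ G) =
      (2 ^ finrank ℚ_[2] F) ^ (∑ p, expCondM d ρ p) := by
    rw [← Finset.prod_pow_eq_pow_sum]
    -- The exponent itself serves as the rank: a row or column congruence (rank 1) involves only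
    -- entries without a congruence, and a `diag` congruence (rank 2) involves besides its pivot
    -- only entries of rank at most 1.
    refine (relIndex_unipotent G' G (shearM π d T ρ) (expCondM d ρ) ?_ ?_).trans
      (Finset.prod_congr rfl fun p _ => relIndex_pideal R _ _)
    · rintro y hy ⟨k, l⟩
      simp only [shearM, AddMonoidHom.coe_mk, ZeroHom.coe_mk]
      split_ifs with h1 h2 h3 h4
      · refine AddSubgroup.sum_mem _ fun s _ => ?_
        have hkl := P.eq_of_eq f h2 h1
        refine mul_mem_of_le R (zpow_mem_pideal π _) (hy (s, l)) ?_
        simp only [expX, hkl]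
        split_ifs <;> omega
      · exact zero_mem _
      · refine AddSubgroup.sum_mem _ fun t _ => mul_mem_of_le R (zpow_mem_pideal π _) (hy (t, l)) ?_
        simp only
        omega
      · refine AddSubgroup.sum_mem _ fun t _ => mul_mem_of_le R (zpow_mem_pideal π _) (hy (k, t)) ?_
        simp only
        omega
      · exact zero_mem _
    · rintro y ⟨k, l⟩ hs
      simp only [shearM, AddMonoidHom.coe_mk, ZeroHom.coe_mk]
      simp only [expCondM] at hs
      split_ifs with h1 h2 h3 h4
      · refine Finset.sum_eq_zero fun s hsT => ?_
        rw [hs (s, l), mul_zero]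
        simp only [h1, h2, h3, if_true]
        have hsk : s ≠ k := (Finset.mem_erase.1 hsT).1
        have : (some k : Option K) ≠ some s := fun e => hsk (Option.some.inj e).symm
        rw [if_neg this]
        split_ifs <;> omega
      · rfl
      · refine Finset.sum_eq_zero fun t ht => ?_
        obtain ⟨htk, ht⟩ := Finset.mem_erase.1 ht
        rw [hs (t, l), mul_zero]
        have h5 := P.ne_of_mem_near f h1 h2 ht htk
        have : (some k : Option K) ≠ some t := fun e => htk (Option.some.inj e).symm
        simp [h1, h2, h5, this]
      · refine Finset.sum_eq_zero fun t ht => ?_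
        obtain ⟨htk, ht⟩ := Finset.mem_erase.1 ht
        rw [hs (k, t), mul_zero]
        have h5 := P.ne_of_mem_near f h4 h1 ht htk
        have : (some l : Option K) ≠ some t := fun e => htk (Option.some.inj e).symm
        simp [h1, h4, h5, this]
      · rfl
  have hG0 : AddSubgroup.pi Set.univ G ≤ AddSubgroup.pi Set.univ fun _ => pideal F π 0 :=
    fun y hy p hp => R.anti (le_max_left _ _) (hy p hp)
  refine ⟨(S' ⊓ AddSubgroup.pi Set.univ G).comap (entriesM x u), fun X => ?_, ?_, ?_⟩
  · rw [mCond_iff f R P, AddSubgroup.mem_comap, AddSubgroup.mem_inf, and_comm]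
    simp only [S', AddSubgroup.mem_comap, AddSubgroup.mem_pi, Set.mem_univ, forall_true_left]
    rfl
  · rw [hM]
    exact AddSubgroup.comap_mono (inf_le_right.trans hG0)
  · rw [hM, AddSubgroup.relIndex_comap,
      AddSubgroup.map_comap_eq_self_of_surjective entriesM_surjective,
      ← AddSubgroup.relIndex_mul_relIndex _ _ _ inf_le_right hG0, AddSubgroup.inf_relIndex_right,
      h1, h2, pow_add, mul_comm]

end IndexM

/-! ### The index of the model in the lattice of integral hermitian forms. -/

section IndexH

variable {F E : Type*} [NontriviallyNormedField F] [NormedAlgebra ℚ_[2] F]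
  [Field E] [Algebra F E] {σ : E ≃ₐ[F] E} {π : E}
  {V : Type*} [AddCommGroup V] [Module E V] {K : Type*} [Fintype K]
  {h : hermForms σ V} {L : Submodule (intRingExt F E) V} {d : K → ℤ} {x u : Basis K E V}
  {T : Finset K} {ρ : ℤ → Option K}

/-- The elements of `E` fixed by `σ`. -/
def fixedPts (σ : E ≃ₐ[F] E) : AddSubgroup E := (σ.toAlgHom.toLinearMap - 1).toAddMonoidHom.ker

theorem mem_fixedPts {a : E} : a ∈ fixedPts σ ↔ σ a = a := by
  rw [fixedPts, AddMonoidHom.mem_ker]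
  exact sub_eq_zero

theorem relIndex_pideal_inf_fixedPts (R : IsRamified F σ π) (j : ℤ) (n : ℕ) :
    (pideal F π (2 * (j + n)) ⊓ fixedPts σ).relIndex (pideal F π (2 * j) ⊓ fixedPts σ) =
      (2 ^ finrank ℚ_[2] F) ^ n := by
  induction n with
  | zero => simp
  | succ n ih =>
    rw [← AddSubgroup.relIndex_mul_relIndex (pideal F π (2 * (j + (n + 1 : ℕ))) ⊓ fixedPts σ)
      (pideal F π (2 * (j + n)) ⊓ fixedPts σ) (pideal F π (2 * j) ⊓ fixedPts σ)
      (inf_le_inf_right _ (R.anti (by push_cast; omega)))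
      (inf_le_inf_right _ (R.anti (by omega))), ih, pow_succ']
    congr 1
    rw [← R.relIndex_fixed (j + n)]
    congr 3
    push_cast
    ring

/-- Pairs of indices, ordered by means of `e`. -/
abbrev OrdPair (e : K → ℕ) : Type _ := {p : K × K // e p.1 ≤ e p.2}

open Classical in
/-- The additional exponents of the congruences that cut out `H(A) - h`. -/
def expCondH (d : K → ℤ) (ρ : ℤ → Option K) (k l : K) : ℕ :=
  if k = l then if Even (d k) ∧ ρ (d k) = some k then 1 else 0
  else if ρ (d k) = some l ∨ ρ (d l) = some k then 1 else 0

open Classical in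
/-- The group `π^i B` for an off-diagonal entry, its `σ`-fixed part for a diagonal entry. -/
def entryGroup (F : Type*) {E : Type*} [NontriviallyNormedField F] [NormedAlgebra ℚ_[2] F]
    [Field E] [Algebra F E] (σ : E ≃ₐ[F] E) (π : E) (p : K × K) (i j : ℤ) : AddSubgroup E :=
  if p.1 = p.2 then pideal F π (2 * i) ⊓ fixedPts σ else pideal F π j

theorem entryGroup_mono (R : IsRamified F σ π) {p : K × K} {i j i' j' : ℤ} (hi : i ≤ i')
    (hj : j ≤ j') : entryGroup F σ π p i' j' ≤ entryGroup F σ π p i j := by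
  unfold entryGroup
  split_ifs
  · exact inf_le_inf_right _ (R.anti (by omega))
  · exact R.anti hj

theorem relIndex_entryGroup (R : IsRamified F σ π) (p : K × K) (i j : ℤ) (n : ℕ) :
    (entryGroup F σ π p (i + n) (j + n)).relIndex (entryGroup F σ π p i j) =
      (2 ^ finrank ℚ_[2] F) ^ n := by
  unfold entryGroup
  split_ifs
  · exact relIndex_pideal_inf_fixedPts R i n
  · exact relIndex_pideal R j n

/-- The values of a hermitian form on ordered pairs of basis vectors. -/
def entriesH (σ : E ≃ₐ[F] E) (u : Basis K E V) (e : K → ℕ) :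
    hermForms σ V →+ (OrdPair e → E) where
  toFun g p := g (u p.1.1) (u p.1.2)
  map_zero' := rfl
  map_add' _ _ := rfl

/-- The entries below the diagonal are determined by conjugation, and the only constraint left is
that diagonal entries are fixed by σ. -/
theorem mem_range_entriesH (R : IsRamified F σ π) {e : K → ℕ} (he : Function.Injective e)
    {y : OrdPair e → E} (hy : ∀ k, σ (y ⟨(k, k), le_rfl⟩) = y ⟨(k, k), le_rfl⟩) :
    y ∈ (entriesH σ u e).range := by
  classical
  let Y : K → K → E := fun k l =>
    if hkl : e k ≤ e l then y ⟨(k, l), hkl⟩ else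
      σ (y ⟨(l, k), (Nat.lt_of_not_le hkl).le⟩)
  have hY : ∀ k l, Y l k = σ (Y k l) := by
    intro k l
    rcases lt_trichotomy (e k) (e l) with h1 | h1 | h1
    · simp only [Y, h1.le, dif_pos, not_le.2 h1, dif_neg, not_false_eq_true]
    · obtain rfl := he h1
      simp only [Y, le_refl, dif_pos, hy]
    · simp only [Y, h1.le, dif_pos, not_le.2 h1, dif_neg, not_false_eq_true, R.invol]
  let g : hermForms σ V := ⟨fun v w => ∑ k, ∑ l, σ (u.repr v k) * Y k l * u.repr w l, by
    refine ⟨fun v w w' => ?_, fun a v w => ?_, fun v w => ?_⟩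
    · simp only [map_add, Finsupp.add_apply, mul_add, Finset.sum_add_distrib]
    · simp only [map_smul, Finsupp.smul_apply, smul_eq_mul, Finset.mul_sum]
      exact Finset.sum_congr rfl fun k _ => Finset.sum_congr rfl fun l _ => by ring
    · simp only [map_sum, map_mul, R.invol]
      rw [Finset.sum_comm]
      exact Finset.sum_congr rfl fun k _ => Finset.sum_congr rfl fun l _ => by
        rw [hY k l]; ring⟩
  refine ⟨g, funext fun ⟨(k, l), hkl⟩ => ?_⟩
  change ∑ a, ∑ b, σ (u.repr (u k) a) * Y a b * u.repr (u l) b = _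
  rw [Finset.sum_eq_single k, Finset.sum_eq_single l]
  · simp only [Basis.repr_self, Finsupp.single_eq_same, map_one, one_mul, mul_one, Y, dif_pos hkl]
  · intro b _ hb
    rw [u.repr_self, u.repr_self, Finsupp.single_eq_of_ne hb, mul_zero]
  · simp
  · intro a _ ha
    refine Finset.sum_eq_zero fun b _ => ?_
    rw [u.repr_self, Finsupp.single_eq_of_ne ha, map_zero, zero_mul, zero_mul]
  · simp

open Classical in
/-- The unipotent change of coordinates that makes the congruences defining `H(A)` diagonal. -/
def shearH (σ : E ≃ₐ[F] E) (π : E) (d : K → ℤ) (T : Finset K) (ρ : ℤ → Option K) (e : K → ℕ) :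
    (OrdPair e → E) →+ (OrdPair e → E) where
  toFun y p :=
    if p.1.1 ≠ p.1.2 ∧ ρ (d p.1.1) = some p.1.2 then
      ∑ t ∈ (near d T (d p.1.1)).erase p.1.2,
        π ^ (max (d p.1.1) (d p.1.2) - max (d p.1.1) (d t)) *
          (if ht : e p.1.1 ≤ e t then y ⟨(p.1.1, t), ht⟩ else
            σ (y ⟨(t, p.1.1), (Nat.lt_of_not_le ht).le⟩))
    else 0
  map_zero' := by
    funext p
    simp
  map_add' y z := by
    funext p
    simp only [Pi.add_apply]
    split_ifs with h1
    · rw [← Finset.sum_add_distrib]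
      refine Finset.sum_congr rfl fun t _ => ?_
      split_ifs
      · rw [mul_add]
      · rw [map_add, mul_add]
    · rw [add_zero]

theorem shearH_entriesH {e : K → ℕ} (g : hermForms σ V) (p : OrdPair e) :
    shearH σ π d T ρ e (entriesH σ u e g) p = by
      classical exact if p.1.1 ≠ p.1.2 ∧ ρ (d p.1.1) = some p.1.2 then
      ∑ t ∈ (near d T (d p.1.1)).erase p.1.2,
        π ^ (max (d p.1.1) (d p.1.2) - max (d p.1.1) (d t)) * g (u p.1.1) (u t) else 0 := by
  simp only [shearH, AddMonoidHom.coe_mk, ZeroHom.coe_mk, entriesH]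
  split_ifs with h1
  · refine Finset.sum_congr rfl fun t _ => ?_
    split_ifs
    · rfl
    · rw [← herm_symm]
  · rfl

/-- The lattice of hermitian forms that are integral on `L`. -/
def latH (σ : E ≃ₐ[F] E) (L : Submodule (intRingExt F E) V) : AddSubgroup (hermForms σ V) where
  carrier := naiveH σ L
  zero_mem' _ _ _ _ := zero_mem (intRingExt F E)
  add_mem' hX hY v hv w hw := add_mem (hX v hv w hw) (hY v hv w hw)
  neg_mem' hX v hv w hw := neg_mem (hX v hv w hw)

variable (f : IsFrame h π L d x u T) (R : IsRamified F σ π) (P : IsPivot d T ρ)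
include f R

theorem mem_naiveH_iff {e : K → ℕ} {g : hermForms σ V} :
    g ∈ naiveH σ L ↔ ∀ p, entriesH σ u e g p ∈ entryGroup F σ π p.1 0 0 := by
  classical
  have hu : ∀ k, u k ∈ L := fun k => by
    rw [f.mem_right, ← one_smul E (u k)]
    exact basis_mem_box isOrd_one.2.1
  constructor
  · rintro hg ⟨⟨k, l⟩, hkl⟩
    have h1 := mem_pideal_zero (π := π).2 (hg _ (hu k) _ (hu l))
    unfold entryGroup
    split_ifs with h2
    · simp only at h2
      subst h2
      exact ⟨h1, mem_fixedPts.2 (herm_self_fixed g _)⟩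
    · exact h1
  · intro hg v hv w hw
    have hle : ∀ k l, e k ≤ e l → g (u k) (u l) ∈ pideal F π 0 := by
      intro k l hkl
      have := hg ⟨(k, l), hkl⟩
      unfold entryGroup at this
      split_ifs at this with h2
      · exact this.1
      · exact this
    rw [← mem_pideal_zero (π := π)]
    refine herm_mem_of_box R g ((f.mem_right v).1 hv) ((f.mem_right w).1 hw) fun k l =>
      ⟨0, ?_, by simp⟩
    rcases le_total (e k) (e l) with h1 | h1
    · exact hle k l h1
    · exact (herm_mem_symm R g).1 (hle l k h1)

include P

/-- The congruence `col` of k is stored at the unordered pair consisting of k and its pivot. On the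
diagonal it already follows from `norm`, so an extra exponent arises there only from `diag`, in even
degree. -/
theorem hCond_iff {e : K → ℕ} (he : Function.Injective e)
    (hpar : ∀ k l, Odd (d k) → Even (d l) → e k < e l) {g : hermForms σ V} :
    HCond π d u T g ↔
    (∀ p, entriesH σ u e g p ∈
      entryGroup F σ π p.1 ((d p.1.1 + 1) / 2 + 1) (max (d p.1.1) (d p.1.2))) ∧
    ∀ p, entriesH σ u e g p + shearH σ π d T ρ e (entriesH σ u e g) p ∈
      entryGroup F σ π p.1 ((d p.1.1 + 1) / 2 + 1 + expCondH d ρ p.1.1 p.1.2)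
        (max (d p.1.1) (d p.1.2) + expCondH d ρ p.1.1 p.1.2) := by
  classical
  have hsome : ∀ {t}, t ∈ T → Even (d t) → ρ (d t) = some t := by
    intro t ht hi
    have h1 := f.near_of_even hi ht rfl
    cases h2 : ρ (d t) with
    | none =>
      rw [P.eq_none_iff, h1] at h2
      exact absurd h2 (Finset.singleton_ne_empty t)
    | some s =>
      have := P.mem_near h2
      rw [h1, Finset.mem_singleton] at this
      rw [this]
  have hcol : ∀ {k l}, ρ (d k) = some l →
      (∑ t ∈ near d T (d k), π ^ (-max (d k) (d t)) * g (u k) (u t) ∈ pideal F π 1 ↔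
        g (u k) (u l) + ∑ t ∈ (near d T (d k)).erase l,
          π ^ (max (d k) (d l) - max (d k) (d t)) * g (u k) (u t) ∈
          pideal F π (max (d k) (d l) + 1)) := fun {k l} h1 =>
    sum_zpow_mem_iff R (P.mem_near h1) (fun t => max (d k) (d t)) fun t => g (u k) (u t)
  -- Odd degrees are enumerated before even ones. A pivot that precedes k therefore has the same
  -- degree as k, is the only near leader, and leaves no further terms; the shear is needed only
  -- when k comes first.
  have hlt : ∀ {k l}, k ≠ l → ρ (d k) = some l → e l < e k → near d T (d k) = {l} := by
    intro k l hkl h1 h2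
    refine P.near_eq h1 ?_
    rcases (mem_near.1 (P.mem_near h1)).2 with h3 | ⟨ho, h3⟩
    · exact h3
    · have hev : Even (d l) := by
        rcases h3 with h3 | h3 <;> rw [h3]
        · exact ho.sub_odd odd_one
        · exact ho.add_odd odd_one
      exact absurd (hpar k l ho hev) (by omega)
  have hdiag : ∀ k i j, entriesH σ u e g ⟨(k, k), le_rfl⟩ ∈ entryGroup F σ π (k, k) i j ↔
      g (u k) (u k) ∈ pideal F π (2 * i) := by
    intro k i j
    rw [entryGroup, if_pos rfl, AddSubgroup.mem_inf, mem_fixedPts]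
    exact and_iff_left (herm_self_fixed g _)
  have hoff : ∀ {k l}, k ≠ l → ∀ (hkl : e k ≤ e l) (b : E) i j,
      entriesH σ u e g ⟨(k, l), hkl⟩ + b ∈ entryGroup F σ π (k, l) i j ↔
      g (u k) (u l) + b ∈ pideal F π j := by
    intro k l hne hkl b i j
    rw [entryGroup, if_neg hne]
    rfl
  constructor
  · intro C
    have hent : ∀ p : OrdPair e, entriesH σ u e g p ∈
      entryGroup F σ π p.1 ((d p.1.1 + 1) / 2 + 1) (max (d p.1.1) (d p.1.2)) := by
      rintro ⟨⟨k, l⟩, hkl⟩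
      by_cases h2 : k = l
      · subst h2
        exact (hdiag k _ _).2 (R.anti (by simp only; omega) (C.norm k))
      · rw [← add_zero (entriesH σ u e g _), hoff h2, add_zero]
        exact C.entry k l
    refine ⟨hent, ?_⟩
    rintro ⟨⟨k, l⟩, hkl⟩
    rw [shearH_entriesH]
    by_cases h2 : k = l
    · subst h2
      rw [if_neg (by simp), add_zero, hdiag]
      simp only [expCondH, if_true]
      split_ifs with h3
      · obtain ⟨m, hm⟩ := h3.1
        exact R.anti (by push_cast; omega) (C.diag k (P.mem h3.2) h3.1)
      · exact R.anti (by push_cast; omega) (C.norm k)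
    · rw [hoff h2]
      simp only [expCondH, if_neg h2]
      by_cases h3 : ρ (d k) = some l
      · rw [if_pos (Or.inl h3 : ρ (d k) = some l ∨ ρ (d l) = some k),
          if_pos (And.intro h2 h3 : k ≠ l ∧ ρ (d k) = some l)]
        exact (hcol h3).1 (C.col k)
      · rw [if_neg (fun h => h3 h.2 : ¬(k ≠ l ∧ ρ (d k) = some l)), add_zero]
        by_cases h4 : ρ (d l) = some k
        · rw [if_pos (Or.inr h4), herm_mem_symm R]
          have hlt' : e k < e l := lt_of_le_of_ne hkl fun h => h2 (he h)
          have h5 := (hcol h4).1 (C.col l)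
          rw [hlt (Ne.symm h2) h4 hlt', Finset.erase_singleton, Finset.sum_empty, add_zero,
            max_comm] at h5
          exact h5
        · rw [if_neg (by tauto), Nat.cast_zero, add_zero]
          exact C.entry k l
  · rintro ⟨hent, hp⟩
    have hle : ∀ k l, e k ≤ e l → g (u k) (u l) ∈ pideal F π (max (d k) (d l)) := by
      intro k l hkl
      by_cases h2 : k = l
      · subst h2
        have := (hdiag k _ _).1 (hent ⟨(k, k), le_rfl⟩)
        exact R.anti (by simp only; omega) this
      · have := hent ⟨(k, l), hkl⟩
        rwa [← add_zero (entriesH σ u e g _), hoff h2, add_zero] at this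
    have hnorm : ∀ k, g (u k) (u k) ∈ pideal F π (2 * ((d k + 1) / 2) + 2) := fun k =>
      R.anti (by simp only; omega) ((hdiag k _ _).1 (hent ⟨(k, k), le_rfl⟩))
    have hdg : ∀ t ∈ T, Even (d t) → g (u t) (u t) ∈ pideal F π (d t + 4) := by
      intro t ht hi
      have h1 := hp ⟨(t, t), le_rfl⟩
      rw [shearH_entriesH, if_neg (by simp), add_zero, hdiag] at h1
      simp only [expCondH, if_true, if_pos (And.intro hi (hsome ht hi))] at h1
      obtain ⟨m, hm⟩ := hi
      exact R.anti (by push_cast; omega) h1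
    refine ⟨fun k l => ?_, hnorm, fun k => ?_, hdg⟩
    · rcases le_total (e k) (e l) with h1 | h1
      · exact hle k l h1
      · rw [herm_mem_symm R, max_comm]
        exact hle l k h1
    · cases h1 : ρ (d k) with
      | none =>
        rw [(P.eq_none_iff _).1 h1]
        simp [zero_mem]
      | some l =>
        rw [hcol h1]
        by_cases h2 : k = l
        · subst h2
          rw [P.near_eq h1 rfl, Finset.erase_singleton, Finset.sum_empty, add_zero]
          -- The bound on the norm exceeds the exponent d k + 1 required by the congruence.
          exact R.anti (by omega) (hnorm k)
        · rcases le_or_gt (e k) (e l) with h3 | h3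
          · have h4 := hp ⟨(k, l), h3⟩
            rw [shearH_entriesH, hoff h2] at h4
            simp only [expCondH, if_neg h2, if_pos (Or.inl h1 : ρ (d k) = some l ∨ ρ (d l) = some k)]
              at h4
            rw [if_pos ⟨h2, h1⟩] at h4
            exact h4
          · have h4 := hp ⟨(l, k), h3.le⟩
            have h5 : ρ (d l) ≠ some k := fun h5 => h2 (P.eq_of_eq f h1 h5)
            rw [shearH_entriesH, hoff (Ne.symm h2), if_neg (fun h => h5 h.2), add_zero] at h4
            simp only [expCondH, if_neg (Ne.symm h2),
              if_pos (Or.inr h1 : ρ (d l) = some k ∨ ρ (d k) = some l)] at h4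
            rw [hlt h2 h1 h3, Finset.erase_singleton, Finset.sum_empty, add_zero, herm_mem_symm R,
              max_comm]
            exact h4

/-- The lattice `H(A) - h` and its index in `H'`. -/
theorem exists_lattice_modelH (hd : ∀ k, 0 ≤ d k) {e : K → ℕ} (he : Function.Injective e)
    (hpar : ∀ k l, Odd (d k) → Even (d l) → e k < e l) :
    ∃ S : AddSubgroup (hermForms σ V),
    (∀ g, g ∈ S ↔ HCond π d u T g) ∧ S ≤ latH σ L ∧
    S.relIndex (latH σ L) = (2 ^ finrank ℚ_[2] F) ^
      (∑ p : OrdPair e, (by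
        classical exact if p.1.1 = p.1.2 then ((d p.1.1 + 1) / 2 + 1).toNat
          else (max (d p.1.1) (d p.1.2)).toNat) + ∑ p : OrdPair e, expCondH d ρ p.1.1 p.1.2) := by
  classical
  let G0 : OrdPair e → AddSubgroup E := fun p => entryGroup F σ π p.1 0 0
  let G : OrdPair e → AddSubgroup E := fun p =>
    entryGroup F σ π p.1 ((d p.1.1 + 1) / 2 + 1) (max (d p.1.1) (d p.1.2))
  let G' : OrdPair e → AddSubgroup E := fun p =>
    entryGroup F σ π p.1 ((d p.1.1 + 1) / 2 + 1 + expCondH d ρ p.1.1 p.1.2)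
        (max (d p.1.1) (d p.1.2) + expCondH d ρ p.1.1 p.1.2)
  let S' : AddSubgroup (OrdPair e → E) :=
    (AddSubgroup.pi Set.univ G').comap (AddMonoidHom.id _ + shearH σ π d T ρ e)
  have hH : latH σ L = (AddSubgroup.pi Set.univ G0).comap (entriesH σ u e) := by
    ext g
    rw [AddSubgroup.mem_comap, AddSubgroup.mem_pi]
    simp only [Set.mem_univ, forall_true_left]
    exact mem_naiveH_iff f R
  have hGG : ∀ p, G p ≤ G0 p := fun p => entryGroup_mono R (by have := hd p.1.1; omega)
    (by have := hd p.1.1; omega)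
  have hG0 : AddSubgroup.pi Set.univ G ≤ AddSubgroup.pi Set.univ G0 :=
    fun y hy p hp => hGG p (hy p hp)
  have h1 : (AddSubgroup.pi Set.univ G).relIndex (AddSubgroup.pi Set.univ G0) =
      (2 ^ finrank ℚ_[2] F) ^ (∑ p : OrdPair e, if p.1.1 = p.1.2 then ((d p.1.1 + 1) / 2 + 1).toNat
          else (max (d p.1.1) (d p.1.2)).toNat) := by
    rw [relIndex_pi_univ, ← Finset.prod_pow_eq_pow_sum]
    refine Finset.prod_congr rfl fun p _ => ?_
    have hp := hd p.1.1
    simp only [G, G0, entryGroup]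
    split_ifs with h2
    · rw [← relIndex_pideal_inf_fixedPts R 0, zero_add, Int.toNat_of_nonneg (by omega)]
    · rw [← relIndex_pideal R 0, zero_add, Int.toNat_of_nonneg (by omega)]
  have hfull : ∀ {y : OrdPair e → E}, (∀ p, y p ∈ G p) → ∀ k t,
      (if ht : e k ≤ e t then y ⟨(k, t), ht⟩ else σ (y ⟨(t, k), (Nat.lt_of_not_le ht).le⟩)) ∈
        pideal F π (max (d k) (d t)) := by
    intro y hy k t
    have hle : ∀ k l (hkl : e k ≤ e l), y ⟨(k, l), hkl⟩ ∈ pideal F π (max (d k) (d l)) := by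
      intro k l hkl
      have h2 := hy ⟨(k, l), hkl⟩
      simp only [G, entryGroup] at h2
      split_ifs at h2 with h3
      · subst h3
        exact R.anti (by omega) h2.1
      · exact h2
    split_ifs with ht
    · exact hle k t ht
    · rw [max_comm]
      exact R.map_mem (hle t k _)
  have h2 : S'.relIndex (AddSubgroup.pi Set.univ G) =
      (2 ^ finrank ℚ_[2] F) ^ (∑ p : OrdPair e, expCondH d ρ p.1.1 p.1.2) := by
    rw [← Finset.prod_pow_eq_pow_sum]
    -- All sheared entries have rank 1, and the terms added to them sit at entries of rank 0.
    refine (relIndex_unipotent G' G (shearH σ π d T ρ e) (fun p => expCondH d ρ p.1.1 p.1.2)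
      ?_ ?_).trans (Finset.prod_congr rfl fun p _ => relIndex_entryGroup R _ _ _ _)
    · rintro y hy ⟨⟨k, l⟩, hkl⟩
      simp only [shearH, AddMonoidHom.coe_mk, ZeroHom.coe_mk]
      split_ifs with h3
      · simp only [G, entryGroup, if_neg h3.1]
        refine AddSubgroup.sum_mem _ fun t _ =>
          mul_mem_of_le R (zpow_mem_pideal π _) (hfull hy k t) (by omega)
      · exact zero_mem _
    · rintro y ⟨⟨k, l⟩, hkl⟩ hs
      simp only [shearH, AddMonoidHom.coe_mk, ZeroHom.coe_mk]
      split_ifs with h3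
      · simp only [expCondH, if_neg h3.1,
          if_pos (Or.inl h3.2 : ρ (d k) = some l ∨ ρ (d l) = some k)] at hs
        refine Finset.sum_eq_zero fun t ht => ?_
        obtain ⟨htl, ht⟩ := Finset.mem_erase.1 ht
        have h4 : ρ (d l) ≠ some k := fun h4 => h3.1 (P.eq_of_eq f h3.2 h4)
        have h5 := P.ne_of_mem_near f h3.2 h4 ht htl
        have h6 : (some l : Option K) ≠ some t := fun e => htl (Option.some.inj e).symm
        have h7 : (some l : Option K) ≠ some k := fun e => h3.1 (Option.some.inj e).symm
        by_cases htk : k = t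
        · subst htk
          rw [dif_pos le_rfl, hs ⟨(k, k), le_rfl⟩ (by simp [h3.2, h7]), mul_zero]
        · split_ifs with h8
          · rw [hs ⟨(k, t), h8⟩ (by simp [h3.2, h5, h6, htk]), mul_zero]
          · rw [hs ⟨(t, k), (Nat.lt_of_not_le h8).le⟩ (by simp [h3.2, h5, h6, Ne.symm htk]),
              map_zero, mul_zero]
      · rfl
  -- The map to entries is not surjective, but its image contains the integral tuples with fixed
  -- diagonal, which is what the index computation needs.
  have hrange : AddSubgroup.pi Set.univ G0 ≤ (entriesH σ u e).range := by
    intro y hy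
    refine mem_range_entriesH R he fun k => ?_
    have h3 := hy ⟨(k, k), le_rfl⟩ (Set.mem_univ _)
    simp only [G0, entryGroup, if_true] at h3
    exact mem_fixedPts.1 h3.2
  refine ⟨(S' ⊓ AddSubgroup.pi Set.univ G).comap (entriesH σ u e), fun g => ?_, ?_, ?_⟩
  · rw [hCond_iff f R P he hpar, AddSubgroup.mem_comap, AddSubgroup.mem_inf, and_comm]
    simp only [S', AddSubgroup.mem_comap, AddSubgroup.mem_pi, Set.mem_univ, forall_true_left]
    rfl
  · rw [hH]
    exact AddSubgroup.comap_mono (inf_le_right.trans hG0)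
  · rw [hH, AddSubgroup.relIndex_comap, AddSubgroup.map_comap_eq_self hrange,
      ← AddSubgroup.relIndex_mul_relIndex _ _ _ inf_le_right hG0, AddSubgroup.inf_relIndex_right,
      h1, h2, pow_add, mul_comm]

end IndexH

/-! ### Elementary changes of basis. -/

section Generic

theorem basis_ne_smul {O M κ : Type*} [CommRing O] [AddCommGroup M] [Module O M]
    (b : Basis κ O M) (k : κ) {p : O} {y : M} (h : b k = p • y) : IsUnit p := by
  have h1 := congrArg (fun v => b.repr v k) h
  simp only [b.repr_self, Finsupp.single_eq_same, map_smul, Finsupp.smul_apply, smul_eq_mul] at h1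
  exact IsUnit.of_mul_eq_one _ h1.symm

theorem exists_basis_shear {O M κ : Type*} [CommRing O] [AddCommGroup M] [Module O M] [Fintype κ]
    (b : Basis κ O M) (k0 : κ) (s : Oˣ) (r : κ → O) : ∃ b' : Basis κ O M,
      b' k0 = (s : O) • b k0 ∧ ∀ k, k ≠ k0 → b' k = b k - r k • (s : O) • b k0 := by
  classical
  let φ : Module.Dual O M := b.constr ℕ fun k => if k = k0 then 0 else -r k
  have hφb : ∀ k, φ (b k) = if k = k0 then 0 else -r k := fun k => b.constr_basis ℕ _ k
  have hφ : φ ((s : O) • b k0) = 0 := by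
    rw [map_smul, hφb, if_pos rfl, smul_zero]
  refine ⟨(b.unitsSMul fun k => if k = k0 then s else 1).map (LinearEquiv.transvection hφ), ?_, ?_⟩
  · simp only [Basis.map_apply, Basis.unitsSMul_apply, if_true]
    change LinearEquiv.transvection hφ ((s : O) • b k0) = _
    rw [LinearEquiv.transvection.apply, hφ, zero_smul, add_zero]
  · intro k hk
    simp only [Basis.map_apply, Basis.unitsSMul_apply, if_neg hk, one_smul,
      LinearEquiv.transvection.apply, hφb]
    rw [sub_eq_add_neg, neg_smul]

theorem coe_eq_sum {O V κ : Type*} [CommRing O] [AddCommGroup V] [Module O V] [Fintype κ]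
    {M : Submodule O V} (b : Basis κ O M) {v : V} (hv : v ∈ M) :
    ∃ c : κ → O, v = ∑ k, c k • (b k : V) := by
  refine ⟨b.repr ⟨v, hv⟩, ?_⟩
  have := congrArg Subtype.val (b.sum_repr ⟨v, hv⟩)
  rw [AddSubmonoidClass.coe_finsetSum] at this
  exact this.symm

end Generic

/-! ### The valuation ring of E is a discrete valuation ring with fraction field E. -/

section Ring

variable {F E : Type*} [NontriviallyNormedField F] [NormedAlgebra ℚ_[2] F]
  [Field E] [Algebra F E] {σ : E ≃ₐ[F] E} {π : E}

theorem zpow_notMem (R : IsRamified F σ π) {i j : ℤ} (h : i < j) : π ^ i ∉ pideal F π j := by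
  intro h1
  have h2 := mul_mem_of_le R (zpow_mem_pideal π (-i)) h1 (show 1 ≤ -i + j by omega)
  rw [← zpow_add₀ R.ne_zero, neg_add_cancel, zpow_zero] at h2
  exact R.one_notMem h2

theorem exists_isOrd (R : IsRamified F σ π) {x : E} (hx : x ≠ 0) : ∃ n, IsOrd F π x n := by
  obtain ⟨a, ha⟩ := R.exists_mem x
  obtain ⟨b, hb⟩ := R.exists_mem x⁻¹
  obtain ⟨n, hn, hmax⟩ := Int.exists_greatest_of_bdd (P := fun n => x ∈ pideal F π n)
    ⟨b, fun z hz => by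
      by_contra! h1
      have := mul_mem_of_le R hz hb (show 1 ≤ z + -(b : ℤ) by omega)
      rw [mul_inv_cancel₀ hx] at this
      exact R.one_notMem this⟩ ⟨_, ha⟩
  have h1 : IsOrd F π (π ^ (-n) * x) 0 := by
    refine isOrd_of_unit R (mul_mem_of_le R (zpow_mem_pideal π _) hn (by omega)) fun h2 => ?_
    rw [(isOrd_zpow R (-n)).mul_mem_iff R (show 1 = -n + (n + 1) by omega)] at h2
    have := hmax _ h2
    omega
  have h2 := (isOrd_zpow R n).mul R h1
  rw [← mul_assoc, ← zpow_add₀ R.ne_zero, add_neg_cancel, zpow_zero, one_mul, add_zero] at h2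
  exact ⟨n, h2⟩

/-- `O` is the valuation ring of `E`. -/
structure IsIntegers (F : Type*) {E : Type*} [NontriviallyNormedField F] [NormedAlgebra ℚ_[2] F]
    [Field E] [Algebra F E] (π : E) (O : Type*) [CommRing O] [Algebra O E] : Prop where
  inj : Function.Injective (algebraMap O E)
  exists_eq : ∀ {a : E}, a ∈ pideal F π 0 → ∃ c : O, algebraMap O E c = a
  mem : ∀ c : O, algebraMap O E c ∈ pideal F π 0

variable {O : Type*} [CommRing O] [Algebra O E] (I : IsIntegers F π O) (R : IsRamified F σ π)
include I R

theorem isUnit_iff_isOrd {x : O} : IsUnit x ↔ IsOrd F π (algebraMap O E x) 0 := by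
  constructor
  · rintro ⟨w, rfl⟩
    have h1 : algebraMap O E (w⁻¹ : Oˣ) * algebraMap O E w = 1 := by
      rw [← map_mul, ← Units.val_mul, inv_mul_cancel, Units.val_one, map_one]
    refine ⟨right_ne_zero_of_mul_eq_one h1, I.mem _, ?_⟩
    rw [← eq_inv_of_mul_eq_one_left h1, neg_zero]
    exact I.mem _
  · rintro ⟨h0, -, h1⟩
    rw [neg_zero] at h1
    obtain ⟨y, hy⟩ := I.exists_eq h1
    refine IsUnit.of_mul_eq_one y (I.inj ?_)
    rw [map_mul, hy, mul_inv_cancel₀ h0, map_one]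

theorem isDomain_of_isIntegers : IsDomain O :=
  I.inj.isDomain (algebraMap O E)

/-- Every non-zero element is a unit times a power of the element over π, and that element is
irreducible because a product of two non-units lies in π²B. -/
theorem isPrincipalIdealRing_of_isIntegers : IsPrincipalIdealRing O := by
  have := isDomain_of_isIntegers I R
  have hπ1 : π ∈ pideal F π 1 := by simpa using zpow_mem_pideal (F := F) π 1
  obtain ⟨ϖ, hϖ⟩ := I.exists_eq (R.anti (show (0 : ℤ) ≤ 1 by omega) hπ1)
  have hmem1 : ∀ a : O, ¬IsUnit a → algebraMap O E a ∈ pideal F π 1 := by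
    intro a ha
    by_contra h1
    exact ha ((isUnit_iff_isOrd I R).2 (isOrd_of_unit R (I.mem a) h1))
  have key : IsDiscreteValuationRing.HasUnitMulPowIrreducibleFactorization O := by
    refine ⟨ϖ, ⟨fun h => ?_, fun a b hab => ?_⟩, ?_⟩
    · have h1 := ((isUnit_iff_isOrd I R).1 h).2.2
      rw [hϖ] at h1
      have := mul_mem_of_le R h1 hπ1 (show 1 ≤ -0 + 1 by omega)
      rw [inv_mul_cancel₀ R.ne_zero] at this
      exact R.one_notMem this
    · by_contra! h
      have h3 := mul_mem_of_le R (hmem1 a h.1) (hmem1 b h.2) (show 2 ≤ 1 + 1 by omega)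
      rw [← map_mul, ← hab, hϖ] at h3
      exact zpow_notMem R (show (1 : ℤ) < 2 by omega) (by simpa using h3)
    · intro x hx
      have hx' : algebraMap O E x ≠ 0 := fun h => hx (I.inj (h.trans (map_zero _).symm))
      obtain ⟨n, hn⟩ := exists_isOrd R hx'
      have hn0 : 0 ≤ n := by
        by_contra! h0
        have h1 := mul_mem_of_le R hn.2.2 (I.mem x) (show 1 ≤ -n + 0 by omega)
        rw [inv_mul_cancel₀ hx'] at h1
        exact R.one_notMem h1
      lift n to ℕ using hn0
      have h1 : IsOrd F π (π ^ (-(n : ℤ)) * algebraMap O E x) 0 := by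
        have := (isOrd_zpow R (-(n : ℤ))).mul R hn
        rwa [neg_add_cancel] at this
      obtain ⟨y, hy⟩ := I.exists_eq h1.2.1
      obtain ⟨w, rfl⟩ := (isUnit_iff_isOrd I R (x := y)).2 (by rwa [hy])
      refine ⟨n, w, I.inj ?_⟩
      rw [map_mul, map_pow, hϖ, hy, zpow_neg, zpow_natCast,
        mul_inv_cancel_left₀ (pow_ne_zero _ R.ne_zero)]
  exact (IsDiscreteValuationRing.ofHasUnitMulPowIrreducibleFactorization key).toIsPrincipalIdealRing

theorem isFractionRing_of_isIntegers : IsFractionRing O E := by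
  have : FaithfulSMul O E := (faithfulSMul_iff_algebraMap_injective O E).2 I.inj
  refine IsFractionRing.of_field _ _ fun z => ?_
  obtain ⟨n, hn⟩ := R.exists_mem z
  obtain ⟨y, hy⟩ := I.exists_eq (mul_mem_of_le R (zpow_mem_pideal π (n : ℤ)) hn (show 0 ≤ _ by omega))
  obtain ⟨ϖ, hϖ⟩ := I.exists_eq (zpow_mem_pideal (F := F) π (n : ℤ) |> R.anti (show 0 ≤ (n : ℤ) by omega))
  refine ⟨y, ϖ, ?_⟩
  rw [hy, hϖ, mul_div_cancel_left₀ _ (zpow_ne_zero _ R.ne_zero)]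

end Ring

/-! ### Diagonalizing the norm on one Jordan component. -/

section Component

variable {F E : Type*} [NontriviallyNormedField F] [NormedAlgebra ℚ_[2] F]
  [Field E] [Algebra F E] {σ : E ≃ₐ[F] E} {π : E}
  {V : Type*} [AddCommGroup V] [Module E V]
  {h : hermForms σ V} {i : ℤ}

section

variable {M : Submodule (intRingExt F E) V}

theorem IsModular.herm_mem (R : IsRamified F σ π) (hM : IsModular π h M i) {v w : V} (hv : v ∈ M)
    (hw : w ∈ M) (hv' : ¬ ∃ y ∈ M, v = π • y) : h v w ∈ pideal F π i := by
  have h1 : h v w ∈ Submodule.span (intRingExt F E) {a : E | ∃ y ∈ M, a = h v y} :=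
    Submodule.subset_span ⟨w, hw, rfl⟩
  rw [hM v hv hv', Submodule.mem_span_singleton] at h1
  obtain ⟨c, hc⟩ := h1
  rw [← hc]
  exact mul_mem_of_le R (mem_pideal_zero.2 c.2) (zpow_mem_pideal π i) (by omega)

/-- Otherwise modularity would make π^i a combination of values h(v, w), all of which lie in
π^(i+1)B. -/
theorem IsModular.exists_eq_smul (R : IsRamified F σ π) (hM : IsModular π h M i) {v : V}
    (hv : v ∈ M) (hv' : ∀ w ∈ M, h v w ∈ pideal F π (i + 1)) : ∃ y ∈ M, v = π • y := by
  by_contra h1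
  have h2 : π ^ i ∈ Submodule.span (intRingExt F E) {a : E | ∃ y ∈ M, a = h v y} := by
    rw [hM v hv h1]
    exact Submodule.mem_span_singleton_self _
  refine zpow_notMem R (show i < i + 1 by omega) (Submodule.span_induction (p := fun a _ =>
    a ∈ pideal F π (i + 1)) ?_ (zero_mem _) (fun _ _ _ _ h1 h2 => add_mem h1 h2) ?_ h2)
  · rintro _ ⟨y, hy, rfl⟩
    exact hv' y hy
  · intro c y _ hy
    exact mul_mem_of_le R (mem_pideal_zero.2 c.2) hy (by omega)

end

/-- The consequences of modularity that are used below. -/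
structure ModularLike (F : Type*) {E : Type*} [NontriviallyNormedField F] [NormedAlgebra ℚ_[2] F]
    [Field E] [Algebra F E] {σ : E ≃ₐ[F] E} (π : E) {V : Type*} [AddCommGroup V] [Module E V]
    (h : hermForms σ V) (M : Set V) (i : ℤ) : Prop where
  herm_mem : ∀ {v w}, v ∈ M → w ∈ M → (¬ ∃ y ∈ M, v = π • y) → h v w ∈ pideal F π i
  exists_eq_smul : ∀ {v}, v ∈ M → (∀ w ∈ M, h v w ∈ pideal F π (i + 1)) → ∃ y ∈ M, v = π • y

variable {O : Type*} [CommRing O] [Algebra O E] [Module O V] [IsScalarTower O E V]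
  {M : Submodule O V} {κ : Type*} [Fintype κ] (I : IsIntegers F π O) (R : IsRamified F σ π)
include I R

theorem coe_basis_ne_smul (b : Basis κ O M) (k : κ) : ¬ ∃ y ∈ M, (b k : V) = π • y := by
  rintro ⟨y, hy, h1⟩
  have hπ1 : π ∈ pideal F π 1 := by simpa using zpow_mem_pideal (F := F) π 1
  obtain ⟨ϖ, hϖ⟩ := I.exists_eq (R.anti (show (0 : ℤ) ≤ 1 by omega) hπ1)
  have h2 := ((isUnit_iff_isOrd I R).1 (basis_ne_smul b k (p := ϖ)
    (y := ⟨y, hy⟩) (Subtype.ext (by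
      rw [h1, ← hϖ, algebraMap_smul]
      rfl)))).2.2
  rw [hϖ] at h2
  have := mul_mem_of_le R h2 hπ1 (show 1 ≤ _ by omega)
  rw [inv_mul_cancel₀ R.ne_zero] at this
  exact R.one_notMem this

theorem ModularLike.herm_mem_of_basis (hM : ModularLike F π h (M : Set V) i) (b : Basis κ O M)
    {v w : V} (hv : v ∈ M) (hw : w ∈ M) : h v w ∈ pideal F π i := by
  obtain ⟨a, rfl⟩ := coe_eq_sum b hv
  rw [herm_sum_left]
  refine AddSubgroup.sum_mem _ fun k _ => ?_
  rw [← algebraMap_smul E (a k), herm_smul_left]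
  exact mul_mem_of_le R (R.map_mem (I.mem (a k)))
    (hM.herm_mem (b k).2 hw (coe_basis_ne_smul I R b k)) (by omega)

/-- A modular lattice has a basis in which at most one vector has a norm that generates the
largest possible ideal. -/
theorem ModularLike.exists_basis (hM : ModularLike F π h (M : Set V) i) (b : Basis κ O M) :
    ∃ (b' : Basis κ O M) (T : Set κ), T.Subsingleton ∧
      (∀ k ∈ T, h (b' k) (b' k) - π ^ (2 * ((i + 1) / 2)) ∈ pideal F π (2 * ((i + 1) / 2) + 1)) ∧
      ∀ k ∉ T, h (b' k) (b' k) ∈ pideal F π (2 * ((i + 1) / 2) + 1) := by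
  classical
  have hmem : ∀ {v w : V}, v ∈ M → w ∈ M → h v w ∈ pideal F π i := fun hv hw =>
    hM.herm_mem_of_basis I R b hv hw
  set c := (i + 1) / 2 with hc
  by_cases h1 : ∀ k, h (b k) (b k) ∈ pideal F π (2 * c + 1)
  · exact ⟨b, ∅, Set.subsingleton_empty, by simp, fun k _ => h1 k⟩
  push Not at h1
  obtain ⟨k0, hk0⟩ := h1
  have hn : ∀ {v : V}, v ∈ M → h v v ∈ pideal F π (2 * c) := fun hv =>
    herm_self_mem R h (R.anti (by omega) (hmem hv hv))
  have hn' : ∀ {v : V}, v ∈ M → π ^ (-(2 * c)) * h v v ∈ pideal F π 0 := fun hv =>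
    mul_mem_of_le R (zpow_mem_pideal π _) (hn hv) (by omega)
  have hunit : IsOrd F π (π ^ (-(2 * c)) * h (b k0) (b k0)) 0 := by
    refine isOrd_of_unit R (hn' (b k0).2) fun h2 => hk0 ?_
    rwa [(isOrd_zpow R _).mul_mem_iff R (show 1 = -(2 * c) + (2 * c + 1) by omega)] at h2
  have hinv := hunit.2.2
  rw [neg_zero] at hinv
  -- Scaling by an approximate square root of the inverse normalizes the leader: σ(s)s ≡ s² modulo
  -- π, so the norm of s·b_(k0) becomes congruent to π^(2c).
  obtain ⟨s, hs, hs2⟩ := R.exists_sqrt hinv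
  have hs1 : s ∉ pideal F π 1 := by
    intro h2
    have h3 := add_mem hs2 (R.anti (show (1 : ℤ) ≤ 2 by omega) (mul_mem_of_le R h2 h2 (by omega)))
    rw [sq, sub_add_cancel] at h3
    have := mul_mem_of_le R h3 hunit.2.1 (show 1 ≤ _ by omega)
    rw [inv_mul_cancel₀ hunit.1] at this
    exact R.one_notMem this
  obtain ⟨s', hs''⟩ := I.exists_eq hs
  obtain ⟨s', rfl⟩ := (isUnit_iff_isOrd I R (x := s')).2 (by rw [hs'']; exact isOrd_of_unit R hs hs1)
  let y0 : V := s • (b k0 : V)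
  have hy0 : y0 = s • (b k0 : V) := rfl
  have hy0M : y0 ∈ M := by
    rw [hy0, ← hs'', algebraMap_smul]
    exact M.smul_mem _ (b k0).2
  have hy0n : h y0 y0 - π ^ (2 * c) ∈ pideal F π (2 * c + 1) := by
    rw [hy0, herm_smul_left, herm_smul_right]
    have e : σ s * (s * h (b k0) (b k0)) - π ^ (2 * c) = (σ s - s) * (s * h (b k0) (b k0)) -
        h (b k0) (b k0) * ((π ^ (-(2 * c)) * h (b k0) (b k0))⁻¹ - s ^ 2) := by
      have h2 := hunit.1
      have h3 : h (b k0) (b k0) ≠ 0 := right_ne_zero_of_mul h2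
      have h4 : π ^ (2 * c) ≠ 0 := zpow_ne_zero _ R.ne_zero
      rw [zpow_neg]
      field_simp
      ring
    rw [e]
    exact sub_mem (mul_mem_of_le R (R.map_sub_mem hs) (mul_mem_of_le R hs (hn (b k0).2) le_rfl)
      (by omega)) (mul_mem_of_le R (hn (b k0).2) hs2 (by omega))
  -- Subtracting r_k times the leader changes the norm of b_k by r_k² π^(2c) to first order; with
  -- r_k² equal to the normalized norm the two contributions add up to a multiple of 2.
  have hr : ∀ k, ∃ r : O,
      π ^ (-(2 * c)) * h (b k) (b k) - algebraMap O E r ^ 2 ∈ pideal F π 1 := fun k => by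
    obtain ⟨r, hr, hr2⟩ := R.exists_sqrt (hn' (b k).2)
    obtain ⟨r, rfl⟩ := I.exists_eq hr
    exact ⟨r, hr2⟩
  choose r hr using hr
  obtain ⟨b', hb0, hbk⟩ := exists_basis_shear b k0 s' r
  have hb0 : (b' k0 : V) = y0 := by
    rw [hb0, hy0, ← hs'', algebraMap_smul]
    rfl
  have hbk : ∀ k, k ≠ k0 → (b' k : V) = b k - algebraMap O E (r k) • y0 := by
    intro k hk
    rw [hbk k hk, hy0, ← hs'', algebraMap_smul, algebraMap_smul]
    rfl
  refine ⟨b', {k0}, Set.subsingleton_singleton, ?_, fun k hk => ?_⟩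
  · rintro k rfl
    rw [hb0]
    exact hy0n
  · have hr0 := I.mem (r k)
    rw [hbk k hk, sub_eq_add_neg, ← neg_smul]
    -- The cross term is a trace and therefore too divisible to matter.
    have h2 := herm_add_self_sub_mem R h (v := (b k : V)) (w := (-algebraMap O E (r k)) • y0) (M := c) (by
      rw [herm_smul_right]
      exact mul_mem_of_le R (neg_mem hr0) (hmem (b k).2 hy0M) (by omega))
    have h3 : h (b k) (b k) + h ((-algebraMap O E (r k)) • y0) ((-algebraMap O E (r k)) • y0) ∈
        pideal F π (2 * c + 1) := by
      rw [herm_smul_left, herm_smul_right]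
      have e : h (b k) (b k) + σ (-algebraMap O E (r k)) * (-algebraMap O E (r k) * h y0 y0) =
          π ^ (2 * c) * (π ^ (-(2 * c)) * h (b k) (b k) - algebraMap O E (r k) ^ 2) +
          (σ (algebraMap O E (r k)) - algebraMap O E (r k)) * (algebraMap O E (r k) * h y0 y0) + algebraMap O E (r k) ^ 2 * (h y0 y0 - π ^ (2 * c))
          + 2 * (algebraMap O E (r k) ^ 2 * π ^ (2 * c)) := by
        rw [mul_sub, ← mul_assoc (π ^ (2 * c)), ← zpow_add₀ R.ne_zero, add_neg_cancel, zpow_zero,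
          map_neg]
        ring
      have hr2 : algebraMap O E (r k) ^ 2 ∈ pideal F π 0 := by
        rw [sq]
        exact mul_mem_of_le R hr0 hr0 (by omega)
      rw [e]
      refine add_mem (add_mem (add_mem ?_ ?_) ?_) ?_
      · exact mul_mem_of_le R (zpow_mem_pideal π _) (hr k) le_rfl
      · exact mul_mem_of_le R (R.map_sub_mem hr0) (mul_mem_of_le R hr0 (hn hy0M) le_rfl) (by omega)
      · exact mul_mem_of_le R hr2 hy0n (by omega)
      · exact mul_mem_of_le R (isOrd_two R).2.1 (mul_mem_of_le R hr2 (zpow_mem_pideal π _) le_rfl)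
          (by omega)
    have := add_mem (R.anti (by omega) h2) h3
    rw [sub_sub, sub_add_cancel] at this
    exact this

end Component

/-! ### Adapted bases of the whole lattice and their duals. -/

section Global

variable {F E : Type*} [NontriviallyNormedField F] [NormedAlgebra ℚ_[2] F]
  [Field E] [Algebra F E] {σ : E ≃ₐ[F] E} {π : E}
  {V : Type*} [AddCommGroup V] [Module E V] {h : hermForms σ V}

theorem linearIndependent_sigma {O V ι : Type*} [CommRing O] [AddCommGroup V] [Module O V]
    {J : ι → Submodule O V} (hJ : iSupIndep J) {κ : ι → Type*} [∀ i, Fintype (κ i)] [Fintype ι]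
    (b : ∀ i, Basis (κ i) O (J i)) :
    LinearIndependent O fun k : Σ i, κ i => (b k.1 k.2 : V) := by
  classical
  rw [Fintype.linearIndependent_iff]
  rintro g hg ⟨i, j⟩
  rw [Fintype.sum_sigma] at hg
  have hmem : ∀ i, ∑ j, g ⟨i, j⟩ • (b i j : V) ∈ J i := fun i =>
    Submodule.sum_mem _ fun j _ => (J i).smul_mem _ (b i j).2
  have h1 : ∑ j, g ⟨i, j⟩ • (b i j : V) = 0 := by
    refine Submodule.disjoint_def.1 (hJ i) _ (hmem i) ?_
    rw [← Finset.add_sum_erase _ _ (Finset.mem_univ i)] at hg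
    rw [eq_neg_of_add_eq_zero_left hg]
    refine Submodule.neg_mem _ (Submodule.sum_mem _ fun l hl => ?_)
    exact Submodule.mem_iSup_of_mem l (Submodule.mem_iSup_of_mem (Finset.ne_of_mem_erase hl) (hmem l))
  have h2 : ∑ j, g ⟨i, j⟩ • b i j = 0 := by
    apply Subtype.ext
    rw [AddSubmonoidClass.coe_finsetSum]
    exact h1
  exact Fintype.linearIndependent_iff.1 (b i).linearIndependent _ h2 j

theorem span_sigma {O V ι : Type*} [CommRing O] [AddCommGroup V] [Module O V]
    {J : ι → Submodule O V} {κ : ι → Type*} (b : ∀ i, Basis (κ i) O (J i)) :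
    Submodule.span O (Set.range fun k : Σ i, κ i => (b k.1 k.2 : V)) = ⨆ i, J i := by
  rw [Set.range_sigma_eq_iUnion_range, Submodule.span_iUnion]
  refine iSup_congr fun i => ?_
  have h1 := congrArg (Submodule.map (J i).subtype) (b i).span_eq
  rw [Submodule.map_span, ← Set.range_comp, Submodule.map_top, Submodule.range_subtype] at h1
  exact h1

/-- A nondegenerate hermitian form admits dual bases. -/
theorem exists_dual_basis [FiniteDimensional E V] {K : Type*} [Fintype K] (x : Basis K E V)
    (hnondeg : ∀ v, (∀ w, h v w = 0) → v = 0) (c : K → E) (hc : ∀ k, c k ≠ 0) :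
    ∃ u : Basis K E V, (∀ k, h (u k) (x k) = c k) ∧ ∀ k l, k ≠ l → h (u k) (x l) = 0 := by
  classical
  let Φ : V →ₗ[E] (K → E) :=
    { toFun := fun w l => h (x l) w
      map_add' := fun v w => funext fun l => herm_add_right h _ _ _
      map_smul' := fun a w => funext fun l => herm_smul_right h _ _ _ }
  have hinj : Function.Injective Φ := by
    rw [← LinearMap.ker_eq_bot, LinearMap.ker_eq_bot']
    intro w hw
    refine hnondeg w fun v => ?_
    rw [← x.sum_repr v, herm_sum_right]
    refine Finset.sum_eq_zero fun l _ => ?_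
    have h1 : h (x l) w = 0 := congrFun hw l
    rw [herm_smul_right, herm_symm h (x l) w, h1, map_zero, mul_zero]
  have hdim : finrank E V = finrank E (K → E) := by
    rw [finrank_eq_card_basis x, finrank_fintype_fun_eq_card]
  let Ψ : V ≃ₗ[E] (K → E) := LinearEquiv.ofBijective Φ
    ⟨hinj, (LinearMap.injective_iff_surjective_of_finrank_eq_finrank hdim).1 hinj⟩
  let w : K → Eˣ := fun k => Units.mk0 (σ.symm (c k)) ((map_ne_zero σ.symm).2 (hc k))
  let u : Basis K E V := ((Pi.basisFun E K).unitsSMul w).map Ψ.symm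
  have hu : ∀ k l, h (x l) (u k) = (σ.symm (c k)) • (Pi.single k (1 : E) : K → E) l := by
    intro k l
    have h1 : Ψ (u k) = (σ.symm (c k)) • (Pi.single k (1 : E) : K → E) := by
      simp only [u, Basis.map_apply, LinearEquiv.apply_symm_apply, Basis.unitsSMul_apply,
        Pi.basisFun_apply]
      rfl
    exact congrFun h1 l
  refine ⟨u, fun k => ?_, fun k l hkl => ?_⟩
  · rw [herm_symm, hu, Pi.single_eq_same, smul_eq_mul, mul_one, AlgEquiv.apply_symm_apply]
  · rw [herm_symm, hu, Pi.single_eq_of_ne hkl.symm, smul_zero, map_zero]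

variable {O : Type*} [CommRing O] [Algebra O E] [Module O V] [IsScalarTower O E V]
  {K : Type*} [Fintype K] (I : IsIntegers F π O) (R : IsRamified F σ π)
include I R

theorem mem_span_iff_mem_box (x : Basis K E V) {v : V} :
    v ∈ Submodule.span O (Set.range x) ↔ v ∈ box F π x 0 := by
  classical
  constructor
  · intro hv
    refine Submodule.span_induction ?_ (zero_mem _) (fun _ _ _ _ => add_mem) ?_ hv
    · rintro _ ⟨k, rfl⟩
      rw [← one_smul E (x k)]
      exact basis_mem_box isOrd_one.2.1
    · intro a w _ hw
      rw [← algebraMap_smul E a]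
      exact smul_mem_box_zero R (I.mem a) hw
  · intro hv
    rw [← x.sum_repr v]
    refine Submodule.sum_mem _ fun k _ => ?_
    obtain ⟨a, ha⟩ := I.exists_eq (hv k)
    rw [← ha, algebraMap_smul]
    exact Submodule.smul_mem _ _ (Submodule.subset_span ⟨k, rfl⟩)

/-- The criterion, by pairing with the vectors `x k`, for a vector to lie in a lattice with a
Jordan splitting. -/
theorem mem_box_zero_of_herm_mem {J : ℤ → Submodule O V} {d : K → ℤ} {x : Basis K E V}
    (hmod : ∀ i, ModularLike F π h (J i : Set V) i)
    (horth : ∀ i j, i ≠ j → ∀ v ∈ J i, ∀ w ∈ J j, h v w = 0) (hx : ∀ k, x k ∈ J (d k))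
    (hJ : ∀ i, ∀ v ∈ J i, v ∈ box F π x 0) {v : V}
    (hv : ∀ i, ∀ w ∈ J i, h v w ∈ pideal F π i) : v ∈ box F π x 0 := by
  classical
  -- A pole of the coordinates is lowered by one: the degree `d k` part w of π^(n+1) v lies in the
  -- component and, by orthogonality, pairs with it into π^(d k + 1)B. Modularity then makes w
  -- divisible by π.
  have step : ∀ n : ℕ, v ∈ box F π x (fun _ => -(n + 1 : ℤ)) → v ∈ box F π x (fun _ => -(n : ℤ)) := by
    intro n hn k
    let w : V := ∑ l with d l = d k, (π ^ (n + 1 : ℤ) * x.repr v l) • x l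
    have hw : w ∈ J (d k) := by
      refine Submodule.sum_mem _ fun l hl => ?_
      obtain ⟨a, ha⟩ := I.exists_eq (mul_mem_of_le R (zpow_mem_pideal π (n + 1 : ℤ)) (hn l)
        (show 0 ≤ (n + 1 : ℤ) + -(n + 1 : ℤ) by omega))
      rw [← ha, algebraMap_smul, ← (Finset.mem_filter.1 hl).2]
      exact Submodule.smul_mem _ _ (hx l)
    have hwv : ∀ y ∈ J (d k), h w y = σ (π ^ (n + 1 : ℤ)) * h v y := by
      intro y hy
      conv_rhs => rw [← x.sum_repr v]
      rw [herm_sum_left, herm_sum_left, Finset.mul_sum, Finset.sum_filter]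
      refine Finset.sum_congr rfl fun l _ => ?_
      split_ifs with hl
      · rw [herm_smul_left, herm_smul_left, map_mul, mul_assoc]
      · rw [herm_smul_left, horth _ _ hl _ (hx l) _ hy, mul_zero, mul_zero]
    obtain ⟨y, hy, hwy⟩ := (hmod (d k)).exists_eq_smul hw fun y hy => by
      rw [hwv y hy]
      exact mul_mem_of_le R (R.map_mem (zpow_mem_pideal π _)) (hv _ y hy) (by omega)
    have h1 : x.repr w k = π ^ (n + 1 : ℤ) * x.repr v k := by
      simp only [w, map_sum, map_smul, Finsupp.finsetSum_apply, Finsupp.smul_apply, Basis.repr_self,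
        smul_eq_mul]
      rw [Finset.sum_eq_single k]
      · rw [Finsupp.single_eq_same, mul_one]
      · intro l _ hl
        rw [Finsupp.single_eq_of_ne hl.symm, mul_zero]
      · simp
    rw [hwy, map_smul, Finsupp.smul_apply, smul_eq_mul] at h1
    have hπ1 : π ∈ pideal F π 1 := by simpa using zpow_mem_pideal (F := F) π 1
    have h2 := mul_mem_of_le R hπ1 (hJ _ y hy k) (show 1 ≤ 1 + (0 : ℤ) by omega)
    rw [h1] at h2
    exact ((isOrd_zpow R (n + 1 : ℤ)).mul_mem_iff R (show (1 : ℤ) = n + 1 + -n by ring)).1 h2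
  have hex : ∃ n : ℕ, v ∈ box F π x (fun _ => -(n : ℤ)) := by
    choose n hn using fun k => R.exists_mem (x.repr v k)
    exact ⟨Finset.univ.sup n, fun k => R.anti
      (neg_le_neg (by exact_mod_cast Finset.le_sup (f := n) (Finset.mem_univ k))) (hn k)⟩
  obtain ⟨n, hn⟩ := hex
  induction n with
  | zero => exact box_mono R (fun k => by simp) hn
  | succ n ih => exact ih (step n (by exact_mod_cast hn))

/-- Coordinates adapted to a Jordan splitting. -/
theorem exists_jordan_basis [FiniteDimensional E V] (hnondeg : ∀ v, (∀ w, h v w = 0) → v = 0)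
    {L : Submodule O V} (hfg : L.FG) (hspan : Submodule.span E (L : Set V) = ⊤)
    {J : ℤ → Submodule O V} (hmod : ∀ i, ModularLike F π h (J i : Set V) i)
    (horth : ∀ i j, i ≠ j → ∀ v ∈ J i, ∀ w ∈ J j, h v w = 0)
    (hindep : iSupIndep J) (hsup : ⨆ i, J i = L) {N : ℕ} (hN : ∀ i, J i ≠ ⊥ → 0 ≤ i ∧ i < N) :
    ∃ (K : Type) (_ : Fintype K) (d : K → ℤ) (x u : Basis K E V) (T : Finset K),
      (∀ i, ((Finset.univ.filter fun k => d k = i).card = finrank O (J i))) ∧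
      (∀ k, 0 ≤ d k ∧ d k < N) ∧ (∀ k, x k ∈ J (d k)) ∧ (∀ k, ¬ ∃ y ∈ J (d k), x k = π • y) ∧
      (∀ {k l}, k ≠ l → h (u k) (x l) = 0) ∧ (∀ k, h (u k) (x k) = π ^ d k) ∧
      (∀ v, v ∈ L ↔ v ∈ box F π x 0) ∧ (∀ v, v ∈ L ↔ v ∈ box F π u 0) ∧
      (∀ i, ∀ v ∈ J i, ∀ w ∈ L, h v w ∈ pideal F π i) ∧ (∀ i, J i ≠ ⊥ → ∃ k, d k = i) ∧
      (∀ {k l}, k ∈ T → l ∈ T → d k = d l → k = l) ∧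
      (∀ {k}, k ∈ T → h (x k) (x k) - π ^ (2 * ((d k + 1) / 2)) ∈
        pideal F π (2 * ((d k + 1) / 2) + 1)) ∧
      (∀ {k}, k ∉ T → h (x k) (x k) ∈ pideal F π (2 * ((d k + 1) / 2) + 1)) := by
  classical
  have hdom : IsDomain O := isDomain_of_isIntegers I R
  -- The components are finitely generated and torsion-free over a principal ideal domain, hence
  -- free; their bases together are independent over the fraction field.
  have hpid : IsPrincipalIdealRing O := isPrincipalIdealRing_of_isIntegers I R
  have hfrac : IsFractionRing O E := isFractionRing_of_isIntegers I R
  have htf : Module.IsTorsionFree O V := Module.IsTorsionFree.of_smul_eq_zero fun a v hav => by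
    rw [← algebraMap_smul E a, smul_eq_zero] at hav
    exact hav.imp_left fun h1 => I.inj (h1.trans (map_zero _).symm)
  have hnoeth : IsNoetherian O L := isNoetherian_of_fg_of_noetherian L hfg
  have hfin : ∀ i, Module.Finite O (J i) := fun i => by
    have hle : J i ≤ L := hsup ▸ le_iSup J i
    have := isNoetherian_of_le hle
    infer_instance
  have hfree : ∀ i, Module.Free O (J i) := fun i => Module.free_of_finite_type_torsion_free'
  choose b T hTs hT hTn using fun i => (hmod i).exists_basis I R (Module.finBasis O (J i))
  let K : Type := Σ i : Fin N, Fin (finrank O (J i))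
  let x0 : K → V := fun k => (b k.1 k.2 : V)
  have hli : LinearIndependent O x0 :=
    linearIndependent_sigma (hindep.comp (f := fun i : Fin N => (i : ℤ))
      (fun i j hij => Fin.ext (Int.ofNat.inj hij))) fun i => b i
  have hsp : Submodule.span O (Set.range x0) = L := by
    refine (span_sigma fun i : Fin N => b i).trans ?_
    rw [← hsup]
    apply le_antisymm
    · exact iSup_le fun i => le_iSup J i
    · refine iSup_le fun i => ?_
      by_cases hi : J i = ⊥
      · rw [hi]
        exact bot_le
      · obtain ⟨h0, h1⟩ := hN i hi
        lift i to ℕ using h0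
        exact le_iSup (fun i : Fin N => J i) ⟨i, by exact_mod_cast h1⟩
  have hliE : LinearIndependent E x0 := (LinearIndependent.iff_fractionRing O E).1 hli
  have hspE : ⊤ ≤ Submodule.span E (Set.range x0) := by
    rw [← hspan, Submodule.span_le, ← hsp]
    exact Submodule.span_le_restrictScalars O E _
  let x : Basis K E V := Basis.mk hliE hspE
  have hx : ∀ k, x k = b k.1 k.2 := fun k => Basis.mk_apply hliE hspE k
  have hxr : Set.range x = Set.range x0 := by rw [Basis.coe_mk]
  let d : K → ℤ := fun k => k.1
  obtain ⟨u, hu, hu'⟩ := exists_dual_basis x hnondeg (fun k => π ^ d k)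
    fun k => zpow_ne_zero _ R.ne_zero
  have hxJ : ∀ k, x k ∈ J (d k) := fun k => by
    rw [hx]
    exact (b k.1 k.2).2
  have hL : ∀ v, v ∈ L ↔ v ∈ box F π x 0 := fun v => by
    rw [← mem_span_iff_mem_box I R, hxr, hsp]
  have hJL : ∀ i, ∀ v ∈ J i, v ∈ box F π x 0 := fun i v hv => by
    rw [← hL, ← hsup]
    exact Submodule.mem_iSup_of_mem i hv
  have hgram : ∀ i, ∀ v ∈ J i, ∀ w ∈ J i, h v w ∈ pideal F π i := fun i v hv w hw =>
    (hmod i).herm_mem_of_basis I R (b i) hv hw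
  have hrepr : ∀ k v, h v (x k) = h (u k) (x k) * σ (u.repr v k) := by
    intro k v
    conv_lhs => rw [← u.sum_repr v, herm_sum_left]
    rw [Finset.sum_eq_single k]
    · rw [herm_smul_left, mul_comm]
    · intro l _ hl
      rw [herm_smul_left, hu' l k hl, mul_zero]
    · exact fun hk => absurd (Finset.mem_univ k) hk
  have hscale : ∀ i, ∀ v ∈ J i, ∀ w ∈ L, h v w ∈ pideal F π i := by
    intro i v hv w hw
    rw [hL] at hw
    rw [← x.sum_repr w, herm_sum_right]
    refine AddSubgroup.sum_mem _ fun k _ => ?_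
    rw [herm_smul_right]
    by_cases hk : i = d k
    · exact mul_mem_of_le R (hw k) (hgram i v hv _ (hk ▸ hxJ k)) (by simp)
    · rw [horth i _ hk v hv _ (hxJ k), mul_zero]
      exact zero_mem _
  refine ⟨K, inferInstance, d, x, u, Finset.univ.filter fun k => k.2 ∈ T k.1, fun i => ?_,
    fun k => ⟨Int.natCast_nonneg _, Int.ofNat_lt.2 k.1.2⟩, hxJ, fun k => ?_, fun {k l} hkl => hu' k l hkl, hu, hL, fun v => ⟨fun hv k => ?_, fun hv => ?_⟩, hscale,
    fun i hi => ?_, ?_, fun {k} hk => ?_, fun {k} hk => ?_⟩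
  · by_cases hi : 0 ≤ i ∧ i < N
    · obtain ⟨h0, h1⟩ := hi
      lift i to ℕ using h0
      have h1' : i < N := by exact_mod_cast h1
      have h2 : (Finset.univ.filter fun k : K => d k = i) =
          (Finset.univ : Finset (Fin (finrank O (J i)))).map
            (Function.Embedding.sigmaMk (β := fun i : Fin N => Fin (finrank O (J i))) ⟨i, h1'⟩) := by
        ext ⟨⟨j, hj⟩, l⟩
        simp only [Finset.mem_filter, Finset.mem_univ, true_and, Finset.mem_map, d,
          Nat.cast_inj]
        constructor
        · rintro rfl
          exact ⟨l, rfl⟩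
        · rintro ⟨a, ha⟩
          exact congrArg (fun k : K => (k.1 : ℕ)) ha.symm
      rw [h2, Finset.card_map, Finset.card_univ, Fintype.card_fin]
    · have h1 : J i = ⊥ := by
        by_contra h1
        exact hi (hN i h1)
      rw [h1, finrank_bot, Finset.card_eq_zero, Finset.filter_eq_empty_iff]
      rintro ⟨j, l⟩ - h2
      exact hi (by rw [← h2]; exact ⟨Int.natCast_nonneg _, Int.ofNat_lt.2 j.2⟩)
  · rw [hx]
    exact coe_basis_ne_smul I R (b k.1) k.2
  · have h1 := hscale (d k) _ (hxJ k) v hv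
    rw [herm_mem_symm R, hrepr, hu, (isOrd_zpow R (d k)).mul_mem_iff R (add_zero (d k)).symm,
      map_mem_iff R] at h1
    exact h1
  -- Integral coordinates with respect to u mean that h(v, x_k) lies in π^(d k)B for all k, and by
  -- modularity of the components these conditions characterize L.
  · rw [hL]
    refine mem_box_zero_of_herm_mem I R hmod horth hxJ hJL fun i w hw => ?_
    by_cases hi : J i = ⊥
    · rw [hi, Submodule.mem_bot] at hw
      rw [hw, herm_zero_right]
      exact zero_mem _
    · obtain ⟨h0, h1⟩ := hN i hi
      lift i to ℕ using h0
      obtain ⟨c, rfl⟩ := coe_eq_sum (b i) hw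
      rw [herm_sum_right]
      refine AddSubgroup.sum_mem _ fun j _ => ?_
      have h3 : h v (x ⟨⟨i, Int.ofNat_lt.1 h1⟩, j⟩) ∈ pideal F π i := by
        rw [hrepr, hu, (isOrd_zpow R _).mul_mem_iff R (add_zero _).symm, map_mem_iff R]
        exact hv _
      rw [hx] at h3
      rw [← algebraMap_smul E (c j), herm_smul_right]
      exact mul_mem_of_le R (I.mem (c j)) h3 (by omega)
  · obtain ⟨h0, h1⟩ := hN i hi
    lift i to ℕ using h0
    by_contra! hne
    refine hi ((Submodule.eq_bot_iff _).2 fun v hv => ?_)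
    obtain ⟨c, rfl⟩ := coe_eq_sum (b i) hv
    exact Finset.sum_eq_zero fun j _ => absurd rfl (hne ⟨⟨i, Int.ofNat_lt.1 h1⟩, j⟩)
  · rintro ⟨i, k⟩ ⟨j, l⟩ hk hl hkl
    obtain rfl : i = j := Fin.ext (Int.ofNat.inj hkl)
    exact congrArg (Sigma.mk i) (hTs i (Finset.mem_filter.1 hk).2 (Finset.mem_filter.1 hl).2)
  · rw [hx]
    exact hT _ _ (Finset.mem_filter.1 hk).2
  · rw [hx]
    exact hTn _ _ fun h => hk (Finset.mem_filter.2 ⟨Finset.mem_univ k, h⟩)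

end Global

/-! ### Existence of frames, and detection of types by leaders. -/

section Existence

variable {F E : Type*} [NontriviallyNormedField F] [NormedAlgebra ℚ_[2] F]
  [Field E] [Algebra F E] {σ : E ≃ₐ[F] E} {π : E}
  {V : Type*} [AddCommGroup V] [Module E V] [FiniteDimensional E V] {h : hermForms σ V}
  {L : Submodule (intRingExt F E) V} {J : ℤ → Submodule (intRingExt F E) V} {N : ℕ}

theorem isIntegers_intRingExt : IsIntegers F π (intRingExt F E) where
  inj := Subtype.val_injective
  exists_eq ha := ⟨⟨_, mem_pideal_zero.1 ha⟩, rfl⟩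
  mem c := mem_pideal_zero.2 c.2

variable (R : IsRamified F σ π)
include R

theorem IsModular.modularLike {M : Submodule (intRingExt F E) V} {i : ℤ} (hM : IsModular π h M i) :
    ModularLike F π h (M : Set V) i where
  herm_mem hv hw hv' := hM.herm_mem R hv hw hv'
  exists_eq_smul hv hv' := hM.exists_eq_smul R hv hv'

/-- A frame adapted to a Jordan splitting; it detects the types of the Jordan components. -/
theorem exists_isFrame (hnondeg : ∀ v, (∀ w, h v w = 0) → v = 0) (hfg : L.FG)
    (hspan : Submodule.span E (L : Set V) = ⊤) (hJ : IsJordanSplitting π h L J)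
    (hN : ∀ i, J i ≠ ⊥ → 0 ≤ i ∧ i < N) :
    ∃ (K : Type) (_ : Fintype K) (d : K → ℤ) (x u : Basis K E V) (T : Finset K),
      IsFrame h π L d x u T ∧ (∀ k, 0 ≤ d k ∧ d k < N) ∧
      (∀ i, ((Finset.univ.filter fun k => d k = i).card : ℤ) = jrank J i) ∧
      ∀ i, IsTypeI π h L J i ↔ near d T i ≠ ∅ := by
  obtain ⟨K, hK, d, x, u, T, hcard, hd, hxJ, hxne, horth, hpair, hmemx, hmemu, hscale, hex, hTinj, hT,
    hTn⟩ := exists_jordan_basis (O := intRingExt F E) isIntegers_intRingExt R hnondeg hfg hspan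
    (fun i => (hJ.modular i).modularLike R) hJ.orthogonal hJ.indep hJ.sup_eq hN
  have hJL : ∀ i, J i ≤ L := fun i => hJ.sup_eq ▸ le_iSup J i
  have f : IsFrame h π L d x u T :=
    { orth := horth
      ord := fun k => by rw [hpair]; exact isOrd_zpow R _
      mem_left := hmemx
      mem_right := hmemu
      pairing := hpair
      gram_orth := fun {k l} hkl => hJ.orthogonal _ _ hkl _ (hxJ k) _ (hxJ l)
      gram_mem := fun {k l} _ => hscale _ _ (hxJ k) _ (hJL _ (hxJ l))
      leader_inj := hTinj
      leader_norm := hT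
      nonleader_norm := hTn }
  refine ⟨K, hK, d, x, u, T, f, hd, fun i => by rw [hcard]; rfl, fun i => ?_⟩
  have hAB : near d T i = ∅ → ∀ v ∈ latA π h L i, v ∈ latB π h L i := fun hn v hv => by
    rw [f.mem_latB R, phi_apply, hn]
    exact ⟨hv, by simp [zero_mem]⟩
  rcases Int.even_or_odd i with hi | hi
  · rw [IsTypeI, and_iff_left (fun h => absurd hi h), imp_iff_right hi]
    have hle : normIdeal h (J i) ≤ scaleIdeal h (J i) :=
      Submodule.span_mono fun a ⟨v, hv, ha⟩ => ⟨v, hv, v, hv, ha⟩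
    constructor
    -- Without a leader of degree i every norm from the component lies in π^(i+1)B, so the norm
    -- ideal cannot contain π^i, which lies in the scale.
    · rintro ⟨hne, heq⟩ hn
      obtain ⟨k, rfl⟩ := hex i hne
      have h1 : π ^ d k ∈ normIdeal h (J (d k)) := by
        rw [heq]
        have h2 : π ^ d k ∈ Submodule.span (intRingExt F E) {a : E | ∃ y ∈ J (d k), a = h (x k) y} := by
          rw [hJ.modular _ _ (hxJ k) (hxne k)]
          exact Submodule.mem_span_singleton_self _
        refine Submodule.span_mono ?_ h2
        rintro a ⟨y, hy, ha⟩
        exact ⟨x k, hxJ k, y, hy, ha⟩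
      refine zpow_notMem R (show d k < d k + 1 by omega) (Submodule.span_induction (p := fun a _ =>
        a ∈ pideal F π (d k + 1)) ?_ (zero_mem _) (fun _ _ _ _ h1 h2 => add_mem h1 h2) ?_ h1)
      · rintro _ ⟨y, hy, rfl⟩
        exact R.anti (by omega)
          (IsFrame.norm_mem_of_latB R (hAB hn y ⟨hJL _ hy, hscale _ y hy⟩))
      · intro c y _ hy
        exact mul_mem_of_le R (mem_pideal_zero.2 c.2) hy (by omega)
    · intro hn
      obtain ⟨t, ht⟩ := Finset.nonempty_iff_ne_empty.2 hn
      obtain ⟨htT, hti⟩ := mem_near.1 ht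
      obtain rfl : d t = i := hti.resolve_right fun h => Int.not_even_iff_odd.2 h.1 hi
      refine ⟨fun h0 => ?_, le_antisymm hle ?_⟩
      · have := hxJ t
        rw [h0, Submodule.mem_bot] at this
        exact x.ne_zero t this
      · have h1 : h (x t) (x t) - π ^ d t ∈ pideal F π (d t + 1) := by
          have h2 := hT htT
          rwa [show 2 * ((d t + 1) / 2) = d t by obtain ⟨m, hm⟩ := hi; omega] at h2
        have h2 : IsOrd F π (π ^ (-d t) * h (x t) (x t)) 0 := by
          have h3 : π ^ (-d t) * h (x t) (x t) - 1 ∈ pideal F π 1 := by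
            have := mul_mem_of_le R (zpow_mem_pideal π (-d t)) h1 (show 1 ≤ _ by omega)
            rwa [mul_sub, ← zpow_add₀ R.ne_zero, neg_add_cancel, zpow_zero] at this
          refine isOrd_of_unit R ?_ fun h4 => R.one_notMem ?_
          · have := add_mem (R.anti (show (0 : ℤ) ≤ 1 by omega) h3) (isOrd_one (F := F)).2.1
            rwa [sub_add_cancel] at this
          · have := sub_mem h4 h3
            rwa [sub_sub_cancel] at this
        have h3 := h2.2.2
        rw [neg_zero, mem_pideal_zero] at h3
        have h4 : π ^ d t ∈ normIdeal h (J (d t)) := by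
          have h5 := Submodule.smul_mem (normIdeal h (J (d t))) ⟨_, h3⟩
            (Submodule.subset_span ⟨x t, hxJ t, rfl⟩ : h (x t) (x t) ∈ normIdeal h (J (d t)))
          have h6 : (π ^ (-d t) * h (x t) (x t))⁻¹ * h (x t) (x t) = π ^ d t := by
            rw [mul_inv, zpow_neg, inv_inv, mul_assoc,
              inv_mul_cancel₀ (right_ne_zero_of_mul h2.1), mul_one]
          rw [← h6]
          exact h5
        rw [scaleIdeal, Submodule.span_le]
        rintro _ ⟨v, hv, w, hw, rfl⟩
        obtain ⟨c, hc, hcv⟩ := hscale _ v hv w (hJL _ hw)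
        have h5 := Submodule.smul_mem (normIdeal h (J (d t))) ⟨c, hc⟩ h4
        rw [SetLike.mem_coe, hcv, mul_comm]
        exact h5
  · have hi' : ¬ Even i := Int.not_even_iff_odd.2 hi
    rw [IsTypeI, and_iff_right (fun h => absurd h hi'), imp_iff_right hi']
    -- If a near leader exists, `phi` takes the value 1 on A_i, so B_i is a proper subset.
    refine not_congr ⟨fun h1 => ?_, fun h1 => Set.Subset.antisymm (hAB h1) fun v hv => hv.1⟩
    by_contra h2
    obtain ⟨t, ht⟩ := Finset.nonempty_iff_ne_empty.2 h2
    obtain ⟨w, hw, hw1⟩ := f.exists_phi_eq_one R ht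
    rw [h1, f.mem_latB R, hw1] at hw
    exact R.one_notMem hw.2

end Existence

/-! ### Sums over basis indices as sums over degrees. -/

section Sums

theorem sum_Ico_sum_Ico (N : ℤ) (g : ℤ → ℤ → ℤ) :
    ∑ i ∈ Finset.Ico 0 N, ∑ j ∈ Finset.Ico 0 N, g i j =
      ∑ i ∈ Finset.Ico 0 N, ∑ j ∈ Finset.Ico (i + 1) N, g i j + ∑ i ∈ Finset.Ico 0 N, g i i +
        ∑ i ∈ Finset.Ico 0 N, ∑ j ∈ Finset.Ico (i + 1) N, g j i := by
  have h1 : ∀ i ∈ Finset.Ico 0 N, ∑ j ∈ Finset.Ico 0 N, g i j =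
      ∑ j ∈ Finset.Ico (i + 1) N, g i j + g i i + ∑ j ∈ Finset.Ico 0 i, g i j := by
    intro i hi
    rw [Finset.mem_Ico] at hi
    have h2 : Finset.Ico 0 N = (Finset.Ico (i + 1) N ∪ {i}) ∪ Finset.Ico 0 i := by
      ext j
      simp only [Finset.mem_union, Finset.mem_Ico, Finset.mem_singleton]
      omega
    rw [h2, Finset.sum_union, Finset.sum_union, Finset.sum_singleton]
    · simp
    · rw [Finset.disjoint_left]
      intro j
      simp only [Finset.mem_union, Finset.mem_Ico, Finset.mem_singleton]
      omega
  rw [Finset.sum_congr rfl h1, Finset.sum_add_distrib, Finset.sum_add_distrib]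
  congr 1
  refine Finset.sum_comm' fun i j => ?_
  simp only [Finset.mem_Ico]
  omega

variable {K : Type*} [Fintype K] {d : K → ℤ} {N : ℕ} {n : ℤ → ℤ}

theorem sum_comp_degree (hd : ∀ k, 0 ≤ d k ∧ d k < N)
    (hn : ∀ i, ((Finset.univ.filter fun k => d k = i).card : ℤ) = n i) (g : ℤ → ℤ) :
    ∑ k, g (d k) = ∑ i ∈ Finset.Ico (0 : ℤ) N, g i * n i := by
  classical
  rw [← Finset.sum_fiberwise_of_maps_to (s := Finset.univ) (t := Finset.Ico (0 : ℤ) N) (g := d)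
    fun k _ => Finset.mem_Ico.2 (hd k)]
  refine Finset.sum_congr rfl fun i _ => ?_
  rw [← hn, Finset.sum_congr rfl fun k hk => by rw [(Finset.mem_filter.1 hk).2], Finset.sum_const,
    nsmul_eq_mul, mul_comm]

theorem sum_sum_comp_degree (hd : ∀ k, 0 ≤ d k ∧ d k < N)
    (hn : ∀ i, ((Finset.univ.filter fun k => d k = i).card : ℤ) = n i) (g : ℤ → ℤ → ℤ) :
    ∑ k, ∑ l, g (d k) (d l) =
      ∑ i ∈ Finset.Ico (0 : ℤ) N, ∑ j ∈ Finset.Ico (0 : ℤ) N, g i j * n i * n j := by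
  rw [sum_comp_degree hd hn fun i => ∑ l, g i (d l)]
  refine Finset.sum_congr rfl fun i _ => ?_
  rw [sum_comp_degree hd hn (g i), Finset.sum_mul]
  exact Finset.sum_congr rfl fun j _ => by ring

theorem sum_max_zero_sub (hd : ∀ k, 0 ≤ d k ∧ d k < N)
    (hn : ∀ i, ((Finset.univ.filter fun k => d k = i).card : ℤ) = n i) :
    ∑ k, ∑ l, max 0 (d l - d k) =
      ∑ i ∈ Finset.Ico (0 : ℤ) N, ∑ j ∈ Finset.Ico (i + 1) (N : ℤ), (j - i) * n i * n j := by
  rw [sum_sum_comp_degree hd hn fun i j => max 0 (j - i), sum_Ico_sum_Ico, Finset.sum_eq_zero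
    (s := Finset.Ico (0 : ℤ) N) (f := fun i => max 0 (i - i) * n i * n i), add_zero, add_eq_left.2]
  · refine Finset.sum_congr rfl fun i _ => Finset.sum_congr rfl fun j hj => ?_
    rw [Finset.mem_Ico] at hj
    rw [max_eq_right (by omega)]
  · refine Finset.sum_eq_zero fun i _ => Finset.sum_eq_zero fun j hj => ?_
    rw [Finset.mem_Ico] at hj
    rw [max_eq_left (by omega), zero_mul, zero_mul]
  · intro i _
    simp

theorem sum_max (hd : ∀ k, 0 ≤ d k ∧ d k < N)
    (hn : ∀ i, ((Finset.univ.filter fun k => d k = i).card : ℤ) = n i) :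
    ∑ k, ∑ l, max (d k) (d l) =
      2 * ∑ i ∈ Finset.Ico (0 : ℤ) N, ∑ j ∈ Finset.Ico (i + 1) (N : ℤ), j * n i * n j +
        ∑ i ∈ Finset.Ico (0 : ℤ) N, i * n i * n i := by
  rw [sum_sum_comp_degree hd hn fun i j => max i j, sum_Ico_sum_Ico]
  have h1 : ∑ i ∈ Finset.Ico (0 : ℤ) N, ∑ j ∈ Finset.Ico (i + 1) (N : ℤ), max i j * n i * n j =
      ∑ i ∈ Finset.Ico (0 : ℤ) N, ∑ j ∈ Finset.Ico (i + 1) (N : ℤ), j * n i * n j := by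
    refine Finset.sum_congr rfl fun i _ => Finset.sum_congr rfl fun j hj => ?_
    rw [Finset.mem_Ico] at hj
    rw [max_eq_right (by omega)]
  have h2 : ∑ i ∈ Finset.Ico (0 : ℤ) N, ∑ j ∈ Finset.Ico (i + 1) (N : ℤ), max j i * n j * n i =
      ∑ i ∈ Finset.Ico (0 : ℤ) N, ∑ j ∈ Finset.Ico (i + 1) (N : ℤ), j * n i * n j := by
    refine Finset.sum_congr rfl fun i _ => Finset.sum_congr rfl fun j hj => ?_
    rw [Finset.mem_Ico] at hj
    rw [max_eq_left (by omega)]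
    ring
  rw [h1, h2]
  simp only [max_self]
  ring

/-- A symmetric array is folded along its diagonal, which is counted twice; doubling avoids
division. -/
theorem two_mul_sum_ordPair {e : K → ℕ} (he : Function.Injective e) (g : K → K → ℤ)
    (hg : ∀ k l, g k l = g l k) :
    2 * ∑ p : OrdPair e, g p.1.1 p.1.2 = ∑ k, ∑ l, g k l + ∑ k, g k k := by
  classical
  have h1 : ∑ p : OrdPair e, g p.1.1 p.1.2 = ∑ k, ∑ l, if e k ≤ e l then g k l else 0 := by
    rw [← Fintype.sum_prod_type' (f := fun k l => if e k ≤ e l then g k l else 0),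
      ← Finset.sum_filter]
    exact (Finset.sum_subtype (Finset.univ.filter fun p : K × K => e p.1 ≤ e p.2) (by simp)
      fun p : K × K => g p.1 p.2).symm
  have h2 : ∑ k, ∑ l, (if e k ≤ e l then g k l else 0) =
      ∑ k, ∑ l, if e l ≤ e k then g k l else 0 := by
    rw [Finset.sum_comm]
    exact Finset.sum_congr rfl fun k _ => Finset.sum_congr rfl fun l _ => by rw [hg]
  rw [two_mul, congrArg₂ (· + ·) (h1.trans h2) h1]
  rw [← Finset.sum_add_distrib, ← Finset.sum_add_distrib]
  refine Finset.sum_congr rfl fun k _ => ?_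
  rw [← Finset.sum_add_distrib]
  have h3 : ∀ l, ((if e l ≤ e k then g k l else 0) + if e k ≤ e l then g k l else 0) =
      g k l + if l = k then g k l else 0 := by
    intro l
    rcases lt_trichotomy (e k) (e l) with h4 | h4 | h4
    · rw [if_neg (by omega), if_pos h4.le, if_neg (by rintro rfl; omega), zero_add, add_zero]
    · obtain rfl := he h4
      simp
    · rw [if_pos h4.le, if_neg (by omega), if_neg (by rintro rfl; omega)]
  rw [Finset.sum_congr rfl fun l _ => h3 l, Finset.sum_add_distrib,
    Finset.sum_ite_eq' Finset.univ k, if_pos (Finset.mem_univ k)]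

end Sums

/-! ### Evaluation of the exponents N_M and N_H. -/

section Exponents

variable {F E : Type*} [NontriviallyNormedField F] [NormedAlgebra ℚ_[2] F]
  [Field E] [Algebra F E] {σ : E ≃ₐ[F] E} {π : E}
  {V : Type*} [AddCommGroup V] [Module E V] {h : hermForms σ V}
  {L : Submodule (intRingExt F E) V} {J : ℤ → Submodule (intRingExt F E) V} {N : ℕ}
  {K : Type*} [Fintype K] {d : K → ℤ} {x u : Basis K E V} {T : Finset K} {ρ : ℤ → Option K}
  (f : IsFrame h π L d x u T) (P : IsPivot d T ρ) (hd : ∀ k, 0 ≤ d k ∧ d k < N)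
  (hn : ∀ i, ((Finset.univ.filter fun k => d k = i).card : ℤ) = jrank J i)
  (hI : ∀ i, IsTypeI π h L J i ↔ near d T i ≠ ∅)
include f P hd hn hI

-- An index k has exactly one pivot if its degree is of type I, and none otherwise.
open Classical in
omit f in
theorem sum_pivot : ∑ k, ∑ l, (if ρ (d k) = some l then (1 : ℤ) else 0) =
    ∑ i ∈ (Finset.Ico (0 : ℤ) N).filter (IsTypeI π h L J), jrank J i := by
  have h1 : ∀ k, ∑ l, (if ρ (d k) = some l then (1 : ℤ) else 0) =
      if IsTypeI π h L J (d k) then 1 else 0 := by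
    intro k
    rw [hI, Ne, ← P.eq_none_iff]
    cases h2 : ρ (d k) with
    | none => simp
    | some t => simp [Finset.sum_ite_eq]
  rw [Finset.sum_congr rfl fun k _ => h1 k,
    sum_comp_degree hd hn fun i => if IsTypeI π h L J i then 1 else 0, Finset.sum_filter]
  exact Finset.sum_congr rfl fun i _ => by split_ifs <;> simp

-- By the preference built into `IsPivot`, an odd degree has its own leader as pivot only if no
-- leader exists in the adjacent even degrees, that is, exactly when the component is free of type
-- I.
open Classical in
theorem sum_free : ∑ k, (if ¬ Even (d k) ∧ ρ (d k) = some k then (1 : ℤ) else 0) =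
    numFreeOdd π h L J N := by
  rw [← Finset.sum_filter, Finset.sum_const, nsmul_eq_mul, mul_one, numFreeOdd]
  congr 1
  have hev : ∀ {i t}, t ∈ T → d t = i → near d T i ≠ ∅ := fun ht hi =>
    Finset.ne_empty_of_mem (mem_near.2 ⟨ht, Or.inl hi⟩)
  refine Finset.card_bij (fun k _ => d k) ?_ ?_ ?_
  · intro k hk
    obtain ⟨hodd, hρ⟩ := (Finset.mem_filter.1 hk).2
    have hodd' := Int.not_even_iff_odd.1 hodd
    have hnear := P.near_eq hρ rfl
    have key : ∀ i, Even i → (i = d k - 1 ∨ i = d k + 1) → ¬ IsTypeI π h L J i := by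
      intro i hi hik h1
      rw [hI] at h1
      obtain ⟨t, ht⟩ := Finset.nonempty_iff_ne_empty.2 h1
      obtain ⟨htT, ht⟩ := mem_near.1 ht
      have hti : d t = i := ht.resolve_right fun h => Int.not_even_iff_odd.2 h.1 hi
      have h2 : t ∈ near d T (d k) := mem_near.2 ⟨htT, Or.inr ⟨hodd', by omega⟩⟩
      rw [hnear, Finset.mem_singleton] at h2
      subst h2
      omega
    rw [Finset.mem_filter, Finset.mem_Ico]
    refine ⟨hd k, hodd', (hI _).2 (hnear ▸ Finset.singleton_ne_empty k), ?_⟩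
    rintro (h1 | h1)
    · exact key _ (hodd'.sub_odd odd_one) (Or.inl rfl) h1
    · exact key _ (hodd'.add_odd odd_one) (Or.inr rfl) h1
  · intro k hk l hl hkl
    have h1 := (Finset.mem_filter.1 hk).2.2
    have h2 := (Finset.mem_filter.1 hl).2.2
    rw [hkl, h2] at h1
    exact (Option.some.inj h1).symm
  · intro i hi
    obtain ⟨-, hodd, hti, hfree⟩ := Finset.mem_filter.1 hi
    cases hρ : ρ i with
    | none => exact absurd ((P.eq_none_iff i).1 hρ) ((hI i).1 hti)
    | some t =>
      obtain ⟨htT, ht⟩ := mem_near.1 (P.mem_near hρ)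
      have hdt : d t = i := by
        refine ht.resolve_right fun h1 => hfree ?_
        exact h1.2.imp (fun h => (hI _).2 (hev htT h)) fun h => (hI _).2 (hev htT h)
      exact ⟨t, Finset.mem_filter.2 ⟨Finset.mem_univ t, by
        rw [hdt]; exact ⟨Int.not_even_iff_odd.2 hodd, hρ⟩⟩, hdt⟩

/-- Row and column pivots each contribute the sum of the type I ranks. The diagonal coincidences
cost one each in odd degree and nothing in even degree. -/
theorem exponentM_eq :
    ((∑ p : K × K, (max 0 (d p.2 - d p.1)).toNat + ∑ p : K × K, expCondM d ρ p : ℕ) : ℤ) =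
      expM π h L J N := by
  classical
  have h1 : ∀ k l, (expCondM d ρ (k, l) : ℤ) = (if ρ (d l) = some k then (1 : ℤ) else 0) +
      (if ρ (d k) = some l then (1 : ℤ) else 0) -
      (if l = k then if ¬ Even (d k) ∧ ρ (d k) = some k then (1 : ℤ) else 0 else 0) := by
    intro k l
    simp only [expCondM]
    by_cases h2 : ρ (d l) = some k
    · by_cases h3 : ρ (d k) = some l
      · obtain rfl := P.eq_of_eq f h3 h2
        by_cases h4 : Even (d k) <;> simp [h2, h4]
      · have h4 : l ≠ k := by rintro rfl; exact h3 h2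
        simp [h2, h3, h4]
    · by_cases h3 : ρ (d k) = some l
      · have h4 : l ≠ k := by rintro rfl; exact h2 h3
        simp [h2, h3, h4]
      · simp only [h2, h3, if_false]
        split_ifs with h4 h5
        · subst h4; exact absurd h5.2 h2
        · rfl
        · rfl
  push_cast
  rw [Fintype.sum_prod_type, Fintype.sum_prod_type]
  simp only [h1, Finset.sum_sub_distrib, Finset.sum_add_distrib, Finset.sum_ite_eq',
    Finset.mem_univ, if_true]
  rw [Finset.sum_comm (f := fun k l => if ρ (d l) = some k then (1 : ℤ) else 0),
    sum_pivot P hd hn hI, sum_free f P hd hn hI, expM, ← Finset.mul_sum,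
    ← sum_max_zero_sub hd hn]
  have h2 : ∑ k, ∑ l, ((max 0 (d l - d k)).toNat : ℤ) = ∑ k, ∑ l, max 0 (d l - d k) :=
    Finset.sum_congr rfl fun k _ => Finset.sum_congr rfl fun l _ =>
      Int.toNat_of_nonneg (le_max_left _ _)
  simp only [Int.ofNat_toNat] at h2 ⊢
  rw [h2]
  ring

/-- Both sums over unordered pairs are evaluated after doubling; the diagonal exponent ⌈d/2⌉ + 1
equals (i+2)/2 or (i+3)/2 according to parity. -/
theorem exponentH_eq {e : K → ℕ} (he : Function.Injective e) :
    ((∑ p : OrdPair e, (by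
        classical exact if p.1.1 = p.1.2 then ((d p.1.1 + 1) / 2 + 1).toNat
          else (max (d p.1.1) (d p.1.2)).toNat) +
        ∑ p : OrdPair e, expCondH d ρ p.1.1 p.1.2 : ℕ) : ℤ) = expH π h L J N := by
  classical
  have h1 : ∀ k l, (expCondH d ρ k l : ℤ) = (if ρ (d l) = some k then (1 : ℤ) else 0) +
      (if ρ (d k) = some l then (1 : ℤ) else 0) -
      (if l = k then (if ρ (d k) = some k then (1 : ℤ) else 0) +
        if ¬ Even (d k) ∧ ρ (d k) = some k then (1 : ℤ) else 0 else 0) := by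
    intro k l
    simp only [expCondH]
    by_cases hkl : k = l
    · subst hkl
      by_cases h2 : ρ (d k) = some k <;> by_cases h4 : Even (d k) <;> simp [h2, h4]
    · by_cases h2 : ρ (d l) = some k
      · have h3 : ρ (d k) ≠ some l := fun h3 => hkl (P.eq_of_eq f h3 h2)
        simp [h2, h3, hkl, Ne.symm hkl]
      · by_cases h3 : ρ (d k) = some l <;> simp [h2, h3, hkl, Ne.symm hkl]
  have h2 : ∀ k, (expCondH d ρ k k : ℤ) = (if ρ (d k) = some k then (1 : ℤ) else 0) -
        if ¬ Even (d k) ∧ ρ (d k) = some k then (1 : ℤ) else 0 := by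
    intro k
    rw [h1, if_pos rfl]
    ring
  have hC := two_mul_sum_ordPair he (fun k l => (expCondH d ρ k l : ℤ)) fun k l => by
    unfold expCondH
    by_cases hkl : k = l
    · subst hkl; rfl
    · simp only [hkl, Ne.symm hkl, if_false]
      exact congrArg Nat.cast (if_congr or_comm rfl rfl)
  obtain ⟨c, hc⟩ : ∃ c : ℤ, c = ∑ p : OrdPair e, (expCondH d ρ p.1.1 p.1.2 : ℤ) := ⟨_, rfl⟩
  rw [← hc, Finset.sum_congr rfl fun k _ => h2 k] at hC
  simp only [h1, Finset.sum_sub_distrib, Finset.sum_add_distrib, Finset.sum_ite_eq',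
    Finset.mem_univ, if_true] at hC
  rw [Finset.sum_comm (f := fun k l => if ρ (d l) = some k then (1 : ℤ) else 0),
    sum_pivot P hd hn hI, sum_free f P hd hn hI] at hC
  have hB := two_mul_sum_ordPair he (fun k l => if k = l then (d k + 1) / 2 + 1 else max (d k) (d l))
    fun k l => by
      by_cases hkl : k = l
      · subst hkl; rfl
      · simp only [hkl, Ne.symm hkl, if_false]
        rw [max_comm]
  have h3 : ∀ k l, (if k = l then (d k + 1) / 2 + 1 else max (d k) (d l)) =
      max (d k) (d l) + if l = k then (d k + 1) / 2 + 1 - d k else 0 := by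
    intro k l
    by_cases hkl : k = l
    · subst hkl
      simp
    · simp [hkl, Ne.symm hkl]
  rw [Finset.sum_congr rfl fun k _ => if_pos rfl] at hB
  rw [Finset.sum_congr rfl fun k _ => Finset.sum_congr rfl fun l _ => h3 k l] at hB
  simp only [Finset.sum_add_distrib, Finset.sum_ite_eq', Finset.mem_univ, if_true,
    Finset.sum_sub_distrib] at hB
  rw [sum_max hd hn, sum_comp_degree hd hn fun i => i] at hB
  have h4 : ∑ i ∈ Finset.Ico (0 : ℤ) N, ((i + 1) / 2 + 1) * jrank J i =
      (∑ i ∈ (Finset.Ico (0 : ℤ) N).filter (fun i => Even i), (i + 2) / 2 * jrank J i)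
    + (∑ i ∈ (Finset.Ico (0 : ℤ) N).filter (fun i => Odd i), (i + 3) / 2 * jrank J i) := by
    rw [Finset.sum_filter, Finset.sum_filter, ← Finset.sum_add_distrib]
    refine Finset.sum_congr rfl fun i _ => ?_
    rcases Int.even_or_odd i with hi | hi
    · rw [if_pos hi, if_neg (Int.not_odd_iff_even.2 hi), add_zero]
      congr 1
      obtain ⟨m, rfl⟩ := hi
      omega
    · rw [if_neg (Int.not_even_iff_odd.2 hi), if_pos hi, zero_add]
      congr 1
      obtain ⟨m, rfl⟩ := hi
      omega
  rw [← sum_comp_degree hd hn fun i => (i + 1) / 2 + 1, Finset.sum_add_distrib] at h4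
  have h5 : 2 * ∑ i ∈ Finset.Ico (0 : ℤ) N, (i * jrank J i * (jrank J i - 1)) / 2 =
      ∑ i ∈ Finset.Ico (0 : ℤ) N, i * jrank J i * jrank J i -
        ∑ i ∈ Finset.Ico (0 : ℤ) N, i * jrank J i := by
    rw [Finset.mul_sum, ← Finset.sum_sub_distrib]
    refine Finset.sum_congr rfl fun i _ => ?_
    have h6 : (2 : ℤ) ∣ i * jrank J i * (jrank J i - 1) := by
      rw [mul_assoc]
      exact Dvd.dvd.mul_left (Int.even_mul_pred_self _).two_dvd _
    rw [Int.mul_ediv_cancel' h6]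
    ring
  have h7 : ((∑ p : OrdPair e, if p.1.1 = p.1.2 then ((d p.1.1 + 1) / 2 + 1).toNat
          else (max (d p.1.1) (d p.1.2)).toNat : ℕ) : ℤ) =
      ∑ p : OrdPair e, if p.1.1 = p.1.2 then (d p.1.1 + 1) / 2 + 1
        else max (d p.1.1) (d p.1.2) := by
    push_cast
    refine Finset.sum_congr rfl fun p _ => ?_
    have := (hd p.1.1).1
    split_ifs <;> omega
  rw [Nat.cast_add, h7, Nat.cast_sum, ← hc, expH]
  linarith

end Exponents

/-! ### Volumes of subgroups of finite index. -/

section Cosets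

/-- A subgroup is the disjoint union of the cosets of a subgroup of finite index. -/
theorem measure_eq_relIndex_mul {G : Type*} [AddCommGroup G] [MeasurableSpace G] [MeasurableAdd G]
    (μ : Measure G) [μ.IsAddLeftInvariant] {S M : AddSubgroup G} (hle : S ≤ M)
    (hS : MeasurableSet (S : Set G)) (hidx : S.relIndex M ≠ 0) :
    μ M = S.relIndex M * μ S := by
  let Q := M ⧸ S.addSubgroupOf M
  have : (S.addSubgroupOf M).FiniteIndex := ⟨hidx⟩
  have hQ : Finite Q := AddSubgroup.finite_quotient_of_finiteIndex
  have hfin : Fintype Q := Fintype.ofFinite Q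
  have hmem : ∀ (x : M) (q : Q), -(q.out : G) + x ∈ S ↔ (QuotientAddGroup.mk x : Q) = q := by
    intro x q
    nth_rw 2 [← q.out_eq]
    rw [eq_comm]
    exact (QuotientAddGroup.eq (s := S.addSubgroupOf M)).symm
  have hU : (M : Set G) = ⋃ q : Q, (fun x => -(q.out : G) + x) ⁻¹' (S : Set G) := by
    ext x
    rw [Set.mem_iUnion]
    constructor
    · intro hx
      exact ⟨QuotientAddGroup.mk (⟨x, hx⟩ : M), (hmem ⟨x, hx⟩ _).2 rfl⟩
    · rintro ⟨q, hq⟩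
      have := M.add_mem q.out.2 (hle hq)
      rwa [add_neg_cancel_left] at this
  rw [hU, measure_iUnion]
  · simp only [measure_preimage_add]
    rw [tsum_fintype, Finset.sum_const, nsmul_eq_mul, Finset.card_univ, ← Nat.card_eq_fintype_card]
    rfl
  · intro q r hqr
    rw [Function.onFun, Set.disjoint_left]
    intro x hq hr
    have hx : x ∈ M := by
      have := M.add_mem q.out.2 (hle hq)
      rwa [add_neg_cancel_left] at this
    exact hqr (((hmem ⟨x, hx⟩ q).1 hq).symm.trans ((hmem ⟨x, hx⟩ r).1 hr))
  · exact fun q => measurable_const_add _ hS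

end Cosets

/-! ### Comparison of invariant measures. -/

section FormMeasure

variable {F : Type*} [NontriviallyNormedField F] [NormedAlgebra ℚ_[2] F]
    [FiniteDimensional ℚ_[2] F] [MeasurableSpace F] [BorelSpace F]

theorem stdHaar_eq : haveI : ProperSpace F := FiniteDimensional.proper ℚ_[2] F
    ∃ c : ℝ≥0, stdHaar F = c • (Measure.addHaar : Measure F) := by
  have : ProperSpace F := FiniteDimensional.proper ℚ_[2] F
  have h1 : (Measure.addHaar (intRing F : Set F) : ℝ≥0∞) ≠ 0 := by
    have h2 : Metric.ball (0 : F) 1 ⊆ (intRing F : Set F) := fun x hx => by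
      rw [SetLike.mem_coe, mem_intRing_iff]
      exact (mem_ball_zero_iff.1 hx).le
    exact fun h3 => (Metric.measure_ball_pos Measure.addHaar (0 : F) one_pos).ne'
      (measure_mono_null h2 h3)
  refine ⟨((Measure.addHaar (intRing F : Set F))⁻¹).toNNReal, ?_⟩
  rw [stdHaar, ← ENNReal.coe_toNNReal (ENNReal.inv_ne_top.2 h1)]
  rfl

instance : SigmaFinite (stdHaar F) := by
  have : ProperSpace F := FiniteDimensional.proper ℚ_[2] F
  obtain ⟨c, hc⟩ := stdHaar_eq (F := F)
  rw [hc]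
  infer_instance

instance : (stdHaar F).IsAddLeftInvariant := by
  have : ProperSpace F := FiniteDimensional.proper ℚ_[2] F
  obtain ⟨c, hc⟩ := stdHaar_eq (F := F)
  rw [hc]
  infer_instance

theorem measurable_dual_apply {ι : Type*} [Fintype ι] (l : (ι → F) →ₗ[F] F) : Measurable l := by
  classical
  have : ProperSpace F := FiniteDimensional.proper ℚ_[2] F
  have : SecondCountableTopology F := secondCountable_of_proper
  have h1 : (l : (ι → F) → F) = fun x => ∑ i, x i • l fun j => if i = j then 1 else 0 :=
    funext fun x => l.pi_apply_eq_sum_univ x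
  rw [h1]
  refine Finset.measurable_fun_sum _ fun i _ => ?_
  simp only [smul_eq_mul]
  exact (measurable_pi_apply i).mul_const _

variable {W ι : Type*} [AddCommGroup W] [Module F W] [Fintype ι]

theorem measurable_equivFun_symm (b : Basis ι F W) :
    @Measurable _ _ _ (linMeasurableSpace F W) b.equivFun.symm := by
  rw [measurable_iff_comap_le, MeasurableSpace.comap_iSup]
  refine iSup_le fun l => ?_
  rw [MeasurableSpace.comap_comp, ← measurable_iff_comap_le]
  exact measurable_dual_apply (l ∘ₗ b.equivFun.symm.toLinearMap)

theorem measurableSet_mem_dyad (l : W →ₗ[F] F) (j : ℤ) :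
    MeasurableSet[linMeasurableSpace F W] {X | l X ∈ dyad F j} := by
  have h1 : Measurable[linMeasurableSpace F W] l := by
    rw [measurable_iff_comap_le]
    exact le_iSup (fun l : Module.Dual F W => MeasurableSpace.comap l inferInstance) l
  have h2 : MeasurableSet {y : F | y ∈ dyad F j} :=
    (isClosed_le continuous_norm continuous_const).measurableSet
  exact h1 h2

theorem formMeasure_apply (ω : W [⋀^ι]→ₗ[F] F) (hb : Nonempty (Basis ι F W)) {Y : Set W}
    (hY : MeasurableSet[linMeasurableSpace F W] Y) :
    formMeasure ω Y = nabs (ω hb.some) *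
      (Measure.pi fun _ : ι => stdHaar F) (hb.some.equivFun.symm ⁻¹' Y) := by
  rw [formMeasure, dif_pos hb]
  rw [Measure.smul_apply, Measure.map_apply (measurable_equivFun_symm _) hY]
  rfl

/-- In the absence of a basis indexed by ι the measure is zero by convention. The normalization to
volume 1 therefore supplies the dimension of the space. -/
theorem nonempty_basis_of_formMeasure {ω : W [⋀^ι]→ₗ[F] F} {Y : Set W}
    (hY : formMeasure ω Y = 1) : Nonempty (Basis ι F W) := by
  by_contra hb
  rw [formMeasure, dif_neg hb] at hY
  simp at hY

theorem nabs_mul (a b : F) : nabs (a * b) = nabs a * nabs b := by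
  rw [nabs, map_mul, nnnorm_mul]
  rfl

/-- Comparison of two invariant measures by means of a lattice and (a translate of) a sublattice. -/
theorem nabs_apply_basis_eq {ω ω' : W [⋀^ι]→ₗ[F] F} (hb : Nonempty (Basis ι F W))
    {S M : AddSubgroup W} {M₀ S₀ : Set W} {w : W} {n : ℕ} (hM₀ : M₀ = M)
    (hS₀ : ∀ X, X ∈ S₀ ↔ X - w ∈ S) (hle : S ≤ M)
    (hSm : MeasurableSet[linMeasurableSpace F W] (S : Set W))
    (hMm : MeasurableSet[linMeasurableSpace F W] (M : Set W))
    (hidx : S.relIndex M = (2 ^ finrank ℚ_[2] F) ^ n)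
    (hω : formMeasure ω M₀ = 1) (hω' : formMeasure ω' S₀ = 1) :
    nabs (ω hb.some) = nabs (2 : F) ^ n * nabs (ω' hb.some) := by
  have : ProperSpace F := FiniteDimensional.proper ℚ_[2] F
  have : SecondCountableTopology F := secondCountable_of_proper
  set b := hb.some
  set μ := Measure.pi fun _ : ι => stdHaar F
  let e : (ι → F) →+ W := b.equivFun.symm.toLinearMap.toAddMonoidHom
  have he : Function.Surjective e := b.equivFun.symm.surjective
  have hidx' : (S.comap e).relIndex (M.comap e) = (2 ^ finrank ℚ_[2] F) ^ n := by
    rw [AddSubgroup.relIndex_comap, AddSubgroup.map_comap_eq_self_of_surjective he, hidx]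
  have hSm' : MeasurableSet ((S.comap e : AddSubgroup (ι → F)) : Set (ι → F)) :=
    measurable_equivFun_symm b hSm
  have hμ : μ (M.comap e : AddSubgroup (ι → F)) =
      ((2 ^ finrank ℚ_[2] F) ^ n : ℕ) * μ (S.comap e : AddSubgroup (ι → F)) := by
    rw [← hidx']
    exact measure_eq_relIndex_mul μ (AddSubgroup.comap_mono hle) hSm'
      (by rw [hidx']; positivity)
  have hS₀' : b.equivFun.symm ⁻¹' S₀ =
      (fun y => -b.equivFun w + y) ⁻¹' (S.comap e : AddSubgroup (ι → F)) := by
    ext y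
    rw [Set.mem_preimage, hS₀, Set.mem_preimage, SetLike.mem_coe, AddSubgroup.mem_comap]
    have : e (-b.equivFun w + y) = b.equivFun.symm y - w := by
      change b.equivFun.symm (-b.equivFun w + y) = _
      rw [map_add, map_neg, LinearEquiv.symm_apply_apply, neg_add_eq_sub]
    rw [this]
  have hS₀m : MeasurableSet[linMeasurableSpace F W] S₀ := by
    have h1 : Measurable[linMeasurableSpace F W, linMeasurableSpace F W] fun X : W => X - w := by
      rw [measurable_iff_comap_le, MeasurableSpace.comap_iSup]
      refine iSup_le fun l => ?_
      rw [MeasurableSpace.comap_comp, ← measurable_iff_comap_le]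
      have h2 : Measurable[linMeasurableSpace F W] l := by
        rw [measurable_iff_comap_le]
        exact le_iSup (fun l : Module.Dual F W => MeasurableSpace.comap l inferInstance) l
      have h3 : (l ∘ fun X : W => X - w) = fun X => l X - l w := funext fun X => map_sub l X w
      rw [h3]
      exact h2.sub_const _
    have h2 : S₀ = (fun X : W => X - w) ⁻¹' (S : Set W) := Set.ext hS₀
    rw [h2]
    exact h1 hSm
  rw [hM₀, formMeasure_apply ω hb hMm] at hω
  rw [formMeasure_apply ω' hb hS₀m, hS₀', measure_preimage_add] at hω'
  have hω2 : (nabs (ω b) : ℝ≥0∞) * (((2 ^ finrank ℚ_[2] F) ^ n : ℕ) *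
      μ (S.comap e : AddSubgroup (ι → F))) = 1 := by
    rw [← hμ]
    exact hω
  set m := μ (S.comap e : AddSubgroup (ι → F))
  -- The normalization of ω' itself excludes the volumes 0 and ∞, so that m may be cancelled.
  have hm0 : m ≠ 0 := by
    intro h
    rw [h, mul_zero] at hω'
    exact zero_ne_one hω'
  have hm1 : m ≠ ⊤ := by
    intro h
    rw [h] at hω'
    by_cases h1 : (nabs (ω' b) : ℝ≥0∞) = 0
    · rw [h1, zero_mul] at hω'
      exact zero_ne_one hω'
    · rw [ENNReal.mul_top h1] at hω'
      exact ENNReal.top_ne_one hω'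
  have key : (nabs (ω' b) : ℝ≥0∞) = nabs (ω b) * ((2 ^ finrank ℚ_[2] F) ^ n : ℕ) := by
    refine (ENNReal.mul_left_inj hm0 hm1).1 ?_
    rw [mul_assoc, hω2]
    exact hω'
  have key' : nabs (ω' b) = nabs (ω b) * (2 ^ finrank ℚ_[2] F) ^ n := by exact_mod_cast key
  have h2 : (2 : ℝ≥0) ^ finrank ℚ_[2] F ≠ 0 := pow_ne_zero _ two_ne_zero
  rw [key', nabs_two, inv_pow, mul_comm, mul_assoc, mul_inv_cancel₀ (pow_ne_zero _ h2), mul_one]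

theorem formMeasure_eq_smul {ω ω' : W [⋀^ι]→ₗ[F] F} (hb : Nonempty (Basis ι F W)) {c : ℝ≥0}
    (h : nabs (ω hb.some) = c * nabs (ω' hb.some)) : formMeasure ω = c • formMeasure ω' := by
  rw [formMeasure, formMeasure, dif_pos hb, dif_pos hb, h, smul_smul]

theorem nabs_zero : nabs (0 : F) = 0 := by
  rw [nabs, Algebra.norm_zero, nnnorm_zero]

/-- Top degree forms are determined by their value on one basis. Proportionality of the forms
themselves, rather than of their measures, is what the quotient form requires. -/
theorem exists_eq_smul_form {ω ω' : W [⋀^ι]→ₗ[F] F} (b : Basis ι F W) {q : ℝ≥0} (hq : q ≠ 0)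
    (hω' : nabs (ω' b) ≠ 0) (h : nabs (ω b) = q * nabs (ω' b)) :
    ∃ c : F, c ≠ 0 ∧ nabs c = q ∧ ω = c • ω' := by
  classical
  have h0 : ω' b ≠ 0 := by
    intro h0
    rw [h0, nabs_zero] at hω'
    exact hω' rfl
  have h1 : ω b / ω' b * ω' b = ω b := div_mul_cancel₀ _ h0
  have h2 : nabs (ω b / ω' b) = q := by
    refine mul_right_cancel₀ hω' ?_
    rw [← nabs_mul, h1, h]
  refine ⟨ω b / ω' b, ?_, h2, ?_⟩
  · intro h3
    rw [h3, nabs_zero] at h2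
    exact hq h2.symm
  · generalize ω b / ω' b = c at h1
    rw [AlternatingMap.eq_smul_basis_det b ω, AlternatingMap.eq_smul_basis_det b ω', smul_smul, h1]

theorem nabs_apply_ne_zero {ω : W [⋀^ι]→ₗ[F] F} {Y : Set W} (hb : Nonempty (Basis ι F W))
    (hY : formMeasure ω Y = 1) : nabs (ω hb.some) ≠ 0 := by
  intro h
  rw [formMeasure, dif_pos hb, h] at hY
  simp at hY

end FormMeasure

/-! ### Scaling of quotient forms and of the measures on the group. -/

section QuotForm

/-- Equal predicates select the same witness. The quotient forms before and after scaling are thus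
evaluated on the same vectors Y, and independence of Y need not be discussed. -/
theorem dite_exists_congr {α β : Type*} {P Q : α → Prop} [Decidable (∃ y, P y)]
    [Decidable (∃ y, Q y)] (h : P = Q) (a : α → β) (b : β) :
    (if hY : ∃ y, P y then a hY.choose else b) = if hY : ∃ y, Q y then a hY.choose else b := by
  subst h
  congr

variable {F E V : Type*} [Field F] [Field E] [Algebra F E] [AddCommGroup V] [Module E V]
  [Module F V] [IsScalarTower F E V] {σ : E ≃ₐ[F] E}

theorem quotForm_smul {ι κ : Type*} (h : hermForms σ V)
    (ωM : (Module.End E V) [⋀^(ι ⊕ κ)]→ₗ[F] F) (ωH : (hermForms σ V) [⋀^κ]→ₗ[F] F) (a : F) {c : F}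
    (hc : c ≠ 0) (g : Module.End E V) (X : ι → Module.End E V) :
    quotForm h (a • ωM) (c • ωH) g X = a / c * quotForm h ωM ωH g X := by
  classical
  unfold quotForm
  have hP : (fun Y : κ → Module.End E V => (c • ωH) (fun j => drho h g (Y j)) ≠ 0) =
      fun Y => ωH (fun j => drho h g (Y j)) ≠ 0 := by
    funext Y
    rw [AlternatingMap.smul_apply, smul_eq_mul, mul_ne_zero_iff, and_iff_right hc]
  rw [dite_exists_congr hP (fun Y => (a • ωM) (Sum.elim X Y) / (c • ωH) (fun j => drho h g (Y j))) 0]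
  split_ifs with hY
  · rw [AlternatingMap.smul_apply, AlternatingMap.smul_apply, smul_eq_mul, smul_eq_mul,
      mul_div_mul_comm]
  · rw [mul_zero]

end QuotForm

section GroupMeasure

variable {F E V : Type*} [NontriviallyNormedField F] [Field E] [Algebra F E] [AddCommGroup V]
  [Module E V] [Module F V] [IsScalarTower F E V] {σ : E ≃ₐ[F] E}
  [NormedAlgebra ℚ_[2] F] [FiniteDimensional ℚ_[2] F] [MeasurableSpace F] [BorelSpace F]

theorem Param.measure_mul {h : hermForms σ V} {d : ℕ} (φ : Param (F := F) h d) (c : F)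
    (τ : Module.End E V → (Fin d → Module.End E V) → F) :
    φ.measure (fun g X => c * τ g X) = nabs c • φ.measure τ := by
  unfold Param.measure
  have h1 : (fun u => (nabs (c * τ (φ.toFun u) (φ.pderiv u)) : ℝ≥0∞)) =
      (nabs c : ℝ≥0∞) • fun u => (nabs (τ (φ.toFun u) (φ.pderiv u)) : ℝ≥0∞) := by
    funext u
    rw [nabs_mul, ENNReal.coe_mul]
    rfl
  rw [h1, withDensity_smul' _ _ ENNReal.coe_ne_top]
  exact Measure.map_smul _ _ _

/-- Scaling by c is monotone with monotone inverse, so it commutes with suprema. -/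
theorem iSup_smul_measure {α ι : Type*} [MeasurableSpace α] (ν : ι → Measure α) {c : ℝ≥0}
    (hc : c ≠ 0) : ⨆ i, c • ν i = c • ⨆ i, ν i := by
  have hmono : ∀ (a : ℝ≥0) {μ μ' : Measure α}, μ ≤ μ' → a • μ ≤ a • μ' := by
    intro a μ μ' hle
    refine Measure.le_iff.2 fun s _ => ?_
    rw [Measure.smul_apply, Measure.smul_apply]
    exact mul_le_mul_right (hle s) (a : ℝ≥0∞)
  apply le_antisymm
  · exact iSup_le fun i => hmono c (le_iSup ν i)
  · have h1 : ⨆ i, ν i ≤ c⁻¹ • ⨆ i, c • ν i := by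
      refine iSup_le fun i => ?_
      have h2 := hmono c⁻¹ (le_iSup (fun i => c • ν i) i)
      rwa [smul_smul, inv_mul_cancel₀ hc, one_smul] at h2
    have h2 := hmono c h1
    rwa [smul_smul, mul_inv_cancel₀ hc, one_smul] at h2

theorem groupMeasure_mul {h : hermForms σ V} {d : ℕ} {c : F} (hc : nabs c ≠ 0)
    (τ : Module.End E V → (Fin d → Module.End E V) → F) :
    groupMeasure (F := F) h (fun g X => c * τ g X) = nabs c • groupMeasure h τ := by
  unfold groupMeasure
  simp only [Param.measure_mul]
  exact @iSup_smul_measure _ _ (linMeasurableSpace F (Module.End E V)) _ _ hc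

end GroupMeasure

/-! ### Measurability of the lattices. -/

section Measurability

variable {F E : Type*} [NontriviallyNormedField F] [NormedAlgebra ℚ_[2] F]
  [FiniteDimensional ℚ_[2] F] [MeasurableSpace F] [BorelSpace F]
  [Field E] [Algebra F E] {σ : E ≃ₐ[F] E} {π : E} (R : IsRamified F σ π)
include R

/-- The σ-algebra is generated by F-valued functionals, so membership in π^i B is first split into
conditions on the two F-coordinates of E. -/
theorem measurableSet_mem_pideal {W : Type*} [AddCommGroup W] [Module F W] (φ : W →ₗ[F] E) (i : ℤ) :
    MeasurableSet[linMeasurableSpace F W] {X | φ X ∈ pideal F π i} := by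
  obtain ⟨re, im, hc⟩ := R.coord
  simp only [hc]
  exact @MeasurableSet.inter _ (linMeasurableSpace F W) _ _
    (measurableSet_mem_dyad (re ∘ₗ φ) _) (measurableSet_mem_dyad (im ∘ₗ φ) _)

variable {V : Type*} [AddCommGroup V] [Module E V] [Module F V] [IsScalarTower F E V]
  {K : Type*} [Fintype K] {h : hermForms σ V} {L : Submodule (intRingExt F E) V}
  {d : K → ℤ} {x u : Basis K E V} {T : Finset K}

omit R in
/-- A matrix entry, as a linear form over `F`. -/
def entryM (x u : Basis K E V) (k l : K) : Module.End E V →ₗ[F] E where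
  toFun X := x.repr (X (u l)) k
  map_add' X Y := by simp
  map_smul' c X := by
    rw [LinearMap.smul_apply, ← algebraMap_smul E c (X (u l)), map_smul, Finsupp.smul_apply,
      smul_eq_mul, RingHom.id_apply, Algebra.smul_def]

omit R [Fintype K] in
/-- An entry of the Gram matrix, as a linear form over `F`. -/
def entryH (σ : E ≃ₐ[F] E) (u : Basis K E V) (k l : K) : hermForms σ V →ₗ[F] E where
  toFun g := g (u k) (u l)
  map_add' _ _ := rfl
  map_smul' _ _ := rfl

theorem measurableSet_latM (f : IsFrame h π L d x u T) :
    MeasurableSet[linMeasurableSpace F (Module.End E V)] (latM L : Set (Module.End E V)) := by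
  let : MeasurableSpace (Module.End E V) := linMeasurableSpace F (Module.End E V)
  have h1 : (latM L : Set (Module.End E V)) =
      ⋂ p : K × K, {X | entryM (F := F) x u p.1 p.2 X ∈ pideal F π 0} := by
    ext X
    rw [Set.mem_iInter]
    exact mem_naiveM_iff f R
  rw [h1]
  exact MeasurableSet.iInter fun p => measurableSet_mem_pideal R _ _

theorem measurableSet_mCond :
    MeasurableSet[linMeasurableSpace F (Module.End E V)]
      {X : Module.End E V | MCond F π d x u T X} := by
  let : MeasurableSpace (Module.End E V) := linMeasurableSpace F (Module.End E V)
  have h1 : {X : Module.End E V | MCond F π d x u T X} =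
      (⋂ k, ⋂ l, {X | entryM (F := F) x u k l X ∈ pideal F π (max 0 (d l - d k))}) ∩
      (⋂ l, {X | (∑ t ∈ near d T (d l), π ^ (-max 0 (d l - d t)) • entryM (F := F) x u t l) X ∈
        pideal F π 1}) ∩
      (⋂ k, {X | (∑ t ∈ near d T (d k), π ^ (-max 0 (d t - d k)) • entryM (F := F) x u k t) X ∈
        pideal F π 1}) ∩
      (⋂ t, ⋂ (_ : t ∈ T), ⋂ (_ : Even (d t)),
        {X | (∑ s ∈ T with expX (d t) (d s) + (d s + 1) / 2 = d t / 2 + 1,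
          π ^ (-expX (d t) (d s)) • entryM (F := F) x u s t) X ∈ pideal F π 1}) := by
    ext X
    simp only [Set.mem_inter_iff, Set.mem_iInter, Set.mem_ofPred_eq, LinearMap.sum_apply,
      LinearMap.smul_apply, smul_eq_mul]
    constructor
    · intro C
      exact ⟨⟨⟨C.entry, fun l => by have := C.row l; rwa [phi_apply] at this⟩, C.col⟩, C.diag⟩
    · rintro ⟨⟨⟨h1, h2⟩, h3⟩, h4⟩
      exact ⟨h1, fun l => by rw [phi_apply]; exact h2 l, h3, h4⟩
  rw [h1]
  refine ((MeasurableSet.inter ?_ ?_).inter ?_).inter ?_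
  · exact MeasurableSet.iInter fun k => MeasurableSet.iInter fun l => measurableSet_mem_pideal R _ _
  · exact MeasurableSet.iInter fun l => measurableSet_mem_pideal R _ _
  · exact MeasurableSet.iInter fun k => measurableSet_mem_pideal R _ _
  · exact MeasurableSet.iInter fun t => MeasurableSet.iInter fun _ => MeasurableSet.iInter fun _ =>
      measurableSet_mem_pideal R _ _

theorem measurableSet_latH (f : IsFrame h π L d x u T) :
    MeasurableSet[linMeasurableSpace F (hermForms σ V)] (latH σ L : Set (hermForms σ V)) := by
  classical
  let : MeasurableSpace (hermForms σ V) := linMeasurableSpace F (hermForms σ V)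
  have hu : ∀ k, u k ∈ L := fun k => by
    rw [f.mem_right, ← one_smul E (u k)]
    exact basis_mem_box isOrd_one.2.1
  have h1 : (latH σ L : Set (hermForms σ V)) =
      ⋂ k, ⋂ l, {g | entryH σ u k l g ∈ pideal F π 0} := by
    ext g
    simp only [Set.mem_iInter]
    constructor
    · exact fun hg k l => mem_pideal_zero.2 (hg _ (hu k) _ (hu l))
    · intro hg v hv w hw
      rw [← mem_pideal_zero (π := π)]
      exact herm_mem_of_box R g ((f.mem_right v).1 hv) ((f.mem_right w).1 hw) fun k l =>
        ⟨0, hg k l, by simp⟩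
  rw [h1]
  exact MeasurableSet.iInter fun k => MeasurableSet.iInter fun l => measurableSet_mem_pideal R _ _

theorem measurableSet_hCond :
    MeasurableSet[linMeasurableSpace F (hermForms σ V)]
      {g : hermForms σ V | HCond π d u T g} := by
  let : MeasurableSpace (hermForms σ V) := linMeasurableSpace F (hermForms σ V)
  have h1 : {g : hermForms σ V | HCond π d u T g} =
      (⋂ k, ⋂ l, {g | entryH σ u k l g ∈ pideal F π (max (d k) (d l))}) ∩
      (⋂ k, {g | entryH σ u k k g ∈ pideal F π (2 * ((d k + 1) / 2) + 2)}) ∩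
      (⋂ k, {g | (∑ t ∈ near d T (d k), π ^ (-max (d k) (d t)) • entryH σ u k t) g ∈
        pideal F π 1}) ∩
      (⋂ t, ⋂ (_ : t ∈ T), ⋂ (_ : Even (d t)), {g | entryH σ u t t g ∈ pideal F π (d t + 4)}) := by
    ext g
    simp only [Set.mem_inter_iff, Set.mem_iInter, Set.mem_ofPred_eq, LinearMap.sum_apply,
      LinearMap.smul_apply, smul_eq_mul]
    exact ⟨fun C => ⟨⟨⟨C.entry, C.norm⟩, C.col⟩, C.diag⟩, fun ⟨⟨⟨h1, h2⟩, h3⟩, h4⟩ =>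
      ⟨h1, h2, h3, h4⟩⟩
  rw [h1]
  refine ((MeasurableSet.inter ?_ ?_).inter ?_).inter ?_
  · exact MeasurableSet.iInter fun k => MeasurableSet.iInter fun l => measurableSet_mem_pideal R _ _
  · exact MeasurableSet.iInter fun k => measurableSet_mem_pideal R _ _
  · exact MeasurableSet.iInter fun k => measurableSet_mem_pideal R _ _
  · exact MeasurableSet.iInter fun t => MeasurableSet.iInter fun _ => MeasurableSet.iInter fun _ =>
      measurableSet_mem_pideal R _ _

end Measurability

/-- An enumeration of a finite type for which odd degrees come before even ones. -/
theorem exists_enumeration {K : Type*} [Fintype K] (d : K → ℤ) : ∃ e : K → ℕ,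
    Function.Injective e ∧ ∀ k l, Odd (d k) → Even (d l) → e k < e l := by
  classical
  let e₀ := Fintype.equivFin K
  refine ⟨fun k => (if Odd (d k) then 0 else Fintype.card K) + e₀ k, fun k l hkl => ?_,
    fun k l hk hl => ?_⟩
  · have h1 := (e₀ k).2
    have h2 := (e₀ l).2
    refine e₀.injective (Fin.ext ?_)
    beta_reduce at hkl
    split_ifs at hkl <;> omega
  · have h1 := (e₀ k).2
    beta_reduce
    rw [if_pos hk, if_neg (Int.not_odd_iff_even.2 hl)]
    omega

end HermLat

end

theorem lemma5p1
    {F E V : Type*}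
    -- `F` is a finite extension of `ℚ₂`, unramified: `2` is a uniformizer of `A`
    [NontriviallyNormedField F] [NormedAlgebra ℚ_[2] F] [FiniteDimensional ℚ_[2] F]
    [MeasurableSpace F] [BorelSpace F]
    (hunram : Irreducible (2 : HermLat.intRing F))
    -- `E = F(π)` with `π² = 2δ`, `δ ≡ 1` mod `2`
    [Field E] [Algebra F E] (hE : Module.finrank F E = 2)
    (π : E) (δ : HermLat.intRing F)
    (hπ : π ^ 2 = algebraMap F E (2 * (δ : F)))
    (hδ : (2 : HermLat.intRing F) ∣ δ - 1)
    -- the non-trivial automorphism of `E / F`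
    (σ : E ≃ₐ[F] E) (hσ : σ ≠ AlgEquiv.refl)
    -- the nondegenerate hermitian space `(V, h)`
    [AddCommGroup V] [Module E V] [Module F V] [IsScalarTower F E V] [FiniteDimensional E V]
    (h : HermLat.hermForms σ V)
    (hnondeg : ∀ v, (∀ w, h v w = 0) → v = 0)
    -- the hermitian lattice `(L, h)`
    (L : Submodule (HermLat.intRingExt F E) V) (hfg : L.FG)
    (hspan : Submodule.span E (L : Set V) = ⊤)
    (hint : ∀ x ∈ L, ∀ y ∈ L, h x y ∈ HermLat.intRingExt F E)
    -- a Jordan splitting `L = ⨁ L_i`, with `L_i = 0` unless `0 ≤ i < N`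
    (J : ℤ → Submodule (HermLat.intRingExt F E) V)
    (hJ : HermLat.IsJordanSplitting π h L J)
    (N : ℕ) (hN : ∀ i, J i ≠ ⊥ → 0 ≤ i ∧ i < N)
    -- the translation-invariant top forms `ω_M`, `ω_M'` on `End_E V` (of dimension `n² + n²`)
    -- and `ω_H`, `ω_H'` on `H` (of dimension `n²`)
    (ωM ωM' : (Module.End E V)
      [⋀^(Fin (Module.finrank E V ^ 2) ⊕ Fin (Module.finrank E V ^ 2))]→ₗ[F] F)
    (ωH ωH' : (HermLat.hermForms σ V) [⋀^(Fin (Module.finrank E V ^ 2))]→ₗ[F] F)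
    (hωM : HermLat.formMeasure ωM (HermLat.naiveM L) = 1)
    (hωH : HermLat.formMeasure ωH (HermLat.naiveH σ L) = 1)
    (hωM' : HermLat.formMeasure ωM' (HermLat.modelM π h L) = 1)
    (hωH' : HermLat.formMeasure ωH' (HermLat.modelH π h L) = 1) :
    -- `|ω_M| = |2|^{N_M} |ω_M'|`
    HermLat.formMeasure ωM =
      HermLat.nabs (2 : F) ^ HermLat.expM π h L J N •
        HermLat.formMeasure ωM' ∧
    -- `|ω_H| = |2|^{N_H} |ω_H'|`
    HermLat.formMeasure ωH =
      HermLat.nabs (2 : F) ^ HermLat.expH π h L J N •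
        HermLat.formMeasure ωH' ∧
    -- `|ω^ld| = |2|^{N_M - N_H} |ω^can|`, as densities on the tangent spaces of `G(F)` ...
    (∀ g ∈ HermLat.unitaryPts h, ∀ X : Fin (Module.finrank E V ^ 2) → Module.End E V,
      HermLat.IsTangent h g X →
      HermLat.nabs (HermLat.quotForm h ωM ωH g X) =
        HermLat.nabs (2 : F) ^ (HermLat.expM π h L J N -
            HermLat.expH π h L J N) *
          HermLat.nabs (HermLat.quotForm h ωM' ωH' g X)) ∧
    -- ... and as measures on `G(F)`
    HermLat.groupMeasure h (HermLat.quotForm h ωM ωH) =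
      HermLat.nabs (2 : F) ^ (HermLat.expM π h L J N -
          HermLat.expH π h L J N) •
        HermLat.groupMeasure h (HermLat.quotForm h ωM' ωH') := by
  classical
  have R := HermLat.isRamified hunram hE π δ hπ hδ σ hσ
  obtain ⟨K, hK, d, x, u, T, f, hd, hn, hI⟩ := HermLat.exists_isFrame R hnondeg hfg hspan hJ hN
  obtain ⟨ρ, P⟩ := f.exists_isPivot
  obtain ⟨e, he, hpar⟩ := HermLat.exists_enumeration d
  obtain ⟨SM, hSM, hSMle, hSMidx⟩ := HermLat.exists_lattice_modelM f R P
  obtain ⟨SH, hSH, hSHle, hSHidx⟩ := HermLat.exists_lattice_modelH f R P (fun k => (hd k).1) he hpar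
  have hbM := HermLat.nonempty_basis_of_formMeasure hωM
  have hbH := HermLat.nonempty_basis_of_formMeasure hωH
  -- The model is the translate by 1 of the lattice `SM`, respectively by h of the lattice `SH`;
  -- invariance of the measure removes the translation.
  have hM := HermLat.nabs_apply_basis_eq hbM rfl
    (fun X => (HermLat.isModelM_iff f R).trans (hSM (X - 1)).symm) hSMle
    (by
      have : (SM : Set (Module.End E V)) = {X | HermLat.MCond F π d x u T X} := Set.ext hSM
      rw [this]
      exact HermLat.measurableSet_mCond R)
    (HermLat.measurableSet_latM R f) hSMidx hωM hωM'
  have hH := HermLat.nabs_apply_basis_eq hbH rfl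
    (fun X => (HermLat.isModelH_iff f R fun k => (hd k).1).trans (hSH (X - h)).symm) hSHle
    (by
      have : (SH : Set (HermLat.hermForms σ V)) = {X | HermLat.HCond π d u T X} := Set.ext hSH
      rw [this]
      exact HermLat.measurableSet_hCond R)
    (HermLat.measurableSet_latH R f) hSHidx hωH hωH'
  rw [← zpow_natCast, HermLat.exponentM_eq f P hd hn hI] at hM
  rw [← zpow_natCast, HermLat.exponentH_eq f P hd hn hI he] at hH
  have h2 : HermLat.nabs (2 : F) ≠ 0 := HermLat.nabs_two_ne_zero
  obtain ⟨a, ha0, ha, haM⟩ := HermLat.exists_eq_smul_form hbM.some (zpow_ne_zero _ h2)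
    (HermLat.nabs_apply_ne_zero hbM hωM') hM
  obtain ⟨c, hc0, hc, hcH⟩ := HermLat.exists_eq_smul_form hbH.some (zpow_ne_zero _ h2)
    (HermLat.nabs_apply_ne_zero hbH hωH') hH
  -- The constant a / c does not depend on the point g, so the same factor |a / c| governs the
  -- tangent space densities and the global measure.
  have hquot : HermLat.quotForm h ωM ωH = fun g (X : Fin (Module.finrank E V ^ 2) → _) =>
      a / c * HermLat.quotForm h ωM' ωH' g X := by
    funext g X
    rw [haM, hcH, HermLat.quotForm_smul h ωM' ωH' a hc0]
  have hac : HermLat.nabs (a / c) = HermLat.nabs (2 : F) ^ (HermLat.expM π h L J N -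
      HermLat.expH π h L J N) := by
    have h1 : HermLat.nabs (a / c) * HermLat.nabs c = HermLat.nabs a := by
      rw [← HermLat.nabs_mul, div_mul_cancel₀ _ hc0]
    rw [zpow_sub₀ h2, ← ha, ← hc, eq_div_iff (by rw [hc]; exact zpow_ne_zero _ h2), h1]
  refine ⟨HermLat.formMeasure_eq_smul hbM hM, HermLat.formMeasure_eq_smul hbH hH,
    fun g _ X _ => ?_, ?_⟩
  · rw [hquot, HermLat.nabs_mul, hac]
  · rw [hquot, HermLat.groupMeasure_mul (by rw [hac]; exact zpow_ne_zero _ h2), hac]
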